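/- **Network.** Let $\Psi:\mathbb R^{4n}\times\mathbb R^{\mathtt p}\to\mathbb R^n$ be a ResNet with blocks $0,\dots,b$. Block $i$ has $k_i\ge1$ hidden layers, widths $L_{i,0},\dots,L_{i,k_i+1}\geq 1$ ($L_{0,0}=4n$, $L_{i,0}=n$ for $i\ge1$, $L_{i,k_i+1}=n$) and weight matrices $V_{i,j}\in\mathbb R^{(L_{i,j}+1)\times L_{i,j+1}}$. It is $\Phi_i(v)=\varphi_{i,k_i}(v)$ with $\varphi_{i,0}(v)=V_{i,0}^\top v$, $\varphi_{i,j}(v)=V_{i,j}^\top\phi_{i,j}(\varphi_{i,j-1}(v))$, where $\phi_{i,j}$ applies smooth scalar activations componentwise and appends a $1$. Put $\kappa_1=\Phi_0([\kappa^\top\,1]^\top)$, $\kappa_{i+1}=\kappa_i+\Phi_i(\psi_i(\kappa_i))$ for $1\le i\le b$ (with $\psi_i$ again componentwise smooth activations followed by an appended $1$), and $\Psi(\kappa,\Theta)=\kappa_{b+1}$, where $\Theta\in\mathbb R^{\mathtt p}$ stacks the entries of all $V_{i,j}$. **System.** Consider $\ddot q=f(q,\dot q)+g(q,\dot q,t)u+\omega(t)$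 with $f,g,\omega$ of class $C^1$ ($t\ge0$), $g(q,\dot q,t)\in\mathbb R^{n\times m}$ of full row rank, $\|\omega(t)\|\le\overline\omega$, and $g^+=g^\top(gg^\top)^{-1}$ bounded uniformly in $t\ge 0$ on bounded sets of $(q,\dot q)$. Let $q_d$ solve $\ddot q_d=f_d(q_d,\dot q_d)$ on $[0,\infty)$ with $\|q_d(t)\|\le\overline q_d$, $\|\dot q_d(t)\|\le\overline{\dot q}_d$ for all $t\geq 0$. Put $e=q_d-q$, $r=\dot e+k_1e$, $\kappa=[q^\top\,\dot q^\top\,q_d^\top\,\dot q_d^\top]^\top$, $h(\kappa)=f_d(q_d,\dot q_d)-f(q,\dot q)$. **Search space and projection.** Let $\mho=\{P\le0\}\subset\mathbb R^{\mathtt p}$ be compact, with $P:\mathbb R^{\mathtt p}\to\mathbb R$ smooth and convex; let $\overline\Theta=\max_{\mho}\|\Theta\|$. Let $\mathcal J:\mho\to[0,\infty)$ be continuous and strictly convex, and let $\Theta^*=\arg\min_\mho\mathcal J$. Let $\Gamma$ be symmetric positive definite, and fix $\epsilon\ge0$ with $P(0)<-\epsilon$, and with $P(\Theta^*)\le-\epsilon$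 if $\epsilon>0$. Put $\mathrm{proj}_\mho(\tau)=\tau$ if $\nabla P(\widehat\Theta)^\top\tau\le0$, and otherwise $$\mathrm{proj}_\mho(\tau)=\Big(I-c(\widehat\Theta)\frac{\Gamma\nabla P\nabla P^\top}{\nabla P^\top\Gamma\nabla P}\Big)\tau,$$ where $c=1$ if $P(\widehat\Theta)\ge0$, $c=0$ if $P(\widehat\Theta)<0$ and $P(\widehat\Theta)\le-\epsilon$, and $c=(P(\widehat\Theta)+\epsilon)/\epsilon$ otherwise. Thus $\epsilon=0$ is the standard projection and $\epsilon>0$ its continuous version with a boundary layer. **Controller.** With $k_1,k_2,k_3,\lambda_V>0$ let $$u=g^+\big((1-k_1^2)e+(k_1+k_2)r+\Psi(\kappa,\widehat\Theta)\big),\qquad \dot{\widehat\Theta}=\mathrm{proj}_\mho\Big(\Gamma\Big(\tfrac{\partial\Psi(\kappa,\widehat\Theta)}{\partial\widehat\Theta}^{\top} r-k_3\widehat\Theta\Big)\Big),$$ the second equation in integrated (Carathéodory) form. Put $\widetilde\Theta=\Theta^*-\widehat\Theta$, $z=[e^\top\,r^\top\,\widetilde\Theta^\top]^\top$, and let $\lambda_1,\lambda_\varphi$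 be the smallest and largest eigenvalues of $\mathrm{blkdiag}\{I_{2n},\Gamma^{-1}\}$. **Constants and sets.** Let $R=\Psi(\kappa,\Theta^*)-\Psi(\kappa,\widehat\Theta)-\frac{\partial\Psi(\kappa,\widehat\Theta)}{\partial\widehat\Theta}\widetilde\Theta$. Call $\rho_0:[0,\infty)\to[0,\infty)$ a remainder bound if it is continuous, strictly increasing, unbounded and $\|R\|\le\rho_0(\|\kappa\|)\|\widetilde\Theta\|^2$ for all $\kappa\in\mathbb R^{4n}$, $\widehat\Theta\in\mho$. Given $\rho_0$ and $\overline\varepsilon$, let $\rho(s)=3\overline\Theta^2\rho_0((k_1+2)s+2(\overline q_d+\overline{\dot q}_d))^2$, $\overline\rho=\rho-\rho(0)$, $k_{\min}=\min\{k_1,\frac{k_2}3,\frac{k_3}2\}$, $\delta=\frac{3(\overline\omega+\overline\varepsilon)^2}{4k_2}+\frac{k_3\overline\Theta^2}2$, $\chi=\overline\rho^{-1}(k_2(k_{\min}-\lambda_V)-\rho(0))$, and $$\mathcal D=\{\|\iota\|\le\chi\},\quad \Omega=\{\|\iota\|\le2(\overline q_d+\overline{\dot q}_d)+(k_1+2)\chi\},$$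 $$\mathcal S=\Big\{\|\iota\|\le\sqrt{\tfrac{\lambda_1}{\lambda_\varphi}}\chi-\sqrt{\tfrac{\delta}{\lambda_V}}\Big\},\quad \mathcal U=\Big\{\|\iota\|\le\sqrt{\tfrac{\lambda_\varphi\delta}{\lambda_1\lambda_V}}\Big\},$$ where $\Omega\subset\mathbb R^{4n}$ and $\mathcal D,\mathcal S,\mathcal U\subset\mathbb R^{2n+\mathtt p}$. **Theorem.** 1. A remainder bound exists; if all activations have bounded first and second derivatives, there is one of the form $\rho_0(s)=a_2s^2+a_1s+a_0$ with $a_0,a_1,a_2\ge0$. 2. Let $\rho_0$ be any remainder bound, suppose that $\|h(\kappa)-\Psi(\kappa,\Theta^*)\|\le\overline\varepsilon$ on $\Omega$ and that $$k_{\min}>\lambda_V+\frac1{k_2}\rho\Big(\sqrt{\tfrac{\lambda_\varphi\delta}{\lambda_1\lambda_V}}\Big).$$ Then for every $t_0\ge0$ and every initial condition with $z(t_0)\in\mathcal S$ and $\widehat\Theta(t_0)\in\mho$ the closed loop has a unique solution; it exists on $[t_0,\infty)$, and for all $t\ge t_0$ $$\|z(t)\|\le\sqrt{\tfrac{\lambda_\varphi}{\lambda_1}\|z(t_0)\|^2e^{-\frac{2\lambda_V}{\lambda_\varphi}(t-t_0)}+\tfrac{\lambda_\varphi\delta}{\lambda_1\lambda_V}\big(1-e^{-\frac{2\lambda_V}{\lambda_\varphi}(t-t_0)}\big)},$$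 $z(t)\in\mathcal D$, $\kappa(t)\in\Omega$ and $\widehat\Theta(t)\in\mho$. Moreover the distance of $z(t)$ to $\mathcal U$ tends to $0$, and $q,\dot q,\widehat\Theta,z,\kappa,u$ are bounded on $[t_0,\infty)$. -/

import Mathlib

open Set Filter Topology MeasureTheory
open scoped Matrix ContDiff

noncomputable section

/-- The Euclidean space `ℝ^d`. -/
abbrev Vec (d : ℕ) : Type := EuclideanSpace ℝ (Fin d)

/-- Matrix-vector product between Euclidean spaces. -/
def mv {ι κ : Type*} [Fintype κ] (A : Matrix ι κ ℝ) (x : EuclideanSpace ℝ κ) :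
    EuclideanSpace ℝ ι :=
  WithLp.toLp 2 (A *ᵥ x.ofLp)

/-- Append the entry `1` (bias input) at the end of a vector. -/
def augment {d : ℕ} (x : Fin d → ℝ) : Fin (d + 1) → ℝ :=
  Fin.snoc (α := fun _ => ℝ) x 1

/-! ### The pre-activation ResNet with a zeroth block -/

/-- Architecture and activation functions of a ResNet with blocks `0, …, b`. Block `i` has `k i`
hidden layers; `L i j` is the number of neurons of its `j`-th layer, `0 ≤ j ≤ k i + 1`. Data with
`i > b` or `j > k i + 1` are never used. -/
structure ResNet (Lin Lout : ℕ) where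
  b : ℕ
  k : ℕ → ℕ
  k_pos : ∀ i, 0 < k i
  L : ℕ → ℕ → ℕ
  L_pos : ∀ i j, 0 < L i j
  L_in_zero : L 0 0 = Lin
  L_in_succ : ∀ i, L (i + 1) 0 = Lout
  L_out : ∀ i, L i (k i + 1) = Lout
  /-- `act i j l` is the activation of neuron `l` of layer `j ≥ 1` in block `i`. -/
  act : ∀ i j, Fin (L i j) → ℝ → ℝ
  act_smooth : ∀ i j l, ContDiff ℝ ∞ (act i j l)
  /-- `pre i l` is the `l`-th component of the pre-activation in front of block `i ≥ 1`. -/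
  pre : ℕ → Fin Lout → ℝ → ℝ
  pre_smooth : ∀ i l, ContDiff ℝ ∞ (pre i l)

namespace ResNet

variable {Lin Lout : ℕ} (N : ResNet Lin Lout)

/-- Positions of the entries of all the weight matrices `V i j`, `i ≤ b`, `j ≤ k i`. -/
abbrev ParamIdx : Type :=
  Σ i : Fin (N.b + 1), Σ j : Fin (N.k i + 1), Fin (N.L i j + 1) × Fin (N.L i (j + 1))

/-- The space of the stacked parameter vectors `Θ`. -/
abbrev Param : Type := EuclideanSpace ℝ N.ParamIdx

/-- The weight matrix `V i j`; its last row holds the biases. -/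
def weight (Θ : N.Param) (i j : ℕ) : Matrix (Fin (N.L i j + 1)) (Fin (N.L i (j + 1))) ℝ :=
  fun a c =>
    if h : i < N.b + 1 ∧ j < N.k i + 1 then Θ ⟨⟨i, h.1⟩, ⟨j, h.2⟩, (a, c)⟩ else 0

/-- The layer recursion of block `i` with augmented input `v`. -/
def layer (Θ : N.Param) (i : ℕ) (v : Fin (N.L i 0 + 1) → ℝ) : (j : ℕ) → Fin (N.L i (j + 1)) → ℝ
  | 0 => (N.weight Θ i 0)ᵀ *ᵥ v
  | j + 1 => (N.weight Θ i (j + 1))ᵀ *ᵥ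
      augment (fun l => N.act i (j + 1) l (layer Θ i v j l))

/-- The fully connected network of block `i`. -/
def block (Θ : N.Param) (i : ℕ) (v : Fin (N.L i 0 + 1) → ℝ) : Fin Lout → ℝ :=
  fun l => N.layer Θ i v (N.k i) (Fin.cast (N.L_out i).symm l)

/-- `resOut Θ x i` is the output of block `i` (input of block `i + 1`) of the ResNet recursion:
the zeroth block has no shortcut, each later block is added to its own input and is fed with
the pre-activated input. -/
def resOut (Θ : N.Param) (x : Fin Lin → ℝ) : ℕ → Fin Lout → ℝ
  | 0 => N.block Θ 0 (augment (fun l => x (Fin.cast N.L_in_zero l)))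
  | i + 1 => resOut Θ x i + N.block Θ (i + 1)
      (augment (fun l => N.pre (i + 1) (Fin.cast (N.L_in_succ i) l)
        (resOut Θ x i (Fin.cast (N.L_in_succ i) l))))

/-- The ResNet map `Ψ(κ, Θ)`. -/
def Psi (x : Vec Lin) (Θ : N.Param) : Vec Lout := WithLp.toLp 2 (N.resOut Θ x.ofLp N.b)

/-- The Jacobian `∂Ψ(κ, Θ)/∂Θ`. -/
def jac (x : Vec Lin) (Θ : N.Param) : N.Param →L[ℝ] Vec Lout := fderiv ℝ (N.Psi x) Θ

/-- The first-order Taylor remainder of `Θ ↦ Ψ(κ, Θ)` at `Θh`, evaluated at `Θs`. -/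
def remainder (x : Vec Lin) (Θs Θh : N.Param) : Vec Lout :=
  N.Psi x Θs - N.Psi x Θh - N.jac x Θh (Θs - Θh)

/-- All activations have bounded first and second derivatives. -/
def BoundedDerivs : Prop :=
  (∀ i j l, ∃ C : ℝ, ∀ x, |deriv (N.act i j l) x| ≤ C ∧ |iteratedDeriv 2 (N.act i j l) x| ≤ C) ∧
  (∀ i l, ∃ C : ℝ, ∀ x, |deriv (N.pre i l) x| ≤ C ∧ |iteratedDeriv 2 (N.pre i l) x| ≤ C)

end ResNet

/-! ### Plant and reference -/

/-- The plant `q̈ = f(q, q̇) + g(q, q̇, t) u + ω(t)`; the disturbance `ω` is the field `dist`. -/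
structure Plant (n m : ℕ) where
  f : Vec n × Vec n → Vec n
  f_smooth : ContDiff ℝ 1 f
  g : Vec n × Vec n × ℝ → Matrix (Fin n) (Fin m) ℝ
  g_smooth : ∀ a c, ContDiffOn ℝ 1 (fun x => g x a c) {x | 0 ≤ x.2.2}
  g_rank : ∀ q v t, 0 ≤ t → (g (q, v, t)).rank = n
  dist : ℝ → Vec n
  dist_smooth : ContDiffOn ℝ 1 dist (Ici 0)

namespace Plant

variable {n m : ℕ} (S : Plant n m)

/-- The right pseudoinverse `g⁺ = gᵀ (g gᵀ)⁻¹`. -/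
def gPlus (q v : Vec n) (t : ℝ) : Matrix (Fin m) (Fin n) ℝ :=
  (S.g (q, v, t))ᵀ * (S.g (q, v, t) * (S.g (q, v, t))ᵀ)⁻¹

/-- `g⁺` is bounded uniformly in time, on bounded sets of states. -/
def GPlusBounded : Prop :=
  ∀ R : ℝ, ∃ M : ℝ, ∀ q v t, ‖q‖ ≤ R → ‖v‖ ≤ R → 0 ≤ t → ∀ a c, |S.gPlus q v t a c| ≤ M

end Plant

/-- `qd, vd` is a position-velocity trajectory on `[0, ∞)` of `q̈_d = f_d(q_d, q̇_d)`. -/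
def IsReference {n : ℕ} (fd : Vec n × Vec n → Vec n) (qd vd : ℝ → Vec n) : Prop :=
  ∀ t, 0 ≤ t → HasDerivWithinAt qd (vd t) (Ici 0) t ∧
    HasDerivWithinAt vd (fd (qd t, vd t)) (Ici 0) t

/-- `κ = [qᵀ q̇ᵀ q_dᵀ q̇_dᵀ]ᵀ ∈ ℝ^{4n}`. -/
def kap {n : ℕ} (q v qd vd : Vec n) : Vec (n + n + n + n) :=
  WithLp.toLp 2 (Fin.append (Fin.append (Fin.append q.ofLp v.ofLp) qd.ofLp) vd.ofLp)

/-! ### Controller -/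

/-- The choices of the designer: the network, the search space `{Θ | P Θ ≤ 0}` given by a smooth
convex function `P`, the width `layer ≥ 0` of the boundary layer of the projection (`0` for the
standard projection), the learning rate matrix, the gains and the rate of convergence. -/
structure Design (n : ℕ) where
  net : ResNet (n + n + n + n) n
  P : net.Param → ℝ
  P_smooth : ContDiff ℝ ∞ P
  P_convex : ConvexOn ℝ univ P
  P_bounded : Bornology.IsBounded {Θ | P Θ ≤ 0}
  layer : ℝ
  layer_nonneg : 0 ≤ layer
  P_zero : P 0 < -layer
  Γ : Matrix net.ParamIdx net.ParamIdx ℝ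
  Γ_posDef : Γ.PosDef
  k₁ : ℝ
  k₁_pos : 0 < k₁
  k₂ : ℝ
  k₂_pos : 0 < k₂
  k₃ : ℝ
  k₃_pos : 0 < k₃
  lamV : ℝ
  lamV_pos : 0 < lamV

namespace Design

variable {n m : ℕ} (d : Design n)

/-- The parameter search space `℧`. -/
def searchSpace : Set d.net.Param := {Θ | d.P Θ ≤ 0}

/-- `Θ̄`, the maximal norm on the search space. -/
def thetaBar : ℝ := sSup (norm '' d.searchSpace)

/-- The weight of the projection: `1` on the boundary of the search space, `0` where
`P ≤ -layer` (in the interior if `layer = 0`), affine in `P` between. -/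
def layerWeight (Θ : d.net.Param) : ℝ :=
  if 0 ≤ d.P Θ then 1 else if -d.layer < d.P Θ then (d.P Θ + d.layer) / d.layer else 0

/-- The projection operator: if `τ` points outwards, its outward part is removed along `Γ ∇P`
(completely on the boundary, to the proportion `layerWeight` in the boundary layer). -/
def proj (Θ τ : d.net.Param) : d.net.Param :=
  if 0 < inner ℝ (gradient d.P Θ) τ then
    τ - (d.layerWeight Θ * inner ℝ (gradient d.P Θ) τ /
      inner ℝ (gradient d.P Θ) (mv d.Γ (gradient d.P Θ))) • mv d.Γ (gradient d.P Θ)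
  else τ

/-- The filtered tracking error `r = ė + k₁ e`, where `e = q_d - q`. -/
def filt (q v qd vd : Vec n) : Vec n := (vd - v) + d.k₁ • (qd - q)

/-- The control input `u`. -/
def control (S : Plant n m) (t : ℝ) (q v qd vd : Vec n) (Θ : d.net.Param) : Vec m :=
  mv (S.gPlus q v t) ((1 - d.k₁ ^ 2) • (qd - q) + (d.k₁ + d.k₂) • d.filt q v qd vd
    + d.net.Psi (kap q v qd vd) Θ)

/-- The right-hand side of the adaptation law. -/
def update (q v qd vd : Vec n) (Θ : d.net.Param) : d.net.Param :=
  d.proj Θ (mv d.Γ (ContinuousLinearMap.adjoint (d.net.jac (kap q v qd vd) Θ)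
    (d.filt q v qd vd) - d.k₃ • Θ))

/-- `(q, v, Θ)` solves the closed loop on the interval `J ∋ t₀`; the adaptation law, whose
right-hand side need not be continuous, is understood in integrated (Carathéodory) form. -/
structure IsSolution (S : Plant n m) (qd vd : ℝ → Vec n) (t₀ : ℝ) (J : Set ℝ)
    (q v : ℝ → Vec n) (Θ : ℝ → d.net.Param) : Prop where
  pos : ∀ t ∈ J, HasDerivWithinAt q (v t) J t
  vel : ∀ t ∈ J, HasDerivWithinAt v (S.f (q t, v t) + mv (S.g (q t, v t, t))
    (d.control S t (q t) (v t) (qd t) (vd t) (Θ t)) + S.dist t) J t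
  cont : ContinuousOn Θ J
  integrable : ∀ t ∈ J, IntervalIntegrable
    (fun s => d.update (q s) (v s) (qd s) (vd s) (Θ s)) volume t₀ t
  adapt : ∀ t ∈ J, Θ t = Θ t₀ + ∫ s in t₀..t, d.update (q s) (v s) (qd s) (vd s) (Θ s)

/-! ### Quantities of the stability statement -/

/-- Index set of the coordinates of `z = [eᵀ rᵀ Θ̃ᵀ]ᵀ`. -/
abbrev StateIdx : Type := (Fin n ⊕ Fin n) ⊕ d.net.ParamIdx

/-- The state space of `z`. -/
abbrev State : Type := EuclideanSpace ℝ d.StateIdx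

/-- `z = [eᵀ rᵀ Θ̃ᵀ]ᵀ` with `Θ̃ = Θs - Θ`. -/
def zvec (Θs : d.net.Param) (q v qd vd : Vec n) (Θ : d.net.Param) : d.State :=
  WithLp.toLp 2
    (Sum.elim (Sum.elim (qd - q).ofLp (d.filt q v qd vd).ofLp) (Θs - Θ).ofLp)

/-- `blkdiag {I_{2n}, Γ⁻¹}`. -/
def lyapMatrix : Matrix d.StateIdx d.StateIdx ℝ := Matrix.fromBlocks 1 0 0 d.Γ⁻¹

/-- The smallest eigenvalue of `lyapMatrix`. -/
def lam₁ : ℝ := sInf (spectrum ℝ d.lyapMatrix)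

/-- The largest eigenvalue of `lyapMatrix`. -/
def lamPhi : ℝ := sSup (spectrum ℝ d.lyapMatrix)

def kmin : ℝ := min d.k₁ (min (d.k₂ / 3) (d.k₃ / 2))

def delta (ωb εb : ℝ) : ℝ := 3 * (ωb + εb) ^ 2 / (4 * d.k₂) + d.k₃ * d.thetaBar ^ 2 / 2

/-- `ρ₀` is a continuous, strictly increasing, unbounded function on `[0, ∞)` such that
`‖R(κ, Θ̃)‖ ≤ ρ₀(‖κ‖) ‖Θ̃‖²` for all inputs `κ` and all estimates in the search space. -/
structure IsRemainderBound (Θs : d.net.Param) (ρ₀ : ℝ → ℝ) : Prop where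
  nonneg : ∀ s, 0 ≤ s → 0 ≤ ρ₀ s
  cont : ContinuousOn ρ₀ (Ici 0)
  mono : StrictMonoOn ρ₀ (Ici 0)
  unbounded : Tendsto ρ₀ atTop atTop
  bound : ∀ x, ∀ Θ ∈ d.searchSpace,
    ‖d.net.remainder x Θs Θ‖ ≤ ρ₀ ‖x‖ * ‖Θs - Θ‖ ^ 2

/-- `ρ(s) = 3 Θ̄² ρ₀((k₁ + 2) s + 2 (q̄_d + v̄_d))²`. -/
def rho (ρ₀ : ℝ → ℝ) (qb vb s : ℝ) : ℝ :=
  3 * d.thetaBar ^ 2 * ρ₀ ((d.k₁ + 2) * s + 2 * (qb + vb)) ^ 2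

/-- `ρ̄⁻¹(k₂ (k_min - λ_V) - ρ(0))`, where `ρ̄ = ρ - ρ(0)` on `[0, ∞)`. -/
def radius (ρ₀ : ℝ → ℝ) (qb vb : ℝ) : ℝ :=
  Function.invFunOn (fun s => d.rho ρ₀ qb vb s - d.rho ρ₀ qb vb 0) (Ici 0)
    (d.k₂ * (d.kmin - d.lamV) - d.rho ρ₀ qb vb 0)

/-- The set `𝒟`. -/
def domD (ρ₀ : ℝ → ℝ) (qb vb : ℝ) : Set d.State := {z | ‖z‖ ≤ d.radius ρ₀ qb vb}

/-- The set `Ω`. -/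
def domOmega (ρ₀ : ℝ → ℝ) (qb vb : ℝ) : Set (Vec (n + n + n + n)) :=
  {x | ‖x‖ ≤ 2 * (qb + vb) + (d.k₁ + 2) * d.radius ρ₀ qb vb}

/-- The set `𝒮` of initial conditions. -/
def domS (ρ₀ : ℝ → ℝ) (qb vb ωb εb : ℝ) : Set d.State :=
  {z | ‖z‖ ≤ -√(d.delta ωb εb / d.lamV) + √(d.lam₁ / d.lamPhi) * d.radius ρ₀ qb vb}

/-- The radius of the ultimate bound. -/
def ultRadius (ωb εb : ℝ) : ℝ := √(d.lamPhi * d.delta ωb εb / (d.lam₁ * d.lamV))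

/-- The ultimate bound `𝒰`. -/
def domU (ωb εb : ℝ) : Set d.State := {z | ‖z‖ ≤ d.ultRadius ωb εb}

/-- The bound on `‖z(t)‖` at elapsed time `s = t - t₀` from an initial state of norm `a`. -/
def expBound (ωb εb a s : ℝ) : ℝ :=
  √(d.lamPhi / d.lam₁ * a ^ 2 * Real.exp (-(2 * d.lamV / d.lamPhi) * s)
    + d.lamPhi * d.delta ωb εb / (d.lam₁ * d.lamV)
      * (1 - Real.exp (-(2 * d.lamV / d.lamPhi) * s)))

end Design

end

noncomputable section
set_option linter.unusedSectionVars false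

/-! ### Lipschitz functions with almost everywhere derivative estimates -/

/-! Full row rank gives `g g⁺ = 1`, so the control cancels `g` and the closed loop reads x' = pr(x,
F(s(t), x)) for the stacked state x = [q, q̇, Θ̂]. Here F is locally Lipschitz, s collects ω, q_d
and q̇_d, and pr is the projection lifted to the stacked space with A = blkdiag(I, Γ) and B = A⁻¹.
Two issues remain: solving an equation whose right-hand side may be discontinuous, and keeping the
trajectory where the approximation hypothesis holds.

Well-posedness rests on one consequence of convexity: ⟨B(x - y), pr(x, τ) - τ⟩ equals the multiplier
times ⟨∇P(x), y - x⟩, which is at most P(y) - P(x) (`inner_B_pr_sub`). Without a layer the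
multiplier vanishes where P(x) < 0, so the correction is dissipative towards every y with P(y) ≤ 0.
The dynamics are thus one-sided Lipschitz in the B inner product, and Grönwall gives uniqueness.
With a layer the projection is locally Lipschitz, because the Slater point 0 keeps ∇P away from zero
where the projection acts, and Picard-Lindelöf applies. Existence without a layer follows from
layers of vanishing width: the same inequality with an error proportional to the width makes the
solutions uniformly Cauchy. Their limit satisfies a variational inequality and is tangent to the
boundary, and these two facts determine its velocity (`eq_pr_zero`).

For stability, take V = zᵀBz/2. The cross terms between e and r cancel, the adaptation law cancels
the term linear in Θ̃, and the projection has the good sign. Young's inequality absorbs disturbance,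
approximation error and Taylor remainder, which leaves V' ≤ -λ_V‖z‖² + δ while ‖z‖ ≤ χ
(`inner_lyap_zvel_le`); χ is the radius at which the remainder exhausts the gain margin. Grönwall
and λ₁‖z‖² ≤ 2V ≤ λ_φ‖z‖² give the exponential bound. From 𝒮 this bound stays below χ, so there is
no first exit time from 𝒟 (`norm_zvec_le_expBound`). F is not globally bounded, so existence is
first proved for a cut-off field that agrees with F over 𝒟; the estimate then shows that the cut-off
never acts.

The remainder is controlled by the second derivative of the network in Θ, whose supremum over
compact sets of inputs and parameters gives a remainder bound. If the activations have bounded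
derivatives, an induction over the layers shows that along a parameter segment the first two
derivatives of the outputs grow at most like (1 + ‖κ‖)‖Θ̃‖ and its square. -/

theorem LocallyLipschitz.comp_lipschitzOnWith_Icc {X Y : Type*} [PseudoMetricSpace X]
    [PseudoMetricSpace Y] {f : X → Y} (hf : LocallyLipschitz f) {x : ℝ → X} {a b : ℝ} {K : NNReal}
    (hx : LipschitzOnWith K x (Icc a b)) :
    ∃ K', LipschitzOnWith K' (fun t => f (x t)) (Icc a b) := by
  obtain ⟨C, hC⟩ := (hf.locallyLipschitzOn (s := x '' Icc a b)).exists_lipschitzOnWith_of_compact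
    (isCompact_Icc.image_of_continuousOn hx.continuousOn)
  exact ⟨C * K, hC.comp hx (mapsTo_image _ _)⟩

/-- The increment is the integral of `deriv W`. Where `W` is not differentiable `deriv` has the
default value 0, so a sign condition on existing derivatives is enough. -/
theorem AbsolutelyContinuousOnInterval.le_of_ae_deriv_nonpos {W : ℝ → ℝ} {a b : ℝ} (hab : a ≤ b)
    (hW : AbsolutelyContinuousOnInterval W a b)
    (h : ∀ᵐ t, t ∈ Ioo a b → ∀ D, HasDerivAt W D t → D ≤ 0) : W b ≤ W a := by
  have h1 := hW.integral_deriv_eq_sub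
  have h2 : 0 ≤ ∫ t in a..b, -deriv W t := by
    apply intervalIntegral.integral_nonneg_of_ae_restrict hab
    have hb : ∀ᵐ t : ℝ, t ≠ b := by simp [ae_iff, measure_singleton]
    have ha : ∀ᵐ t : ℝ, t ≠ a := by simp [ae_iff, measure_singleton]
    rw [EventuallyLE, ae_restrict_iff' measurableSet_Icc]
    filter_upwards [h, hb, ha] with t ht htb hta hmem
    by_cases hd : DifferentiableAt ℝ W t
    · have := ht ⟨lt_of_le_of_ne hmem.1 (Ne.symm hta), lt_of_le_of_ne hmem.2 htb⟩ _ hd.hasDerivAt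
      simpa using this
    · simp [deriv_zero_of_not_differentiableAt hd]
  rw [intervalIntegral.integral_neg, h1] at h2
  linarith

/-- Differential form of Grönwall's inequality for absolutely continuous functions. -/
theorem AbsolutelyContinuousOnInterval.le_gronwall {W : ℝ → ℝ} {a b α β : ℝ} (hab : a ≤ b)
    (hα : α ≠ 0) (hW : AbsolutelyContinuousOnInterval W a b)
    (h : ∀ᵐ t, t ∈ Ioo a b → ∃ D, HasDerivAt W D t ∧ D ≤ -α * W t + β) :
    W b ≤ W a * Real.exp (-α * (b - a)) + β / α * (1 - Real.exp (-α * (b - a))) := by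
  have hexp : AbsolutelyContinuousOnInterval (fun t => Real.exp (α * (t - a))) a b := by
    have : ContDiff ℝ 1 (fun t : ℝ => Real.exp (α * (t - a))) := by fun_prop
    obtain ⟨K, hK⟩ := this.locallyLipschitz.locallyLipschitzOn.exists_lipschitzOnWith_of_compact
      (isCompact_uIcc (a := a) (b := b))
    exact hK.absolutelyContinuousOnInterval
  have hc : AbsolutelyContinuousOnInterval (fun _ : ℝ => β / α) a b :=
    (LipschitzWith.const (β / α)).lipschitzOnWith.absolutelyContinuousOnInterval (K := 0)
  -- Integrating factor: (W - β/α) e^{α(t - a)} has a nonpositive derivative almost everywhere.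
  have key := ((hW.sub hc).mul hexp).le_of_ae_deriv_nonpos hab (by
    filter_upwards [h] with t ht hmem D hD
    obtain ⟨D', hD', hle⟩ := ht hmem
    have h1 : HasDerivAt (fun t => Real.exp (α * (t - a)))
        (Real.exp (α * (t - a)) * (α * 1)) t :=
      (((hasDerivAt_id t).sub_const a).const_mul α).exp
    have h2 := (hD'.sub (hasDerivAt_const t (β / α))).mul h1
    rw [hD.unique h2]
    have hp := Real.exp_pos (α * (t - a))
    have : (D' - 0) * Real.exp (α * (t - a))
        + (W t - β / α) * (Real.exp (α * (t - a)) * (α * 1))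
        = Real.exp (α * (t - a)) * (D' + α * W t - β) := by
      field_simp
      ring
    have h3 : (W - fun _ : ℝ => β / α) t = W t - β / α := rfl
    rw [h3, this]
    exact mul_nonpos_of_nonneg_of_nonpos hp.le (by linarith))
  simp only [Pi.mul_apply, Pi.sub_apply, sub_self, mul_zero, Real.exp_zero, mul_one] at key
  have he : Real.exp (-α * (b - a)) * Real.exp (α * (b - a)) = 1 := by
    rw [← Real.exp_add]; simp
  have hp := Real.exp_pos (-α * (b - a))
  have := mul_le_mul_of_nonneg_left key hp.le
  have h4 : Real.exp (-α * (b - a)) * ((W b - β / α) * Real.exp (α * (b - a))) = W b - β / α := by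
    linear_combination (W b - β / α) * he
  rw [h4] at this
  linarith

/-- Where `W` is positive it coincides locally with its positive part; elsewhere the positive part
is at its minimum, so its derivative is zero. This serves forward invariance, where the velocity is
controlled only outside the set. -/
theorem HasDerivAt.sup_zero_nonpos {W : ℝ → ℝ} {t D : ℝ} (hW : ContinuousAt W t)
    (hD : HasDerivAt (fun s => max (W s) 0) D t) (h : 0 < W t → ∃ D', HasDerivAt W D' t ∧ D' ≤ 0) :
    D ≤ 0 := by
  rcases lt_or_ge 0 (W t) with hpos | hneg
  · obtain ⟨D', hD', hle⟩ := h hpos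
    have : (fun s => max (W s) 0) =ᶠ[𝓝 t] W := by
      filter_upwards [hW.eventually (lt_mem_nhds hpos)] with s hs using max_eq_left hs.le
    exact (hD.unique (hD'.congr_of_eventuallyEq this)).trans_le hle
  · have : IsLocalMin (fun s => max (W s) 0) t := by
      filter_upwards with s
      simp [max_eq_right hneg]
    exact (this.hasDerivAt_eq_zero hD).le

/-! ### Locally Lipschitz functions -/

section LocallyLipschitzAlgebra

variable {X : Type*} [PseudoMetricSpace X] {E F G : Type*} [NormedAddCommGroup E] [NormedSpace ℝ E]
  [NormedAddCommGroup F] [NormedSpace ℝ F] [NormedAddCommGroup G] [NormedSpace ℝ G]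

theorem ContDiff.comp_locallyLipschitz {f : E → F} (hf : ContDiff ℝ 1 f) {g : X → E}
    (hg : LocallyLipschitz g) : LocallyLipschitz (fun x => f (g x)) :=
  hf.locallyLipschitz.comp hg

theorem LocallyLipschitz.smul' {f : X → ℝ} {g : X → E} (hf : LocallyLipschitz f)
    (hg : LocallyLipschitz g) : LocallyLipschitz (fun x => f x • g x) :=
  (contDiff_fst.smul contDiff_snd : ContDiff ℝ 1 (fun p : ℝ × E => p.1 • p.2)).comp_locallyLipschitz
    (hf.prodMk hg)

theorem LocallyLipschitz.clm_apply {f : X → E →L[ℝ] F} {g : X → E} (hf : LocallyLipschitz f)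
    (hg : LocallyLipschitz g) : LocallyLipschitz (fun x => f x (g x)) :=
  (contDiff_fst.clm_apply contDiff_snd :
    ContDiff ℝ 1 (fun p : (E →L[ℝ] F) × E => p.1 p.2)).comp_locallyLipschitz (hf.prodMk hg)

theorem LocallyLipschitz.real_mul {f g : X → ℝ} (hf : LocallyLipschitz f)
    (hg : LocallyLipschitz g) : LocallyLipschitz (fun x => f x * g x) :=
  hf.smul' hg

theorem LocallyLipschitz.real_inv {f : X → ℝ} (hf : LocallyLipschitz f)
    (h0 : ∀ x, f x ≠ 0) : LocallyLipschitz (fun x => (f x)⁻¹) := by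
  intro x
  obtain ⟨K, t, ht, hK⟩ := (contDiffAt_inv ℝ (h0 x) (n := 1)).exists_lipschitzOnWith
  obtain ⟨K', t', ht', hK'⟩ := hf x
  refine ⟨K * K', t' ∩ f ⁻¹' t, inter_mem ht' (hf.continuous.continuousAt ht), ?_⟩
  exact hK.comp (hK'.mono inter_subset_left) (fun y hy => hy.2)

theorem LocallyLipschitz.inner' {H : Type*} [NormedAddCommGroup H] [InnerProductSpace ℝ H]
    {f g : X → H} (hf : LocallyLipschitz f) (hg : LocallyLipschitz g) :
    LocallyLipschitz (fun x => inner ℝ (f x) (g x)) :=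
  (contDiff_fst.inner ℝ contDiff_snd : ContDiff ℝ 1 (fun p : H × H => inner ℝ p.1 p.2)
    ).comp_locallyLipschitz (hf.prodMk hg)

theorem LocallyLipschitz.clm (L : E →L[ℝ] F) {g : X → E} (hg : LocallyLipschitz g) :
    LocallyLipschitz (fun x => L (g x)) :=
  L.contDiff.comp_locallyLipschitz hg

end LocallyLipschitzAlgebra

/-! ### Global solutions of bounded locally Lipschitz fields -/

theorem exists_solution_of_bounded {S X : Type*} [NormedAddCommGroup S]
    [NormedAddCommGroup X] [NormedSpace ℝ X] [FiniteDimensional ℝ X]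
    {F : S × X → X} (hF : LocallyLipschitz F) {p : ℝ → S} {a b : ℝ} (hab : a ≤ b)
    (hp : ContinuousOn p (Icc a b)) {L : ℝ} (hL : ∀ t ∈ Icc a b, ∀ x, ‖F (p t, x)‖ ≤ L) (x₀ : X) :
    ∃ x : ℝ → X, x a = x₀ ∧ ∀ t ∈ Icc a b, HasDerivWithinAt x (F (p t, x t)) (Icc a b) t := by
  have : ProperSpace X := FiniteDimensional.proper ℝ X
  have hL0 : 0 ≤ L := (norm_nonneg _).trans (hL a ⟨le_rfl, hab⟩ x₀)
  -- A curve of speed at most `L` cannot leave this ball before time `b`, so the local theorem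
  -- covers the whole interval.
  set r : ℝ := L * (b - a) with hr
  have hr0 : 0 ≤ r := mul_nonneg hL0 (sub_nonneg.2 hab)
  have hcomp : IsCompact ((p '' Icc a b) ×ˢ Metric.closedBall x₀ r) :=
    (isCompact_Icc.image_of_continuousOn hp).prod (isCompact_closedBall _ _)
  obtain ⟨K, hK⟩ := (hF.locallyLipschitzOn).exists_lipschitzOnWith_of_compact hcomp
  have hPL : IsPicardLindelof (fun t x => F (p t, x)) (tmin := a) (tmax := b)
      ⟨a, le_rfl, hab⟩ x₀ ⟨r, hr0⟩ 0 ⟨L, hL0⟩ K := by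
    refine ⟨fun t ht => ?_, fun x _ => ?_, fun t ht x _ => hL t ht x, ?_⟩
    · intro x hx y hy
      have := hK (x := (p t, x)) ⟨mem_image_of_mem _ ht, hx⟩ (y := (p t, y))
        ⟨mem_image_of_mem _ ht, hy⟩
      simpa [Prod.edist_eq] using this
    · exact hF.continuous.comp_continuousOn (hp.prodMk continuousOn_const)
    · simp only [sub_self, NNReal.coe_zero, sub_zero]
      rw [max_eq_left (sub_nonneg.2 hab)]
      exact hr.ge
  exact hPL.exists_eq_forall_mem_Icc_hasDerivWithinAt₀

/-! ### The projection operator: convexity, invariance and regularity -/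

/-- A convex sublevel set `{P ≤ 0}` of a Hilbert space with a Slater point at the origin, and a
positive definite operator `A` with inverse `B`. -/
structure ProjData (H : Type*) [NormedAddCommGroup H] [InnerProductSpace ℝ H] where
  P : H → ℝ
  P_smooth : ContDiff ℝ 2 P
  P_convex : ConvexOn ℝ univ P
  P_zero : P 0 < 0
  A : H →L[ℝ] H
  B : H →L[ℝ] H
  B_A : ∀ x, B (A x) = x
  B_symm : ∀ x y, inner ℝ (B x) y = inner ℝ x (B y)
  α : ℝ
  α_pos : 0 < α
  A_coercive : ∀ x, α * ‖x‖ ^ 2 ≤ inner ℝ x (A x)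
  β : ℝ
  β_pos : 0 < β
  B_coercive : ∀ x, β * ‖x‖ ^ 2 ≤ inner ℝ x (B x)

namespace ProjData

variable {H : Type*} [NormedAddCommGroup H] [InnerProductSpace ℝ H] [CompleteSpace H]
  (p : ProjData H)

/-- The gradient of the constraint function. -/
def grad (x : H) : H := gradient p.P x

/-- The weight of the projection with boundary layer of width `ε`. -/
def weight (ε : ℝ) (x : H) : ℝ :=
  if 0 ≤ p.P x then 1 else if -ε < p.P x then (p.P x + ε) / ε else 0

/-- The multiplier of `A ∇P` in the projection. -/
def mult (ε : ℝ) (x τ : H) : ℝ :=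
  p.weight ε x * max 0 (inner ℝ (p.grad x) τ) / inner ℝ (p.grad x) (p.A (p.grad x))

/-- The projection operator with boundary layer of width `ε`. -/
def pr (ε : ℝ) (x τ : H) : H := τ - p.mult ε x τ • p.A (p.grad x)

theorem differentiable : Differentiable ℝ p.P := p.P_smooth.differentiable (by norm_num)

theorem inner_grad (x y : H) : inner ℝ (p.grad x) y = fderiv ℝ p.P x y := by
  rw [grad, inner_gradient_left]

theorem locallyLipschitz_P : LocallyLipschitz p.P :=
  (p.P_smooth.of_le (by norm_num)).locallyLipschitz

theorem locallyLipschitz_grad : LocallyLipschitz p.grad := by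
  have h1 : ContDiff ℝ 1 (fderiv ℝ p.P) := p.P_smooth.fderiv_right (by norm_num)
  have h2 : p.grad = fun x => (InnerProductSpace.toDual ℝ H).symm (fderiv ℝ p.P x) := rfl
  rw [h2]
  exact (InnerProductSpace.toDual ℝ H).symm.lipschitz.locallyLipschitz.comp h1.locallyLipschitz

theorem hasDerivAt_comp {x : ℝ → H} {x' : H} {t : ℝ} (hx : HasDerivAt x x' t) :
    HasDerivAt (fun s => p.P (x s)) (inner ℝ (p.grad (x t)) x') t := by
  rw [inner_grad]
  exact (p.differentiable (x t)).hasFDerivAt.comp_hasDerivAt t hx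

/-- Restriction to the line through `x` and `y` reduces this to the slope inequality for convex
functions of one variable. -/
theorem inner_grad_sub_le (x y : H) : inner ℝ (p.grad x) (y - x) ≤ p.P y - p.P x := by
  have hline : HasDerivAt (fun s : ℝ => x + s • (y - x)) (y - x) 0 := by
    simpa using ((hasDerivAt_id (0 : ℝ)).smul_const (y - x)).const_add x
  have hd := p.hasDerivAt_comp hline
  simp only [zero_smul, add_zero] at hd
  have hconv : ConvexOn ℝ univ (fun s : ℝ => p.P (x + s • (y - x))) := by
    have := p.P_convex.comp_affineMap (AffineMap.lineMap (k := ℝ) x y)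
    simp only [preimage_univ] at this
    refine this.congr (fun s _ => ?_)
    simp [AffineMap.lineMap_apply, add_comm]
  have := hconv.le_slope_of_hasDerivWithinAt (mem_univ 0) (mem_univ 1) one_pos
    hd.hasDerivWithinAt
  simpa [slope_def_field] using this

theorem weight_nonneg {ε : ℝ} (hε : 0 ≤ ε) (x : H) : 0 ≤ p.weight ε x := by
  unfold weight
  split_ifs with h1 h2
  · exact zero_le_one
  · exact div_nonneg (by linarith) hε
  · exact le_rfl

theorem weight_le_one {ε : ℝ} (hε : 0 ≤ ε) (x : H) : p.weight ε x ≤ 1 := by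
  unfold weight
  split_ifs with h1 h2
  · exact le_rfl
  · exact div_le_one_of_le₀ (by linarith) hε
  · exact zero_le_one

theorem weight_of_nonneg (ε : ℝ) {x : H} (hx : 0 ≤ p.P x) : p.weight ε x = 1 := if_pos hx

theorem neg_le_P_of_weight_ne_zero {ε : ℝ} (hε : 0 ≤ ε) {x : H} (h : p.weight ε x ≠ 0) :
    -ε ≤ p.P x := by
  unfold weight at h
  split_ifs at h with h1 h2
  · linarith
  · exact h2.le
  · exact absurd rfl h

/-- The gradient inequality towards the origin. It makes the Slater condition quantitative: on
bounded sets ∇P is bounded below wherever P exceeds P(0) by a fixed amount. -/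
theorem sub_le_norm_grad_mul {x : H} : p.P x - p.P 0 ≤ ‖p.grad x‖ * ‖x‖ := by
  have h1 := p.inner_grad_sub_le x 0
  have h2 := real_inner_le_norm (p.grad x) x
  simp only [zero_sub, inner_neg_right] at h1
  linarith

theorem grad_ne_zero {x : H} (hx : p.P 0 < p.P x) : p.grad x ≠ 0 := by
  intro h
  have := p.sub_le_norm_grad_mul (x := x)
  simp [h] at this
  linarith

theorem inner_A_pos {x : H} (hx : x ≠ 0) : 0 < inner ℝ x (p.A x) :=
  lt_of_lt_of_le (mul_pos p.α_pos (by positivity)) (p.A_coercive x)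

theorem inner_A_nonneg (x : H) : 0 ≤ inner ℝ x (p.A x) :=
  le_trans (mul_nonneg p.α_pos.le (by positivity)) (p.A_coercive x)

theorem mult_nonneg {ε : ℝ} (hε : 0 ≤ ε) (x τ : H) : 0 ≤ p.mult ε x τ :=
  div_nonneg (mul_nonneg (p.weight_nonneg hε x) (le_max_left _ _)) (p.inner_A_nonneg _)

theorem neg_le_P_of_mult_ne_zero {ε : ℝ} (hε : 0 ≤ ε) {x τ : H} (h : p.mult ε x τ ≠ 0) :
    -ε ≤ p.P x := by
  apply p.neg_le_P_of_weight_ne_zero hε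
  intro h0
  simp [mult, h0] at h

/-- The numerator is at most ‖∇P‖‖τ‖ and the denominator at least α‖∇P‖². The powers of ‖∇P‖ cancel,
so no lower bound on the gradient is needed for linear growth of the projection. -/
theorem mult_mul_norm_le {ε : ℝ} (hε : 0 ≤ ε) (x τ : H) :
    p.mult ε x τ * ‖p.grad x‖ ≤ ‖τ‖ / p.α := by
  by_cases h : p.grad x = 0
  · simp only [h, norm_zero, mul_zero]
    exact div_nonneg (norm_nonneg _) p.α_pos.le
  have hN : 0 < ‖p.grad x‖ := norm_pos_iff.2 h
  have h1 := p.A_coercive (p.grad x)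
  have h2 : p.weight ε x * max 0 (inner ℝ (p.grad x) τ) ≤ ‖p.grad x‖ * ‖τ‖ := by
    have h3 : max 0 (inner ℝ (p.grad x) τ) ≤ ‖p.grad x‖ * ‖τ‖ :=
      max_le (by positivity) (real_inner_le_norm _ _)
    calc _ ≤ 1 * max 0 (inner ℝ (p.grad x) τ) :=
          mul_le_mul_of_nonneg_right (p.weight_le_one hε x) (le_max_left _ _)
      _ ≤ _ := by rwa [one_mul]
  have hpos := p.inner_A_pos h
  have hα := p.α_pos
  rw [mult, div_mul_eq_mul_div, div_le_div_iff₀ hpos hα]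
  calc p.weight ε x * max 0 (inner ℝ (p.grad x) τ) * ‖p.grad x‖ * p.α
      ≤ ‖p.grad x‖ * ‖τ‖ * ‖p.grad x‖ * p.α := by gcongr
    _ = ‖τ‖ * (p.α * ‖p.grad x‖ ^ 2) := by ring
    _ ≤ _ := mul_le_mul_of_nonneg_left h1 (norm_nonneg _)

theorem norm_pr_le {ε : ℝ} (hε : 0 ≤ ε) (x τ : H) :
    ‖p.pr ε x τ‖ ≤ (1 + ‖p.A‖ / p.α) * ‖τ‖ := by
  have h1 := p.mult_mul_norm_le hε x τ
  have h0 := p.mult_nonneg hε x τ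
  calc ‖p.pr ε x τ‖ ≤ ‖τ‖ + ‖p.mult ε x τ • p.A (p.grad x)‖ := norm_sub_le _ _
    _ ≤ ‖τ‖ + ‖p.A‖ * (p.mult ε x τ * ‖p.grad x‖) := by
        rw [norm_smul, Real.norm_of_nonneg h0]
        have := mul_le_mul_of_nonneg_left (p.A.le_opNorm (p.grad x)) h0
        linarith
    _ ≤ ‖τ‖ + ‖p.A‖ * (‖τ‖ / p.α) := by gcongr
    _ = _ := by ring

theorem inner_grad_pr_nonpos (ε : ℝ) {x τ : H} (hx : 0 ≤ p.P x) :
    inner ℝ (p.grad x) (p.pr ε x τ) ≤ 0 := by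
  have hpos := p.inner_A_pos (p.grad_ne_zero (p.P_zero.trans_le hx))
  rw [pr, mult, p.weight_of_nonneg ε hx, inner_sub_right, inner_smul_right,
    one_mul, div_mul_cancel₀ _ hpos.ne']
  linarith [le_max_right 0 (inner ℝ (p.grad x) τ)]

/-- The operator `B` undoes `A`, so the correction along A∇P is paired with the plain gradient, to
which convexity applies. -/
theorem inner_B_pr_sub (ε : ℝ) (x y τ : H) :
    inner ℝ (p.B (x - y)) (p.pr ε x τ - τ) = p.mult ε x τ * inner ℝ (p.grad x) (y - x) := by
  rw [pr, sub_sub_cancel_left, inner_neg_right, inner_smul_right, p.B_symm, p.B_A,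
    ← neg_sub x y, inner_neg_right, real_inner_comm]
  ring

/-- The projection only decreases the distance to points on which the constraint function is
not larger than on the layer. -/
theorem inner_B_pr_sub_nonpos {ε : ℝ} (hε : 0 ≤ ε) {x y : H} (τ : H) (hy : p.P y ≤ 0)
    (hyε : 0 < ε → p.P y ≤ -ε) : inner ℝ (p.B (x - y)) (p.pr ε x τ - τ) ≤ 0 := by
  rw [inner_B_pr_sub]
  by_cases h : p.mult ε x τ = 0
  · simp [h]
  · refine mul_nonpos_of_nonneg_of_nonpos (p.mult_nonneg hε x τ)
      ((p.inner_grad_sub_le x y).trans ?_)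
    have := p.neg_le_P_of_mult_ne_zero hε h
    rcases hε.eq_or_lt with h0 | h0
    · subst h0; linarith
    · linarith [hyε h0]

/-- If the multiplier is nonzero then P(x) ≥ -ε, so P(y) - P(x) ≤ ε. There also ‖∇P(x)‖‖x‖ ≥
-P(0)/2, which bounds the multiplier. The estimate measures the failure of dissipativity caused by a
layer, and drives the limit of vanishing layers. -/
theorem inner_B_pr_sub_le {ε R M : ℝ} (hε : 0 ≤ ε) (hε' : ε ≤ -p.P 0 / 2) {x y τ : H}
    (hx : ‖x‖ ≤ R) (hτ : ‖τ‖ ≤ M) (hy : p.P y ≤ 0) :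
    inner ℝ (p.B (x - y)) (p.pr ε x τ - τ) ≤ 2 * R * M / (p.α * -p.P 0) * ε := by
  have h0 := p.P_zero
  have hα := p.α_pos
  have hR : 0 ≤ R := (norm_nonneg _).trans hx
  have hM : 0 ≤ M := (norm_nonneg _).trans hτ
  have hpos : 0 < p.α * -p.P 0 := mul_pos hα (by linarith)
  rw [inner_B_pr_sub]
  by_cases h : p.mult ε x τ = 0
  · rw [h, zero_mul]
    positivity
  have hP := p.neg_le_P_of_mult_ne_zero hε h
  have hm0 := p.mult_nonneg hε x τ
  have h1 : inner ℝ (p.grad x) (y - x) ≤ ε := (p.inner_grad_sub_le x y).trans (by linarith)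
  have h2 := p.mult_mul_norm_le hε x τ
  have h3 : -p.P 0 / 2 ≤ ‖p.grad x‖ * ‖x‖ := le_trans (by linarith) p.sub_le_norm_grad_mul
  have h4 : p.mult ε x τ * (-p.P 0 / 2) ≤ M / p.α * R := by
    calc p.mult ε x τ * (-p.P 0 / 2) ≤ p.mult ε x τ * (‖p.grad x‖ * ‖x‖) := by gcongr
      _ = p.mult ε x τ * ‖p.grad x‖ * ‖x‖ := by ring
      _ ≤ ‖τ‖ / p.α * ‖x‖ := by gcongr
      _ ≤ M / p.α * R := by gcongr
  calc p.mult ε x τ * inner ℝ (p.grad x) (y - x) ≤ p.mult ε x τ * ε := by gcongr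
    _ ≤ 2 * R * M / (p.α * -p.P 0) * ε := by
      gcongr
      rw [le_div_iff₀ hpos]
      have h5 : M / p.α * R * p.α = M * R := by field_simp
      nlinarith [mul_le_mul_of_nonneg_right h4 hα.le]

/-- The set `{P ≤ 0}` is forward invariant under the projected dynamics. -/
theorem P_nonpos_of_ae {ε : ℝ} {x : ℝ → H} {τ : ℝ → H} {a b : ℝ} {K : NNReal}
    (hx : LipschitzOnWith K x (Icc a b)) (h0 : p.P (x a) ≤ 0)
    (hd : ∀ᵐ t, t ∈ Ioo a b → HasDerivAt x (p.pr ε (x t) (τ t)) t) :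
    ∀ t ∈ Icc a b, p.P (x t) ≤ 0 := by
  intro t ht
  obtain ⟨K', hK'⟩ := (p.locallyLipschitz_P.max_const 0).comp_lipschitzOnWith_Icc
    (hx.mono (Icc_subset_Icc_right ht.2))
  have hac : AbsolutelyContinuousOnInterval (fun s => max (p.P (x s)) 0) a t :=
    (uIcc_of_le ht.1 ▸ hK').absolutelyContinuousOnInterval
  have := hac.le_of_ae_deriv_nonpos ht.1 (by
    filter_upwards [hd] with s hs hmem D hD
    have hx' := p.hasDerivAt_comp (hs ⟨hmem.1, hmem.2.trans_le ht.2⟩)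
    exact hD.sup_zero_nonpos hx'.continuousAt (fun hpos =>
      ⟨_, hx', p.inner_grad_pr_nonpos ε hpos.le⟩))
  simp only [max_eq_right h0] at this
  exact (le_max_left _ _).trans this

theorem locallyLipschitz_weight {ε : ℝ} (hε : 0 < ε) : LocallyLipschitz (p.weight ε) := by
  -- The three cases are the affine function (P + ε)/ε clamped to [0, 1].
  have : p.weight ε = fun x => max 0 (min 1 (ε⁻¹ * (p.P x + ε))) := by
    ext x
    unfold weight
    split_ifs with h1 h2
    · have : 1 ≤ ε⁻¹ * (p.P x + ε) := by
        rw [inv_mul_eq_div, le_div_iff₀ hε]; linarith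
      rw [min_eq_left this, max_eq_right zero_le_one]
    · have h3 : ε⁻¹ * (p.P x + ε) ≤ 1 := by
        rw [inv_mul_eq_div, div_le_iff₀ hε]; linarith
      have h4 : 0 ≤ ε⁻¹ * (p.P x + ε) := mul_nonneg (by positivity) (by linarith)
      rw [min_eq_right h3, max_eq_right h4]
      ring
    · have h4 : ε⁻¹ * (p.P x + ε) ≤ 0 :=
        mul_nonpos_of_nonneg_of_nonpos (by positivity) (by linarith)
      rw [max_eq_left ((min_le_right _ _).trans h4)]
  rw [this]
  exact (((LocallyLipschitz.const _).real_mul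
    (p.locallyLipschitz_P.add (LocallyLipschitz.const _))).const_min 1).const_max 0

/-- With a boundary layer, the projection is locally Lipschitz. -/
theorem locallyLipschitz_pr {ε : ℝ} (hε : 0 < ε) (hε' : ε < -p.P 0) :
    LocallyLipschitz (fun y : H × H => p.pr ε y.1 y.2) := by
  set g : ℝ := -p.P 0 - ε with hg
  have hg0 : 0 < g := by linarith
  have hα := p.α_pos
  have hx : LocallyLipschitz (fun y : H × H => y.1) := LipschitzWith.prod_fst.locallyLipschitz
  have hτ : LocallyLipschitz (fun y : H × H => y.2) := LipschitzWith.prod_snd.locallyLipschitz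
  have hN : LocallyLipschitz (fun y : H × H => p.grad y.1) := p.locallyLipschitz_grad.comp hx
  have hw : LocallyLipschitz (fun y : H × H => p.weight ε y.1) :=
    (p.locallyLipschitz_weight hε).comp hx
  have hAN := LocallyLipschitz.clm p.A hN
  -- The true denominator may vanish away from the layer. It is replaced by its maximum with a
  -- positive function that does not exceed it where the weight is nonzero, since there ‖∇P‖‖x‖ ≥ g.
  set D : H × H → ℝ := fun y =>
    max (inner ℝ (p.grad y.1) (p.A (p.grad y.1))) (p.α * g ^ 2 * (1 + inner ℝ y.1 y.1)⁻¹) with hD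
  have hpos1 : ∀ y : H × H, 0 < 1 + inner ℝ y.1 y.1 := fun y => by
    have := real_inner_self_nonneg (x := y.1)
    linarith
  have hDL : LocallyLipschitz D :=
    (hN.inner' hAN).max ((LocallyLipschitz.const _).real_mul
      (((LocallyLipschitz.const _).add (hx.inner' hx)).real_inv (fun y => (hpos1 y).ne')))
  have hDpos : ∀ y, D y ≠ 0 := fun y => by
    refine (lt_of_lt_of_le ?_ (le_max_right _ _)).ne'
    have := hpos1 y
    positivity
  have hform : (fun y : H × H => p.pr ε y.1 y.2) = fun y =>
      y.2 - (p.weight ε y.1 * max 0 (inner ℝ (p.grad y.1) y.2) * (D y)⁻¹) • p.A (p.grad y.1) := by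
    ext1 y
    rw [pr, mult, div_eq_mul_inv]
    by_cases h : p.weight ε y.1 = 0
    · simp [h]
    · have hP := p.neg_le_P_of_weight_ne_zero hε.le h
      have hgn : g ≤ ‖p.grad y.1‖ * ‖y.1‖ := le_trans (by linarith) p.sub_le_norm_grad_mul
      have hle : p.α * g ^ 2 * (1 + inner ℝ y.1 y.1)⁻¹ ≤
          inner ℝ (p.grad y.1) (p.A (p.grad y.1)) := by
        refine le_trans ?_ (p.A_coercive _)
        rw [← div_eq_mul_inv, div_le_iff₀ (hpos1 y), real_inner_self_eq_norm_sq]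
        have h5 : g ^ 2 ≤ (‖p.grad y.1‖ * ‖y.1‖) ^ 2 := by gcongr
        have h6 : g ^ 2 ≤ ‖p.grad y.1‖ ^ 2 * (1 + ‖y.1‖ ^ 2) := by
          nlinarith [sq_nonneg ‖p.grad y.1‖]
        calc p.α * g ^ 2 ≤ p.α * (‖p.grad y.1‖ ^ 2 * (1 + ‖y.1‖ ^ 2)) := by gcongr
          _ = _ := by ring
      have : D y = inner ℝ (p.grad y.1) (p.A (p.grad y.1)) := max_eq_left hle
      rw [this]
  rw [hform]
  exact hτ.sub (((hw.real_mul ((hN.inner' hτ).const_max 0)).real_mul (hDL.real_inv hDpos)).smul'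
    hAN)

end ProjData

/-! ### Carathéodory solutions of the projected dynamics: uniqueness and existence -/

/-- Lipschitz Carathéodory solutions of `x' = Φ t x` on `[a, b]`. -/
structure CaratheodorySol {H : Type*} [NormedAddCommGroup H] [NormedSpace ℝ H]
    (Φ : ℝ → H → H) (a b : ℝ) (x : ℝ → H) : Prop where
  lip : ∃ K, LipschitzOnWith K x (Icc a b)
  deriv : ∀ᵐ t, t ∈ Ioo a b → HasDerivAt x (Φ t (x t)) t

theorem CaratheodorySol.mono {H : Type*} [NormedAddCommGroup H] [NormedSpace ℝ H]
    {Φ : ℝ → H → H} {a b c : ℝ} {x : ℝ → H} (h : CaratheodorySol Φ a b x) (hc : c ≤ b) :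
    CaratheodorySol Φ a c x := by
  obtain ⟨⟨K, hK⟩, hd⟩ := h
  refine ⟨⟨K, hK.mono (Icc_subset_Icc_right hc)⟩, ?_⟩
  filter_upwards [hd] with t ht hmem using ht ⟨hmem.1, hmem.2.trans_le hc⟩

theorem HasDerivAt.nonpos_of_eventually_le {f : ℝ → ℝ} {t D : ℝ} (hf : HasDerivAt f D t)
    (h : ∀ᶠ s in 𝓝[>] t, f s ≤ f t) : D ≤ 0 := by
  have h1 := (hasDerivWithinAt_iff_tendsto_slope' self_notMem_Ioi).mp (hf.hasDerivWithinAt (s := Ioi t))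
  refine le_of_tendsto h1 ?_
  filter_upwards [h, self_mem_nhdsWithin] with s hs hmem
  rw [slope_def_field]
  exact div_nonpos_of_nonpos_of_nonneg (by linarith) (sub_nonneg.2 (le_of_lt hmem))

namespace ProjData

variable {H : Type*} [NormedAddCommGroup H] [InnerProductSpace ℝ H] [CompleteSpace H]
  (p : ProjData H)

theorem hasDerivAt_quadratic {x : ℝ → H} {x' : H} {t : ℝ} (hx : HasDerivAt x x' t) :
    HasDerivAt (fun s => inner ℝ (x s) (p.B (x s))) (2 * inner ℝ (p.B (x t)) x') t := by
  have h := hx.inner ℝ (p.B.hasFDerivAt.comp_hasDerivAt t hx)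
  convert! h using 1
  have h1 := p.B_symm (x t) x'
  have h2 := real_inner_comm x' (p.B (x t))
  simp only [Function.comp_apply]
  linarith

theorem locallyLipschitz_quadratic : LocallyLipschitz (fun x : H => inner ℝ x (p.B x)) :=
  LocallyLipschitz.id.inner' (LocallyLipschitz.clm p.B LocallyLipschitz.id)

/-- Grönwall estimate of the distance of two curves with a one-sided Lipschitz velocity. -/
theorem quadratic_sub_le {x y x' y' : ℝ → H} {a b : ℝ} (hab : a ≤ b) {K K' : NNReal}
    (hx : LipschitzOnWith K x (Icc a b)) (hy : LipschitzOnWith K' y (Icc a b)) (h0 : x a = y a)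
    (hxd : ∀ᵐ t, t ∈ Ioo a b → HasDerivAt x (x' t) t)
    (hyd : ∀ᵐ t, t ∈ Ioo a b → HasDerivAt y (y' t) t)
    {C m : ℝ} (hC : 0 ≤ C)
    (h : ∀ t ∈ Ioo a b, inner ℝ (p.B (x t - y t)) (x' t - y' t) ≤ C * ‖x t - y t‖ ^ 2 + m) :
    p.β * ‖x b - y b‖ ^ 2 ≤
      2 * m / (2 * C / p.β + 1) * (Real.exp ((2 * C / p.β + 1) * (b - a)) - 1) := by
  have hβ := p.β_pos
  have hxy : LipschitzOnWith (K + K') (fun t => x t - y t) (Icc a b) := hx.sub hy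
  obtain ⟨K'', hK⟩ := p.locallyLipschitz_quadratic.comp_lipschitzOnWith_Icc hxy
  have hac : AbsolutelyContinuousOnInterval
      (fun t => inner ℝ (x t - y t) (p.B (x t - y t))) a b :=
    (uIcc_of_le hab ▸ hK).absolutelyContinuousOnInterval
  -- The summand 1 keeps the Grönwall rate nonzero even if C = 0.
  have hc : 0 < 2 * C / p.β + 1 := by positivity
  have key := hac.le_gronwall (α := -(2 * C / p.β + 1)) (β := 2 * m) hab (by linarith) (by
    filter_upwards [hxd, hyd] with t hxt hyt hmem
    refine ⟨_, p.hasDerivAt_quadratic ((hxt hmem).sub (hyt hmem)), ?_⟩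
    have h1 := h t hmem
    have h2 := p.B_coercive (x t - y t)
    have h3 : C * ‖x t - y t‖ ^ 2 ≤ C / p.β * inner ℝ (x t - y t) (p.B (x t - y t)) := by
      rw [div_mul_eq_mul_div, le_div_iff₀ hβ]
      nlinarith
    have h4 : 0 ≤ inner ℝ (x t - y t) (p.B (x t - y t)) := le_trans (by positivity) h2
    rw [neg_neg, add_mul, one_mul, mul_div_assoc, mul_assoc]
    linarith)
  simp only [h0, sub_self, inner_zero_left, zero_mul, zero_add, neg_neg] at key
  refine (p.B_coercive _).trans (key.trans_eq ?_)
  rw [div_neg]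
  ring

variable {S : Type*} [NormedAddCommGroup S]

/-- Uniqueness of solutions of the projected dynamics. -/
theorem eqOn_of_caratheodorySol {F : S × H → H} (hF : LocallyLipschitz F) {s : ℝ → S} {a b : ℝ}
    (hs : ContinuousOn s (Icc a b)) {ε : ℝ} (hε : 0 ≤ ε) (hε' : ε < -p.P 0) {x y : ℝ → H}
    (hx : CaratheodorySol (fun t z => p.pr ε z (F (s t, z))) a b x)
    (hy : CaratheodorySol (fun t z => p.pr ε z (F (s t, z))) a b y)
    (h0 : x a = y a) (hP : p.P (x a) ≤ 0) : ∀ t ∈ Icc a b, x t = y t := by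
  obtain ⟨K₁, hK₁⟩ := hx.lip
  obtain ⟨K₂, hK₂⟩ := hy.lip
  have hcomp : IsCompact ((s '' Icc a b) ×ˢ (x '' Icc a b ∪ y '' Icc a b)) :=
    (isCompact_Icc.image_of_continuousOn hs).prod
      ((isCompact_Icc.image_of_continuousOn hK₁.continuousOn).union
        (isCompact_Icc.image_of_continuousOn hK₂.continuousOn))
  have hone : ∃ C : ℝ, 0 ≤ C ∧ ∀ t ∈ Icc a b, inner ℝ (p.B (x t - y t))
      (p.pr ε (x t) (F (s t, x t)) - p.pr ε (y t) (F (s t, y t))) ≤ C * ‖x t - y t‖ ^ 2 := by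
    have hlip : ∀ G : S × H → H, LocallyLipschitz G → ∃ C : ℝ, 0 ≤ C ∧ ∀ t ∈ Icc a b,
        inner ℝ (p.B (x t - y t)) (G (s t, x t) - G (s t, y t)) ≤ C * ‖x t - y t‖ ^ 2 := by
      intro G hG
      obtain ⟨K, hK⟩ := hG.locallyLipschitzOn.exists_lipschitzOnWith_of_compact hcomp
      refine ⟨‖p.B‖ * K, by positivity, fun t ht => ?_⟩
      have h1 := hK.dist_le_mul (s t, x t) ⟨mem_image_of_mem _ ht, Or.inl (mem_image_of_mem _ ht)⟩
        (s t, y t) ⟨mem_image_of_mem _ ht, Or.inr (mem_image_of_mem _ ht)⟩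
      rw [dist_prod_same_left, dist_eq_norm, dist_eq_norm] at h1
      calc _ ≤ ‖p.B (x t - y t)‖ * ‖G (s t, x t) - G (s t, y t)‖ := real_inner_le_norm _ _
        _ ≤ (‖p.B‖ * ‖x t - y t‖) * (K * ‖x t - y t‖) := by
          gcongr
          exact p.B.le_opNorm _
        _ = _ := by ring
    -- Without a layer only a one-sided estimate is available: both solutions stay in {P ≤ 0}, so
    -- each is an admissible comparison point for the other. With a layer the projected field is
    -- itself locally Lipschitz.
    rcases hε.eq_or_lt with h | h
    · subst h
      obtain ⟨C, hC, hle⟩ := hlip F hF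
      have hPx := p.P_nonpos_of_ae hK₁ hP hx.deriv
      have hPy := p.P_nonpos_of_ae hK₂ (h0 ▸ hP) hy.deriv
      refine ⟨C, hC, fun t ht => ?_⟩
      have h1 := p.inner_B_pr_sub_nonpos le_rfl (x := x t) (F (s t, x t)) (hPy t ht)
        (fun h => absurd h (lt_irrefl _))
      have h2 := p.inner_B_pr_sub_nonpos le_rfl (x := y t) (F (s t, y t)) (hPx t ht)
        (fun h => absurd h (lt_irrefl _))
      have h3 := hle t ht
      rw [← neg_sub (x t), map_neg, inner_neg_left] at h2
      simp only [inner_sub_right] at h1 h2 h3 ⊢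
      linarith
    · refine hlip (fun z => p.pr ε z.2 (F z)) ?_
      exact (p.locallyLipschitz_pr h hε').comp (LipschitzWith.prod_snd.locallyLipschitz.prodMk hF)
  obtain ⟨C, hC, hle⟩ := hone
  intro t ht
  have := p.quadratic_sub_le (m := 0) ht.1 (hK₁.mono (Icc_subset_Icc_right ht.2))
    (hK₂.mono (Icc_subset_Icc_right ht.2)) h0 (hx.mono ht.2).deriv (hy.mono ht.2).deriv hC
    (fun r hr => by simpa using hle r ⟨hr.1.le, hr.2.le.trans ht.2⟩)
  simp only [mul_zero, zero_div, zero_mul] at this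
  have h2 : ‖x t - y t‖ ^ 2 ≤ 0 := nonpos_of_mul_nonpos_right this p.β_pos
  exact sub_eq_zero.1 (norm_eq_zero.1 (pow_eq_zero_iff two_ne_zero |>.1
    (le_antisymm h2 (sq_nonneg _))))

/-- The velocity of the projected dynamics, characterized by the normal cone inequality and
tangency. -/
theorem eq_pr_zero {x τ D : H} (hx : p.P x ≤ 0)
    (hn : ∀ y, p.P y ≤ 0 → inner ℝ (p.B (x - y)) (D - τ) ≤ 0)
    (ht : p.P x = 0 → inner ℝ (p.grad x) D = 0) : D = p.pr 0 x τ := by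
  -- The hypothesis `hn` says that `u` lies in the normal cone of {P ≤ 0} at `x`. In the interior
  -- this cone is zero; at the boundary it is the ray spanned by ∇P.
  set u := p.B (τ - D) with hu
  have hn' : ∀ y, p.P y ≤ 0 → inner ℝ u (y - x) ≤ 0 := by
    intro y hy
    have := hn y hy
    rw [p.B_symm, ← neg_sub τ D, map_neg, ← hu, ← neg_sub y x, inner_neg_neg,
      real_inner_comm] at this
    exact this
  have hinj : ∀ v, p.B v = 0 → v = 0 := by
    intro v hv
    have := p.B_coercive v
    rw [hv, inner_zero_right] at this
    have h2 : ‖v‖ ^ 2 ≤ 0 := nonpos_of_mul_nonpos_right this p.β_pos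
    exact norm_eq_zero.1 (pow_eq_zero_iff two_ne_zero |>.1 (le_antisymm h2 (sq_nonneg _)))
  have hdir : ∀ v, (∀ᶠ r in 𝓝[>] (0 : ℝ), p.P (x + r • v) ≤ 0) → inner ℝ u v ≤ 0 := by
    intro v hv
    obtain ⟨r, hr, hr0⟩ := (hv.and self_mem_nhdsWithin).exists
    have := hn' _ hr
    rw [add_sub_cancel_left, inner_smul_right] at this
    exact nonpos_of_mul_nonpos_right this hr0
  have hline : ∀ v : H, HasDerivAt (fun r : ℝ => x + r • v) v 0 := fun v => by
    simpa using ((hasDerivAt_id (0 : ℝ)).smul_const v).const_add x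
  have hline0 : ∀ v : H, x + (0 : ℝ) • v = x := fun v => by simp
  rcases hx.lt_or_eq with hlt | heq
  · have hu0 : u = 0 := by
      have h1 : inner ℝ u u ≤ 0 := hdir u (by
        have hc : ContinuousAt (fun r : ℝ => p.P (x + r • u)) 0 :=
          (p.hasDerivAt_comp (hline u)).continuousAt
        have := hc.eventually (gt_mem_nhds (by simpa using hlt : p.P (x + (0 : ℝ) • u) < 0))
        exact (this.filter_mono nhdsWithin_le_nhds).mono fun r hr => hr.le)
      exact inner_self_eq_zero.1 (le_antisymm h1 real_inner_self_nonneg)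
    have : τ - D = 0 := hinj _ hu0
    have hw : p.weight 0 x = 0 := by
      unfold weight
      rw [if_neg (not_le.2 hlt), if_neg (by simpa using hx)]
    rw [pr, mult, hw, zero_mul, zero_div, zero_smul, sub_zero]
    exact (sub_eq_zero.1 this).symm
  · set N := p.grad x with hN
    have hN0 : N ≠ 0 := p.grad_ne_zero (by rw [heq]; exact p.P_zero)
    have hNN : 0 < inner ℝ N N := real_inner_self_pos.2 hN0
    have hneg : ∀ v, inner ℝ N v < 0 → inner ℝ u v ≤ 0 := by
      intro v hv
      refine hdir v ?_
      have hd := p.hasDerivAt_comp (hline v)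
      rw [hline0, ← hN] at hd
      have h1 := (hasDerivWithinAt_iff_tendsto_slope' self_notMem_Ioi).mp
        (hd.hasDerivWithinAt (s := Ioi 0))
      filter_upwards [h1.eventually (gt_mem_nhds hv), self_mem_nhdsWithin] with r hr hr0
      rw [slope_def_field, hline0, heq, sub_zero, sub_zero] at hr
      exact ((div_neg_iff.1 hr).resolve_left (fun h => absurd h.2 (not_lt.2 (le_of_lt hr0)))).1.le
    -- Only strictly inward directions are known to be feasible; the others are limits of v - rN as
    -- r decreases to 0.
    have hle : ∀ v, inner ℝ N v ≤ 0 → inner ℝ u v ≤ 0 := by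
      intro v hv
      have h1 : Tendsto (fun r : ℝ => inner ℝ u (v - r • N)) (𝓝[>] 0) (𝓝 (inner ℝ u v)) := by
        have : Continuous (fun r : ℝ => inner ℝ u (v - r • N)) := by fun_prop
        have := this.tendsto 0
        simp only [zero_smul, sub_zero] at this
        exact this.mono_left nhdsWithin_le_nhds
      refine le_of_tendsto h1 ?_
      filter_upwards [self_mem_nhdsWithin] with r hr
      apply hneg
      rw [inner_sub_right, inner_smul_right]
      have : 0 < r * inner ℝ N N := mul_pos hr hNN
      linarith
    -- Farkas' lemma for one constraint: testing with the part of `u` orthogonal to `N` shows that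
    -- it vanishes, and testing with -N gives μ ≥ 0. Tangency then identifies μ with the projection
    -- multiplier.
    set μ := inner ℝ N u / inner ℝ N N with hμ
    have hperp : inner ℝ N (u - μ • N) = 0 := by
      rw [inner_sub_right, inner_smul_right, hμ, div_mul_cancel₀ _ hNN.ne', sub_self]
    have huN : u = μ • N := by
      have h1 := hle _ hperp.le
      have h2 : inner ℝ (u - μ • N) (u - μ • N) = inner ℝ u (u - μ • N) := by
        rw [inner_sub_left, inner_smul_left, hperp]; simp
      exact sub_eq_zero.1 (inner_self_eq_zero.1 (le_antisymm (h2 ▸ h1) real_inner_self_nonneg))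
    have hμ0 : 0 ≤ μ := by
      have := hle (-N) (by rw [inner_neg_right]; linarith)
      rw [inner_neg_right, real_inner_comm] at this
      exact div_nonneg (by linarith) hNN.le
    have hτD : τ - D = μ • p.A N := by
      refine sub_eq_zero.1 (hinj _ ?_)
      rw [map_sub, map_smul, p.B_A, ← hu, huN, sub_self]
    have hANpos := p.inner_A_pos hN0
    have hin : inner ℝ N τ = μ * inner ℝ N (p.A N) := by
      have h1 := congrArg (inner ℝ N) hτD
      rw [inner_sub_right, ht heq, sub_zero, inner_smul_right] at h1
      exact h1
    have hmult : p.mult 0 x τ = μ := by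
      rw [mult, p.weight_of_nonneg 0 heq.ge, ← hN, hin, max_eq_right (by positivity), one_mul,
        mul_div_cancel_right₀ _ hANpos.ne']
    rw [pr, hmult, ← hN, ← hτD]
    abel

end ProjData

namespace ProjData

variable {H : Type*} [NormedAddCommGroup H] [InnerProductSpace ℝ H] [FiniteDimensional ℝ H]
  [CompleteSpace H] (p : ProjData H) {S : Type*} [NormedAddCommGroup S]

/-- Existence for the projected dynamics with a boundary layer. -/
theorem exists_caratheodorySol_layer {F : S × H → H} (hF : LocallyLipschitz F) {s : ℝ → S}
    {a b : ℝ} (hab : a ≤ b) (hs : ContinuousOn s (Icc a b)) {M : ℝ} (hM0 : 0 ≤ M)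
    (hM : ∀ t ∈ Icc a b, ∀ x, ‖F (s t, x)‖ ≤ M) {ε : ℝ} (hε : 0 < ε) (hε' : ε < -p.P 0) (x₀ : H) :
    ∃ x, x a = x₀ ∧ CaratheodorySol (fun t z => p.pr ε z (F (s t, z))) a b x ∧
      LipschitzOnWith (Real.toNNReal ((1 + ‖p.A‖ / p.α) * M)) x (Icc a b) := by
  have hα := p.α_pos
  have hbd : ∀ t ∈ Icc a b, ∀ x, ‖p.pr ε x (F (s t, x))‖ ≤ (1 + ‖p.A‖ / p.α) * M := by
    intro t ht x
    refine (p.norm_pr_le hε.le x _).trans ?_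
    gcongr
    exact hM t ht x
  obtain ⟨x, hx0, hx⟩ := exists_solution_of_bounded (F := fun z : S × H => p.pr ε z.2 (F z))
    ((p.locallyLipschitz_pr hε hε').comp (LipschitzWith.prod_snd.locallyLipschitz.prodMk hF))
    hab hs hbd x₀
  have hlip : LipschitzOnWith (Real.toNNReal ((1 + ‖p.A‖ / p.α) * M)) x (Icc a b) := by
    refine (convex_Icc a b).lipschitzOnWith_of_nnnorm_hasDerivWithin_le hx (fun t ht => ?_)
    rw [← NNReal.coe_le_coe, coe_nnnorm, Real.coe_toNNReal _ (by positivity)]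
    exact hbd t ht _
  refine ⟨x, hx0, ⟨⟨_, hlip⟩, Eventually.of_forall fun t ht => ?_⟩, hlip⟩
  exact (hx t (Ioo_subset_Icc_self ht)).hasDerivAt (Icc_mem_nhds ht.1 ht.2)

/-- Existence for the projected dynamics without a boundary layer, as the limit of vanishing
boundary layers. -/
theorem exists_caratheodorySol_zero {F : S × H → H} (hF : LocallyLipschitz F) {s : ℝ → S}
    {a b : ℝ} (hab : a ≤ b) (hs : ContinuousOn s (Icc a b)) {M : ℝ} (hM0 : 0 ≤ M)
    (hM : ∀ t ∈ Icc a b, ∀ x, ‖F (s t, x)‖ ≤ M) {x₀ : H} (hx₀ : p.P x₀ ≤ 0) :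
    ∃ x, x a = x₀ ∧ CaratheodorySol (fun t z => p.pr 0 z (F (s t, z))) a b x := by
  have hα := p.α_pos
  have hβ := p.β_pos
  have hP0 := p.P_zero
  set L : ℝ := (1 + ‖p.A‖ / p.α) * M with hL
  have hL0 : 0 ≤ L := by positivity
  -- Layer widths. Staying below -P(0)/2 keeps the layers away from the Slater point, so the
  -- multiplier bounds are uniform in `k`.
  set e : ℕ → ℝ := fun k => (-p.P 0 / 2) / (k + 1) with he
  have he0 : ∀ k, 0 < e k := fun k => div_pos (by linarith) (by positivity)
  have he1 : ∀ k, e k ≤ -p.P 0 / 2 := fun k =>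
    div_le_self (by linarith) (by linarith [Nat.cast_nonneg (α := ℝ) k])
  have helim : Tendsto e atTop (𝓝 0) := by
    have := (tendsto_one_div_add_atTop_nhds_zero_nat (𝕜 := ℝ)).const_mul (-p.P 0 / 2)
    rw [mul_zero] at this
    exact this.congr fun k => mul_one_div _ _
  choose X hX0 hXsol hXlip using fun k =>
    p.exists_caratheodorySol_layer hF hab hs hM0 hM (he0 k) (by linarith [he1 k]) x₀
  set R : ℝ := ‖x₀‖ + L * (b - a) with hR
  have hR0 : 0 ≤ R := add_nonneg (norm_nonneg _) (mul_nonneg hL0 (sub_nonneg.2 hab))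
  have hnorm : ∀ x : ℝ → H, x a = x₀ → LipschitzOnWith (Real.toNNReal L) x (Icc a b) →
      ∀ t ∈ Icc a b, ‖x t‖ ≤ R := by
    intro x hx0 hx t ht
    have h1 := hx.dist_le_mul t ht a ⟨le_rfl, hab⟩
    rw [Real.coe_toNNReal _ hL0, dist_eq_norm, Real.dist_eq, abs_of_nonneg (sub_nonneg.2 ht.1),
      hx0] at h1
    have h2 : L * (t - a) ≤ L * (b - a) := by
      gcongr
      exact ht.2
    calc ‖x t‖ = ‖(x t - x₀) + x₀‖ := by rw [sub_add_cancel]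
      _ ≤ ‖x t - x₀‖ + ‖x₀‖ := norm_add_le _ _
      _ ≤ R := by linarith
  have hXP : ∀ k, ∀ t ∈ Icc a b, p.P (X k t) ≤ 0 := fun k =>
    p.P_nonpos_of_ae (hXlip k) (by rw [hX0 k]; exact hx₀) (hXsol k).deriv
  have : ProperSpace H := FiniteDimensional.proper ℝ H
  have hcomp : IsCompact ((s '' Icc a b) ×ˢ Metric.closedBall (0 : H) R) :=
    (isCompact_Icc.image_of_continuousOn hs).prod (isCompact_closedBall _ _)
  have hmem : ∀ x : ℝ → H, (∀ t ∈ Icc a b, ‖x t‖ ≤ R) → ∀ t ∈ Icc a b,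
      (s t, x t) ∈ (s '' Icc a b) ×ˢ Metric.closedBall (0 : H) R := fun x hx t ht =>
    ⟨mem_image_of_mem _ ht, mem_closedBall_zero_iff.2 (hx t ht)⟩
  obtain ⟨KF, hKF⟩ := hF.locallyLipschitzOn.exists_lipschitzOnWith_of_compact hcomp
  set m : ℝ := 2 * R * M / (p.α * -p.P 0) with hm
  have hm0 : 0 ≤ m := by
    have : 0 < p.α * -p.P 0 := mul_pos hα (by linarith)
    positivity
  -- the layer solutions form a uniform Cauchy sequence
  set C : ℝ := ‖p.B‖ * KF with hC
  set c : ℝ := 2 * C / p.β + 1 with hc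
  have hc0 : 0 < c := by positivity
  set Q : ℝ := 2 * m / c * (Real.exp (c * (b - a)) - 1) / p.β with hQ
  have hexp : ∀ t, a ≤ t → 0 ≤ Real.exp (c * (t - a)) - 1 := fun t ht => by
    have : 0 ≤ c * (t - a) := mul_nonneg hc0.le (sub_nonneg.2 ht)
    linarith [Real.add_one_le_exp (c * (t - a))]
  have hQ0 : 0 ≤ Q := by
    have := hexp b hab
    positivity
  have hcauchy : ∀ k l, ∀ t ∈ Icc a b, ‖X k t - X l t‖ ^ 2 ≤ Q * (e k + e l) := by
    intro k l t ht
    have := p.quadratic_sub_le (C := C) (m := m * (e k + e l)) ht.1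
      ((hXlip k).mono (Icc_subset_Icc_right ht.2))
      ((hXlip l).mono (Icc_subset_Icc_right ht.2)) ((hX0 k).trans (hX0 l).symm)
      ((hXsol k).mono ht.2).deriv ((hXsol l).mono ht.2).deriv (by positivity) (by
        intro r hr
        have hr' : r ∈ Icc a b := ⟨hr.1.le, hr.2.le.trans ht.2⟩
        have hk := hnorm _ (hX0 k) (hXlip k)
        have hl := hnorm _ (hX0 l) (hXlip l)
        -- Each layer solution lies in {P ≤ 0} and serves as comparison point for the other, at a
        -- cost proportional to the widths.
        have h1 := p.inner_B_pr_sub_le (he0 k).le (he1 k) (hk r hr') (hM r hr' (X k r))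
          (hXP l r hr')
        have h2 := p.inner_B_pr_sub_le (he0 l).le (he1 l) (hl r hr') (hM r hr' (X l r))
          (hXP k r hr')
        have h3 := hKF.dist_le_mul _ (hmem _ hk r hr') _ (hmem _ hl r hr')
        rw [dist_prod_same_left, dist_eq_norm, dist_eq_norm] at h3
        have h4 : inner ℝ (p.B (X k r - X l r)) (F (s r, X k r) - F (s r, X l r))
            ≤ C * ‖X k r - X l r‖ ^ 2 := by
          calc _ ≤ ‖p.B (X k r - X l r)‖ * ‖F (s r, X k r) - F (s r, X l r)‖ :=
                real_inner_le_norm _ _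
            _ ≤ (‖p.B‖ * ‖X k r - X l r‖) * (KF * ‖X k r - X l r‖) := by
              gcongr
              exact p.B.le_opNorm _
            _ = _ := by ring
        rw [← neg_sub (X k r), map_neg, inner_neg_left] at h2
        simp only [inner_sub_right] at h1 h2 h4 ⊢
        linarith)
    rw [mul_comm, ← le_div_iff₀ hβ] at this
    refine this.trans ?_
    have h5 : Real.exp (c * (t - a)) - 1 ≤ Real.exp (c * (b - a)) - 1 := by
      gcongr
      exact ht.2
    calc 2 * (m * (e k + e l)) / c * (Real.exp (c * (t - a)) - 1) / p.β
        ≤ 2 * (m * (e k + e l)) / c * (Real.exp (c * (b - a)) - 1) / p.β := by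
          have := (he0 k).le
          have := (he0 l).le
          gcongr
      _ = _ := by rw [hQ]; ring
  have hlim : ∀ t, ∃ y, t ∈ Icc a b → Tendsto (fun k => X k t) atTop (𝓝 y) := by
    intro t
    by_cases ht : t ∈ Icc a b
    · have : CauchySeq (fun k => X k t) := by
        refine cauchySeq_of_le_tendsto_0 (fun k => √(Q * (e k + e k))) (fun i j k hi hj => ?_) ?_
        · rw [dist_eq_norm]
          apply Real.le_sqrt_of_sq_le
          refine (hcauchy i j t ht).trans ?_
          have hanti : ∀ i, k ≤ i → e i ≤ e k := fun i hi => by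
            have : (k : ℝ) ≤ i := by exact_mod_cast hi
            simp only [he]
            apply div_le_div_of_nonneg_left <;> linarith [Nat.cast_nonneg (α := ℝ) k]
          have := hanti i hi
          have := hanti j hj
          gcongr
        · have : Tendsto (fun k => √(Q * (e k + e k))) atTop (𝓝 √(Q * (0 + 0))) :=
            ((helim.add helim).const_mul Q).sqrt
          simpa using this
      obtain ⟨y, hy⟩ := cauchySeq_tendsto_of_complete this
      exact ⟨y, fun _ => hy⟩
    · exact ⟨x₀, fun h => absurd h ht⟩
  choose x hx using hlim
  have hxa : x a = x₀ := by
    refine tendsto_nhds_unique (hx a ⟨le_rfl, hab⟩) ?_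
    simp only [hX0]
    exact tendsto_const_nhds
  have hclose : ∀ k, ∀ t ∈ Icc a b, ‖X k t - x t‖ ≤ √(Q * e k) := by
    intro k t ht
    apply Real.le_sqrt_of_sq_le
    have h1 : Tendsto (fun l => ‖X k t - X l t‖ ^ 2) atTop (𝓝 (‖X k t - x t‖ ^ 2)) :=
      ((tendsto_const_nhds.sub (hx t ht)).norm).pow 2
    have h2 : Tendsto (fun l => Q * (e k + e l)) atTop (𝓝 (Q * (e k + 0))) :=
      (tendsto_const_nhds.add helim).const_mul Q
    rw [add_zero] at h2
    exact le_of_tendsto_of_tendsto' h1 h2 (fun l => hcauchy k l t ht)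
  have hxlip : LipschitzOnWith (Real.toNNReal L) x (Icc a b) := by
    refine LipschitzOnWith.of_dist_le_mul fun t ht r hr => ?_
    exact le_of_tendsto' ((hx t ht).dist (hx r hr)) (fun k => (hXlip k).dist_le_mul t ht r hr)
  have hxR := hnorm x hxa hxlip
  have hxP : ∀ t ∈ Icc a b, p.P (x t) ≤ 0 := fun t ht =>
    le_of_tendsto' (((p.locallyLipschitz_P.continuous.tendsto _).comp (hx t ht)))
      (fun k => hXP k t ht)
  refine ⟨x, hxa, ⟨⟨_, hxlip⟩, ?_⟩⟩
  filter_upwards [hxlip.ae_differentiableWithinAt_of_mem_real] with t htd ht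
  have ht' := Ioo_subset_Icc_self ht
  have hD := ((htd ht').differentiableAt (Icc_mem_nhds ht.1 ht.2)).hasDerivAt
  -- The limit is differentiable almost everywhere by Rademacher's theorem, but the velocities of
  -- the layer solutions need not converge. The limit velocity is therefore identified by the normal
  -- cone inequality and tangency.
  rw [← p.eq_pr_zero (hxP t ht') (D := deriv x t) (τ := F (s t, x t)) ?_ ?_]
  · exact hD
  · intro Y hY
    -- the variational inequality
    set g : ℝ → ℝ := fun r => inner ℝ (p.B (x r - Y)) (F (s r, x r)) with hg
    have hGlip : LocallyLipschitz (fun z : S × H => inner ℝ (p.B (z.2 - Y)) (F z)) :=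
      (LocallyLipschitz.clm p.B (LipschitzWith.prod_snd.locallyLipschitz.sub
        (LocallyLipschitz.const Y))).inner' hF
    obtain ⟨KG, hKG⟩ := hGlip.locallyLipschitzOn.exists_lipschitzOnWith_of_compact hcomp
    have hgc : ContinuousAt g t :=
      (hGlip.continuous.comp_continuousOn (hs.prodMk hxlip.continuousOn)).continuousAt
        (Icc_mem_nhds ht.1 ht.2)
    have hφ : HasDerivAt (fun r => inner ℝ (x r - Y) (p.B (x r - Y)))
        (2 * inner ℝ (p.B (x t - Y)) (deriv x t)) t :=
      p.hasDerivAt_quadratic (hD.sub_const Y)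
    -- The inequality is integrated for the layer solutions over a short interval [t, r], passed to
    -- the limit in `k`, and then differentiated at `t`. One η absorbs the variation of `g` on the
    -- interval, the other the layer error and the distance of `X k` from `x`.
    have hstep : ∀ η > 0, 2 * inner ℝ (p.B (x t - Y)) (deriv x t) ≤ 2 * (g t + 2 * η) := by
      intro η hη
      have hlin : HasDerivAt (fun r : ℝ => 2 * (g t + 2 * η) * r) (2 * (g t + 2 * η)) t := by
        simpa using (hasDerivAt_id t).const_mul (2 * (g t + 2 * η))
      rw [← sub_nonpos]
      refine (hφ.sub hlin).nonpos_of_eventually_le ?_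
      have h1 : ∀ᶠ r in 𝓝[>] t, ∀ r' ∈ Ioo t r, g r' ≤ g t + η := by
        have := hgc.eventually (gt_mem_nhds (by linarith : g t < g t + η))
        obtain ⟨δ, hδ, hball⟩ := Metric.eventually_nhds_iff.1 this
        filter_upwards [Ioo_mem_nhdsGT (show t < t + δ by linarith)] with r hr r' hr'
        refine (hball ?_).le
        rw [Real.dist_eq, abs_lt]
        constructor <;> linarith [hr'.1, hr'.2, hr.2]
      filter_upwards [h1, Ioo_mem_nhdsGT ht.2] with r hr hrb
      have hsub : Icc t r ⊆ Icc a b := Icc_subset_Icc ht.1.le hrb.2.le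
      have hk : ∀ᶠ k in atTop, KG * √(Q * e k) + m * e k < η := by
        have : Tendsto (fun k => KG * √(Q * e k) + m * e k) atTop (𝓝 (KG * √(Q * 0) + m * 0)) :=
          ((helim.const_mul Q).sqrt.const_mul _).add (helim.const_mul m)
        simp only [mul_zero, Real.sqrt_zero, add_zero] at this
        exact this.eventually (gt_mem_nhds hη)
      have hle : ∀ᶠ k in atTop,
          inner ℝ (X k r - Y) (p.B (X k r - Y)) - 2 * (g t + 2 * η) * r ≤
          inner ℝ (X k t - Y) (p.B (X k t - Y)) - 2 * (g t + 2 * η) * t := by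
        filter_upwards [hk] with k hk
        have hloc : LocallyLipschitz (fun z : H × ℝ =>
            inner ℝ (z.1 - Y) (p.B (z.1 - Y)) - 2 * (g t + 2 * η) * z.2) :=
          (p.locallyLipschitz_quadratic.comp (LipschitzWith.prod_fst.locallyLipschitz.sub
            (LocallyLipschitz.const Y))).sub
            ((LocallyLipschitz.const _).real_mul LipschitzWith.prod_snd.locallyLipschitz)
        obtain ⟨K', hK'⟩ := hloc.comp_lipschitzOnWith_Icc (x := fun r => (X k r, r))
          (((hXlip k).mono hsub).prodMk (LipschitzWith.id.lipschitzOnWith (s := Icc t r)))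
        have hac := (uIcc_of_le hrb.1.le ▸ hK').absolutelyContinuousOnInterval
        refine hac.le_of_ae_deriv_nonpos hrb.1.le ?_
        filter_upwards [(hXsol k).deriv] with r' hr'd hr' D' hD'
        have hr'' : r' ∈ Icc a b := hsub (Ioo_subset_Icc_self hr')
        have hX := hr'd ⟨ht.1.trans hr'.1, hr'.2.trans hrb.2⟩
        have hlin' : HasDerivAt (fun r : ℝ => 2 * (g t + 2 * η) * r) (2 * (g t + 2 * η)) r' := by
          simpa using (hasDerivAt_id r').const_mul (2 * (g t + 2 * η))
        rw [hD'.unique ((p.hasDerivAt_quadratic (hX.sub_const Y)).sub hlin')]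
        have hkn := hnorm _ (hX0 k) (hXlip k)
        have e1 := p.inner_B_pr_sub_le (he0 k).le (he1 k) (hkn r' hr'') (hM r' hr'' (X k r')) hY
        have e2 := hKG.dist_le_mul _ (hmem _ hkn r' hr'') _ (hmem _ hxR r' hr'')
        rw [dist_prod_same_left, Real.dist_eq, dist_eq_norm] at e2
        have e3 := (le_abs_self _).trans (e2.trans
          (mul_le_mul_of_nonneg_left (hclose k r' hr'') KG.coe_nonneg))
        have e4 := hr r' hr'
        simp only [hg] at e4
        simp only [inner_sub_right] at e1 e3 e4 ⊢
        linarith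
      have hT : ∀ r ∈ Icc a b, Tendsto
          (fun k => inner ℝ (X k r - Y) (p.B (X k r - Y)) - 2 * (g t + 2 * η) * r) atTop
          (𝓝 (inner ℝ (x r - Y) (p.B (x r - Y)) - 2 * (g t + 2 * η) * r)) := fun r hr =>
        (((p.locallyLipschitz_quadratic.continuous.tendsto _).comp
          ((hx r hr).sub_const Y))).sub_const _
      exact le_of_tendsto_of_tendsto (hT r (hsub ⟨hrb.1.le, le_rfl⟩)) (hT t ht') hle
    have : inner ℝ (p.B (x t - Y)) (deriv x t) ≤ g t := by
      refine le_of_forall_pos_le_add fun η hη => ?_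
      have := hstep (η / 2) (by positivity)
      linarith
    rw [inner_sub_right]
    exact sub_nonpos.2 this
  · intro h0
    -- The limit stays in {P ≤ 0}, so P along it is maximal at any interior time when it touches the
    -- boundary; this is the tangency.
    have hmax : IsLocalMax (fun r => p.P (x r)) t := by
      filter_upwards [Icc_mem_nhds ht.1 ht.2] with r hr
      simpa [h0] using hxP r hr
    exact hmax.hasDerivAt_eq_zero (p.hasDerivAt_comp hD)

/-- Existence for the projected dynamics of a bounded locally Lipschitz field. -/
theorem exists_caratheodorySol {F : S × H → H} (hF : LocallyLipschitz F) {s : ℝ → S}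
    {a b : ℝ} (hab : a ≤ b) (hs : ContinuousOn s (Icc a b)) {M : ℝ}
    (hM : ∀ t ∈ Icc a b, ∀ x, ‖F (s t, x)‖ ≤ M) {ε : ℝ} (hε : 0 ≤ ε) (hε' : ε < -p.P 0)
    {x₀ : H} (hx₀ : p.P x₀ ≤ 0) :
    ∃ x, x a = x₀ ∧ CaratheodorySol (fun t z => p.pr ε z (F (s t, z))) a b x := by
  have hM0 : 0 ≤ M := (norm_nonneg _).trans (hM a ⟨le_rfl, hab⟩ 0)
  rcases hε.eq_or_lt with h | h
  · subst h
    exact p.exists_caratheodorySol_zero hF hab hs hM0 hM hx₀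
  · obtain ⟨x, hx0, hx, -⟩ := p.exists_caratheodorySol_layer hF hab hs hM0 hM h hε' x₀
    exact ⟨x, hx0, hx⟩

end ProjData

/-! ### Smoothness and Taylor remainder of the network -/

theorem EuclideanSpace.norm_le_sum {ι : Type*} [Fintype ι] (x : EuclideanSpace ℝ ι) :
    ‖x‖ ≤ ∑ i, |x i| := by
  rw [EuclideanSpace.norm_eq]
  refine Real.sqrt_le_iff.2 ⟨Finset.sum_nonneg fun i _ => abs_nonneg _, ?_⟩
  exact Finset.sum_sq_le_sq_sum_of_nonneg fun i _ => abs_nonneg _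

theorem EuclideanSpace.abs_apply_le_norm {ι : Type*} [Fintype ι] (x : EuclideanSpace ℝ ι) (i : ι) :
    |x i| ≤ ‖x‖ := by
  rw [← Real.norm_eq_abs]
  exact PiLp.norm_apply_le x i

namespace ResNet

variable {Lin Lout : ℕ} (N : ResNet Lin Lout)

/-- A property of scalar functions that is stable under the operations of the network holds for
the outputs of the network. -/
theorem resOut_induction {Z : Type*} (Q : (Z → ℝ) → Prop) (θ : Z → N.Param)
    (x : Z → Fin Lin → ℝ) (hzero : Q fun _ => 0) (hone : Q fun _ => 1)
    (hadd : ∀ f g, Q f → Q g → Q fun z => f z + g z)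
    (hweight : ∀ idx f, Q f → Q fun z => θ z idx * f z)
    (hact : ∀ i j l f, Q f → Q fun z => N.act i j l (f z))
    (hpre : ∀ i l f, Q f → Q fun z => N.pre i l (f z))
    (hx : ∀ l, Q fun z => x z l) (i : ℕ) : ∀ l, Q fun z => N.resOut (θ z) (x z) i l := by
  have hsum : ∀ (n : ℕ) (f : Fin n → Z → ℝ), (∀ a, Q (f a)) → Q fun z => ∑ a, f a z := by
    intro n
    induction n with
    | zero => intro f _; simpa using hzero
    | succ n ih =>
      intro f hf
      simp only [Fin.sum_univ_succ]
      exact hadd _ _ (hf 0) (ih _ fun a => hf a.succ)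
  have hmul : ∀ (i j : ℕ) (v : Z → Fin (N.L i j + 1) → ℝ), (∀ a, Q fun z => v z a) →
      ∀ c, Q fun z => ((N.weight (θ z) i j)ᵀ *ᵥ v z) c := by
    intro i j v hv c
    simp only [Matrix.mulVec, dotProduct, Matrix.transpose_apply, weight]
    refine hsum _ _ fun a => ?_
    by_cases h : i < N.b + 1 ∧ j < N.k i + 1
    · simp only [dif_pos h]
      exact hweight _ _ (hv a)
    · simp only [dif_neg h, zero_mul]
      exact hzero
  have haug : ∀ (n : ℕ) (v : Z → Fin n → ℝ), (∀ a, Q fun z => v z a) →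
      ∀ a, Q fun z => augment (v z) a := by
    intro n v hv a
    refine Fin.lastCases ?_ (fun a => ?_) a
    · simpa [augment] using hone
    · simpa [augment] using hv a
  have hlayer : ∀ (i : ℕ) (v : Z → Fin (N.L i 0 + 1) → ℝ), (∀ a, Q fun z => v z a) →
      ∀ j c, Q fun z => N.layer (θ z) i (v z) j c := by
    intro i v hv j
    induction j with
    | zero => exact hmul i 0 v hv
    | succ j ih =>
      exact hmul i (j + 1) _ (haug _ _ fun l => hact _ _ _ _ (ih l))
  have hblock : ∀ (i : ℕ) (v : Z → Fin (N.L i 0 + 1) → ℝ), (∀ a, Q fun z => v z a) →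
      ∀ l, Q fun z => N.block (θ z) i (v z) l := fun i v hv l => hlayer i v hv _ _
  induction i with
  | zero => exact hblock 0 _ (haug _ _ fun l => hx _)
  | succ i ih =>
    intro l
    exact hadd _ _ (ih l) (hblock (i + 1) _ (haug _ _ fun l => hpre _ _ _ (ih _)) l)

theorem contDiff_Psi : ContDiff ℝ ∞ (fun z : Vec Lin × N.Param => N.Psi z.1 z.2) := by
  rw [contDiff_euclidean]
  refine N.resOut_induction (fun f : Vec Lin × N.Param → ℝ => ContDiff ℝ ∞ f) (fun z => z.2)
    (fun z => z.1.ofLp) contDiff_const contDiff_const (fun f g hf hg => hf.add hg)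
    (fun idx f hf => ContDiff.mul ?_ hf) (fun i j l f hf => (N.act_smooth i j l).comp hf)
    (fun i l f hf => (N.pre_smooth i l).comp hf) (fun l => ?_) N.b
  · exact (contDiff_euclidean.1 contDiff_snd) idx
  · exact (contDiff_euclidean.1 contDiff_fst) l

theorem contDiff_jac : ContDiff ℝ ∞ (fun z : Vec Lin × N.Param => N.jac z.1 z.2) := by
  have h : ContDiff ℝ ∞ (Function.uncurry fun (z : Vec Lin × N.Param) Θ => N.Psi z.1 Θ) :=
    N.contDiff_Psi.comp ((contDiff_fst.comp contDiff_fst).prodMk contDiff_snd)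
  exact h.fderiv contDiff_snd le_rfl

theorem continuous_fderiv_jac :
    Continuous (fun z : Vec Lin × N.Param => fderiv ℝ (N.jac z.1) z.2) := by
  have h : ContDiff ℝ ∞ (Function.uncurry fun (z : Vec Lin × N.Param) Θ => N.jac z.1 Θ) :=
    N.contDiff_jac.comp ((contDiff_fst.comp contDiff_fst).prodMk contDiff_snd)
  exact (h.fderiv (n := ∞) contDiff_snd le_rfl).continuous

theorem hasFDerivAt_Psi (x : Vec Lin) (Θ : N.Param) :
    HasFDerivAt (N.Psi x) (N.jac x Θ) Θ := by
  have : ContDiff ℝ ∞ (N.Psi x) := N.contDiff_Psi.comp (contDiff_const.prodMk contDiff_id)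
  exact (this.differentiable (by simp) Θ).hasFDerivAt

theorem differentiable_jac (x : Vec Lin) : Differentiable ℝ (N.jac x) := by
  have : ContDiff ℝ ∞ (N.jac x) := N.contDiff_jac.comp (contDiff_const.prodMk contDiff_id)
  exact this.differentiable (by simp)

/-- The remainder is quadratic, with the bound of the second derivative as factor. -/
theorem norm_remainder_le {s : Set N.Param} (hs : Convex ℝ s) {x : Vec Lin} {C : ℝ}
    (hC : ∀ Θ ∈ s, ‖fderiv ℝ (N.jac x) Θ‖ ≤ C) {Θs Θ : N.Param} (hΘs : Θs ∈ s) (hΘ : Θ ∈ s) :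
    ‖N.remainder x Θs Θ‖ ≤ C * ‖Θs - Θ‖ ^ 2 := by
  have hC0 : 0 ≤ C := le_trans (norm_nonneg (fderiv ℝ (N.jac x) Θ)) (hC Θ hΘ)
  have hseg : segment ℝ Θ Θs ⊆ s := hs.segment_subset hΘ hΘs
  have h1 : ∀ z ∈ segment ℝ Θ Θs, ‖N.jac x z - N.jac x Θ‖ ≤ C * ‖Θs - Θ‖ := by
    intro z hz
    refine ((convex_segment Θ Θs).norm_image_sub_le_of_norm_fderiv_le
      (fun y _ => N.differentiable_jac x y) (fun y hy => hC y (hseg hy))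
      (left_mem_segment ℝ Θ Θs) hz).trans ?_
    gcongr
    obtain ⟨r, hr, rfl⟩ := (segment_eq_image' ℝ Θ Θs) ▸ hz
    simp only [add_sub_cancel_left, norm_smul, Real.norm_of_nonneg hr.1]
    exact mul_le_of_le_one_left (norm_nonneg _) hr.2
  have := (convex_segment Θ Θs).norm_image_sub_le_of_norm_hasFDerivWithin_le' (φ := N.jac x Θ)
    (fun y _ => (N.hasFDerivAt_Psi x y).hasFDerivWithinAt) h1 (left_mem_segment ℝ Θ Θs)
    (right_mem_segment ℝ Θ Θs)
  calc ‖N.remainder x Θs Θ‖ ≤ C * ‖Θs - Θ‖ * ‖Θs - Θ‖ := this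
    _ = _ := by ring

/-- Scalar functions of one variable whose first two derivatives are bounded on `[0, 1]` with the
growth of network outputs along segments in the parameter space. -/
def SegmentGrowth {α : Type*} (m w : α → ℝ) (f : α × ℝ → ℝ) : Prop :=
  ∃ A : ℝ, 0 ≤ A ∧ ∀ a, ∃ F₁ F₂ : ℝ → ℝ, (∀ s, HasDerivAt (fun s => f (a, s)) (F₁ s) s) ∧
    (∀ s, HasDerivAt F₁ (F₂ s) s) ∧ ∀ s ∈ Icc (0 : ℝ) 1, |f (a, s)| ≤ A * m a ∧
      |F₁ s| ≤ A * (m a * w a) ∧ |F₂ s| ≤ A * (m a ^ 2 * w a ^ 2)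

namespace SegmentGrowth

variable {α : Type*} {m w : α → ℝ} {f g : α × ℝ → ℝ}

theorem of_bound (hm : ∀ a, 1 ≤ m a) (hw : ∀ a, 0 ≤ w a) {c : α → ℝ} {A : ℝ} (hA : 0 ≤ A)
    (h : ∀ a, |c a| ≤ A * m a) :
    SegmentGrowth m w fun z => c z.1 := by
  refine ⟨A, hA, fun a => ⟨fun _ => 0, fun _ => 0, fun s => hasDerivAt_const s (c a),
    fun s => hasDerivAt_const s 0, fun s _ => ⟨h a, ?_, ?_⟩⟩⟩ <;>
  · have := hm a
    have := hw a
    rw [abs_zero]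
    positivity

theorem add (hf : SegmentGrowth m w f) (hg : SegmentGrowth m w g) :
    SegmentGrowth m w fun z => f z + g z := by
  obtain ⟨A, hA, hf⟩ := hf
  obtain ⟨A', hA', hg⟩ := hg
  refine ⟨A + A', add_nonneg hA hA', fun a => ?_⟩
  obtain ⟨F₁, F₂, hF₁, hF₂, hF⟩ := hf a
  obtain ⟨G₁, G₂, hG₁, hG₂, hG⟩ := hg a
  refine ⟨fun s => F₁ s + G₁ s, fun s => F₂ s + G₂ s, fun s => (hF₁ s).add (hG₁ s),
    fun s => (hF₂ s).add (hG₂ s), fun s hs => ?_⟩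
  obtain ⟨h1, h2, h3⟩ := hF s hs
  obtain ⟨h4, h5, h6⟩ := hG s hs
  refine ⟨(abs_add_le _ _).trans ?_, (abs_add_le _ _).trans ?_, (abs_add_le _ _).trans ?_⟩ <;>
  linarith

/-- Along a segment each weight is affine with slope at most `w`, so it contributes at most one
derivative. The new term w·(m·w) in the second derivative is absorbed into m²w² because m ≥ 1. -/
theorem affine_mul (hm : ∀ a, 1 ≤ m a) (hw : ∀ a, 0 ≤ w a) {c v : α → ℝ} {M : ℝ} (hM : 0 ≤ M)
    (hc : ∀ a, ∀ s ∈ Icc (0 : ℝ) 1, |c a + s * v a| ≤ M) (hv : ∀ a, |v a| ≤ w a)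
    (hf : SegmentGrowth m w f) : SegmentGrowth m w fun z => (c z.1 + z.2 * v z.1) * f z := by
  obtain ⟨A, hA, hf⟩ := hf
  refine ⟨(2 + M) * A, by positivity, fun a => ?_⟩
  obtain ⟨F₁, F₂, hF₁, hF₂, hF⟩ := hf a
  have hlin : ∀ s, HasDerivAt (fun s => c a + s * v a) (v a) s := fun s => by
    simpa using ((hasDerivAt_id s).mul_const (v a)).const_add (c a)
  refine ⟨fun s => v a * f (a, s) + (c a + s * v a) * F₁ s,
    fun s => v a * F₁ s + (v a * F₁ s + (c a + s * v a) * F₂ s),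
    fun s => (hlin s).mul (hF₁ s),
    fun s => ((hF₁ s).const_mul (v a)).add ((hlin s).mul (hF₂ s)), fun s hs => ?_⟩
  obtain ⟨h1, h2, h3⟩ := hF s hs
  have hcs := hc a s hs
  have hva := hv a
  have hma := hm a
  have hwa := hw a
  have e1 : |v a * f (a, s)| ≤ w a * (A * m a) := by rw [abs_mul]; gcongr
  have e2 : |(c a + s * v a) * F₁ s| ≤ M * (A * (m a * w a)) := by rw [abs_mul]; gcongr
  have e3 : |v a * F₁ s| ≤ w a * (A * (m a * w a)) := by rw [abs_mul]; gcongr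
  have e4 : |(c a + s * v a) * F₂ s| ≤ M * (A * (m a ^ 2 * w a ^ 2)) := by rw [abs_mul]; gcongr
  have e5 : |(c a + s * v a) * f (a, s)| ≤ M * (A * m a) := by rw [abs_mul]; gcongr
  have hmm : w a * (A * (m a * w a)) ≤ A * (m a ^ 2 * w a ^ 2) := by
    have : A * w a ^ 2 * m a ≤ A * w a ^ 2 * m a ^ 2 := by
      gcongr
      nlinarith
    nlinarith
  have p1 : 0 ≤ A * m a := by positivity
  have p2 : 0 ≤ A * (m a * w a) := by positivity
  refine ⟨by nlinarith, (abs_add_le _ _).trans (by nlinarith), ?_⟩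
  refine (abs_add_le _ _).trans ((add_le_add le_rfl (abs_add_le _ _)).trans ?_)
  linarith

/-- A bounded σ' preserves linear growth of values and of first derivatives. In the second
derivative, σ'' multiplies the square of the first derivative; this is the source of the factor m²
and of the quadratic growth of the remainder bound. -/
theorem comp (hm : ∀ a, 1 ≤ m a) (hw : ∀ a, 0 ≤ w a) {σ : ℝ → ℝ} (hσ : ContDiff ℝ ∞ σ) {C : ℝ}
    (hC : ∀ x, |deriv σ x| ≤ C ∧ |iteratedDeriv 2 σ x| ≤ C) (hf : SegmentGrowth m w f) :
    SegmentGrowth m w fun z => σ (f z) := by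
  have hC0 : 0 ≤ C := (abs_nonneg _).trans (hC 0).1
  obtain ⟨A, hA, hf⟩ := hf
  refine ⟨|σ 0| + C * A + C * A ^ 2, by positivity, fun a => ?_⟩
  obtain ⟨F₁, F₂, hF₁, hF₂, hF⟩ := hf a
  have hd1 : ∀ y, HasDerivAt σ (deriv σ y) y := fun y =>
    (hσ.differentiable (by simp) y).hasDerivAt
  have hd2 : ∀ y, HasDerivAt (deriv σ) (iteratedDeriv 2 σ y) y := fun y => by
    rw [iteratedDeriv_succ, iteratedDeriv_one]
    have : ContDiff ℝ ∞ (deriv σ) := (contDiff_infty_iff_deriv.1 hσ).2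
    exact (this.differentiable (by simp) y).hasDerivAt
  refine ⟨fun s => deriv σ (f (a, s)) * F₁ s,
    fun s => iteratedDeriv 2 σ (f (a, s)) * F₁ s * F₁ s + deriv σ (f (a, s)) * F₂ s,
    fun s => (hd1 _).comp s (hF₁ s), fun s => ((hd2 _).comp s (hF₁ s)).mul (hF₂ s),
    fun s hs => ?_⟩
  obtain ⟨h1, h2, h3⟩ := hF s hs
  have hma := hm a
  have hwa := hw a
  have c1 := (hC (f (a, s))).1
  have c2 := (hC (f (a, s))).2
  have e1 : |σ (f (a, s)) - σ 0| ≤ C * (A * m a) := by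
    have := convex_univ.norm_image_sub_le_of_norm_deriv_le (f := σ) (C := C) (x := 0)
      (y := f (a, s)) (fun y _ => (hd1 y).differentiableAt) (fun y _ => (hC y).1) (mem_univ _)
      (mem_univ _)
    rw [Real.norm_eq_abs, Real.norm_eq_abs, sub_zero] at this
    exact this.trans (by gcongr)
  have e2 : |deriv σ (f (a, s)) * F₁ s| ≤ C * (A * (m a * w a)) := by rw [abs_mul]; gcongr
  have e3 : |deriv σ (f (a, s)) * F₂ s| ≤ C * (A * (m a ^ 2 * w a ^ 2)) := by
    rw [abs_mul]; gcongr
  have e4 : |iteratedDeriv 2 σ (f (a, s)) * F₁ s * F₁ s|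
      ≤ C * (A * (m a * w a)) * (A * (m a * w a)) := by
    rw [abs_mul, abs_mul]; gcongr
  have p0 := abs_nonneg (σ 0)
  refine ⟨?_, ?_, (abs_add_le _ _).trans ?_⟩
  · have e5 : |σ (f (a, s))| ≤ |σ (f (a, s)) - σ 0| + |σ 0| := by
      simpa using abs_add_le (σ (f (a, s)) - σ 0) (σ 0)
    have : |σ 0| ≤ |σ 0| * m a := le_mul_of_one_le_right p0 hma
    have : 0 ≤ C * A ^ 2 * m a := by positivity
    linarith
  · have : 0 ≤ (|σ 0| + C * A ^ 2) * (m a * w a) := by positivity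
    linarith
  · have : 0 ≤ |σ 0| * (m a ^ 2 * w a ^ 2) := by positivity
    linarith

/-- Two mean value estimates on [0, 1]: one for F₁, one for f with its linear part at 0 removed. -/
theorem taylor (hf : SegmentGrowth m w f) (hw : ∀ a, 0 ≤ w a) (hm : ∀ a, 1 ≤ m a) :
    ∃ A, 0 ≤ A ∧ ∀ a D, HasDerivAt (fun s => f (a, s)) D 0 →
      |f (a, 1) - f (a, 0) - D| ≤ A * (m a ^ 2 * w a ^ 2) := by
  obtain ⟨A, hA, hf⟩ := hf
  refine ⟨A, hA, fun a D hD => ?_⟩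
  obtain ⟨F₁, F₂, hF₁, hF₂, hF⟩ := hf a
  rw [hD.unique (hF₁ 0)]
  have h1 : ∀ s ∈ Icc (0 : ℝ) 1, ‖F₁ s - F₁ 0‖ ≤ A * (m a ^ 2 * w a ^ 2) := by
    intro s hs
    have := (convex_Icc (0 : ℝ) 1).norm_image_sub_le_of_norm_hasDerivWithin_le (f := F₁)
      (fun r _ => (hF₂ r).hasDerivWithinAt) (fun r hr => (hF r hr).2.2)
      (left_mem_Icc.2 zero_le_one) hs
    refine this.trans ?_
    rw [Real.norm_eq_abs, sub_zero, abs_of_nonneg hs.1]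
    exact mul_le_of_le_one_right (by have := hw a; have := hm a; positivity) hs.2
  have := (convex_Icc (0 : ℝ) 1).norm_image_sub_le_of_norm_hasDerivWithin_le
    (f := fun s => f (a, s) - s * F₁ 0)
    (fun r _ => (((hF₁ r).sub ((hasDerivAt_id r).mul_const (F₁ 0))).hasDerivWithinAt))
    (fun r hr => by simpa using h1 r hr)
    (left_mem_Icc.2 zero_le_one) (right_mem_Icc.2 zero_le_one)
  simp only [Real.norm_eq_abs, one_mul, zero_mul, sub_zero, abs_one, mul_one] at this
  rwa [sub_right_comm]

end SegmentGrowth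

/-- For activations with bounded derivatives, the factor of the remainder grows quadratically
with the input, uniformly on bounded convex sets of parameters. -/
theorem exists_remainder_le_of_boundedDerivs (hN : N.BoundedDerivs) {s : Set N.Param}
    (hb : Bornology.IsBounded s) {Θs : N.Param} (hΘs : Θs ∈ s) :
    ∃ A : ℝ, 0 ≤ A ∧ ∀ x, ∀ Θ ∈ s,
      ‖N.remainder x Θs Θ‖ ≤ A * (1 + ‖x‖) ^ 2 * ‖Θs - Θ‖ ^ 2 := by
  obtain ⟨M, hM⟩ := hb.exists_norm_le
  have hM0 : 0 ≤ M := (norm_nonneg _).trans (hM _ hΘs)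
  set m : Vec Lin × s → ℝ := fun a => 1 + ‖a.1‖ with hm
  set w : Vec Lin × s → ℝ := fun a => ‖Θs - a.2‖ with hw
  have hm1 : ∀ a, 1 ≤ m a := fun a => by
    have := norm_nonneg a.1
    simp only [hm]
    linarith
  have hw0 : ∀ a, 0 ≤ w a := fun a => norm_nonneg _
  have key : ∀ l, SegmentGrowth m w (fun z => N.Psi z.1.1 (z.1.2.1 + z.2 • (Θs - z.1.2.1)) l) := by
    refine N.resOut_induction (SegmentGrowth m w) (fun z => z.1.2.1 + z.2 • (Θs - z.1.2.1))
      (fun z => z.1.1.ofLp) ?_ ?_ (fun f g hf hg => hf.add hg) (fun idx f hf => ?_)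
      (fun i j l f hf => ?_) (fun i l f hf => ?_) (fun l => ?_) N.b
    · exact SegmentGrowth.of_bound hm1 hw0 (c := fun _ => 0) le_rfl (by simp)
    · exact SegmentGrowth.of_bound hm1 hw0 (c := fun _ => 1) zero_le_one (by simpa using hm1)
    -- An entry of Θ is bounded by M and the increment s(Θ* - Θ) by 2M, hence 3M.
    · refine SegmentGrowth.affine_mul hm1 hw0 (M := 3 * M) (c := fun a => a.2.1 idx)
        (v := fun a => (Θs - a.2.1) idx) (by positivity) (fun a s hs => ?_)
        (fun a => EuclideanSpace.abs_apply_le_norm _ _) hf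
      have h1 := (EuclideanSpace.abs_apply_le_norm a.2.1 idx).trans (hM _ a.2.2)
      have h2 := (EuclideanSpace.abs_apply_le_norm (Θs - a.2.1) idx).trans
        ((norm_sub_le _ _).trans (add_le_add (hM _ hΘs) (hM _ a.2.2)))
      have h3 : |s * (Θs - a.2.1) idx| ≤ 1 * (M + M) := by
        rw [abs_mul, abs_of_nonneg hs.1]
        gcongr
        exact hs.2
      exact (abs_add_le _ _).trans (by linarith)
    · obtain ⟨C, hC⟩ := hN.1 i j l
      exact hf.comp hm1 hw0 (N.act_smooth i j l) hC
    · obtain ⟨C, hC⟩ := hN.2 i l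
      exact hf.comp hm1 hw0 (N.pre_smooth i l) hC
    · refine SegmentGrowth.of_bound hm1 hw0 (c := fun a => a.1 l) zero_le_one (fun a => ?_)
      have := EuclideanSpace.abs_apply_le_norm a.1 l
      simp only [hm]
      linarith
  choose A hA hle using fun l => (key l).taylor hw0 hm1
  refine ⟨∑ l, A l, Finset.sum_nonneg fun l _ => hA l, fun x Θ hΘ => ?_⟩
  refine (EuclideanSpace.norm_le_sum _).trans ?_
  rw [Finset.sum_mul, Finset.sum_mul]
  refine Finset.sum_le_sum fun l _ => ?_
  have hline : HasDerivAt (fun r : ℝ => Θ + r • (Θs - Θ)) (Θs - Θ) 0 := by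
    simpa using ((hasDerivAt_id (0 : ℝ)).smul_const (Θs - Θ)).const_add Θ
  have hd : HasDerivAt (fun r : ℝ => N.Psi x (Θ + r • (Θs - Θ)) l) (N.jac x Θ (Θs - Θ) l) 0 := by
    have h1 : HasFDerivAt (N.Psi x) (N.jac x Θ) (Θ + (0 : ℝ) • (Θs - Θ)) := by
      simpa using N.hasFDerivAt_Psi x Θ
    exact (EuclideanSpace.proj l : Vec Lout →L[ℝ] ℝ).hasFDerivAt.comp_hasDerivAt (0 : ℝ)
      (h1.comp_hasDerivAt (0 : ℝ) hline)
  have := hle l (x, ⟨Θ, hΘ⟩) _ hd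
  simp only [one_smul, zero_smul, add_zero, add_sub_cancel] at this
  rw [mul_assoc]
  exact this

end ResNet

/-! ### Existence of remainder bounds -/

namespace Design

variable {n : ℕ} (d : Design n)

theorem isCompact_searchSpace : IsCompact d.searchSpace :=
  Metric.isCompact_of_isClosed_isBounded
    (isClosed_le d.P_smooth.continuous continuous_const) d.P_bounded

theorem convex_searchSpace : Convex ℝ d.searchSpace := by
  simpa [searchSpace] using d.P_convex.convex_le 0

/-- The factor is s plus the supremum of the second parameter derivative over inputs in the ball of
radius s and Θ in the search space. Writing these inputs as s·u with ‖u‖ ≤ 1 keeps the compact index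
set fixed, so the supremum is continuous in s. The summand s makes the sum strictly increasing and
unbounded. -/
theorem exists_isRemainderBound {Θs : d.net.Param} (hΘs : Θs ∈ d.searchSpace) :
    ∃ ρ₀ : ℝ → ℝ, d.IsRemainderBound Θs ρ₀ := by
  set K : Set (Vec (n + n + n + n) × d.net.Param) := Metric.closedBall 0 1 ×ˢ d.searchSpace with hK
  have hKc : IsCompact K := (isCompact_closedBall _ _).prod d.isCompact_searchSpace
  set D : ℝ → Vec (n + n + n + n) × d.net.Param → ℝ :=
    fun s z => ‖fderiv ℝ (d.net.jac (s • z.1)) z.2‖ with hD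
  have hDc : Continuous (Function.uncurry D) := by
    have h := d.net.continuous_fderiv_jac.comp
      (f := fun y : ℝ × Vec (n + n + n + n) × d.net.Param => (y.1 • y.2.1, y.2.2)) (by fun_prop)
    exact Continuous.norm (E := d.net.Param →L[ℝ] d.net.Param →L[ℝ] Vec n) h
  have hbdd : ∀ s, BddAbove (D s '' K) := fun s =>
    (hKc.image (hDc.comp (Continuous.prodMk_right s))).bddAbove
  have hle : ∀ s, ∀ u, ‖u‖ ≤ 1 → ∀ Θ ∈ d.searchSpace,
      ‖fderiv ℝ (d.net.jac (s • u)) Θ‖ ≤ sSup (D s '' K) := fun s u hu Θ hΘ =>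
    le_csSup (hbdd s) ⟨(u, Θ), ⟨mem_closedBall_zero_iff.2 hu, hΘ⟩, rfl⟩
  have hmono : MonotoneOn (fun s => sSup (D s '' K)) (Ici 0) := by
    intro s hs s' hs' hss
    refine csSup_le ⟨_, ⟨(0, Θs), ⟨by simp, hΘs⟩, rfl⟩⟩ ?_
    rintro _ ⟨⟨u, Θ⟩, ⟨hu, hΘ⟩, rfl⟩
    rcases eq_or_lt_of_le (mem_Ici.1 hs') with h0 | h0
    · have : s = 0 := le_antisymm (hss.trans_eq h0.symm) hs
      have h2 : s' = s := by rw [this, ← h0]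
      rw [h2]
      exact hle s u (mem_closedBall_zero_iff.1 hu) Θ hΘ
    · have h1 : s • u = s' • ((s / s') • u) := by
        rw [smul_smul, mul_div_cancel₀ _ h0.ne']
      simp only [hD]
      rw [h1]
      refine hle s' _ ?_ Θ hΘ
      rw [norm_smul, Real.norm_of_nonneg (div_nonneg hs h0.le)]
      exact mul_le_one₀ ((div_le_one h0).2 hss) (norm_nonneg _) (mem_closedBall_zero_iff.1 hu)
  have hnn : ∀ s, 0 ≤ sSup (D s '' K) := fun s =>
    Real.sSup_nonneg (by rintro _ ⟨z, _, rfl⟩; exact norm_nonneg (fderiv ℝ (d.net.jac (s • z.1)) z.2))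
  refine ⟨fun s => s + sSup (D s '' K), fun s hs => add_nonneg hs (hnn s), ?_, ?_, ?_, ?_⟩
  · exact (continuous_id.add (hKc.continuous_sSup hDc)).continuousOn
  · intro s hs s' hs' hss
    exact add_lt_add_of_lt_of_le hss (hmono hs hs' hss.le)
  · exact tendsto_atTop_mono (fun s => le_add_of_nonneg_right (hnn s)) tendsto_id
  · intro x Θ hΘ
    have hx : ∃ u, ‖u‖ ≤ 1 ∧ ‖x‖ • u = x := by
      by_cases h : x = 0
      · exact ⟨0, by simp, by simp [h]⟩
      · have : ‖x‖ ≠ 0 := norm_ne_zero_iff.2 h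
        refine ⟨‖x‖⁻¹ • x, ?_, ?_⟩
        · rw [norm_smul, norm_inv, norm_norm, inv_mul_cancel₀ this]
        · rw [smul_smul, mul_inv_cancel₀ this, one_smul]
    obtain ⟨u, hu, hux⟩ := hx
    have := d.net.norm_remainder_le d.convex_searchSpace (x := x)
      (fun Θ hΘ => by simpa only [hux] using hle ‖x‖ u hu Θ hΘ) hΘs hΘ
    refine this.trans ?_
    gcongr
    exact le_add_of_nonneg_left (norm_nonneg _)

theorem exists_quadratic_isRemainderBound (hN : d.net.BoundedDerivs) {Θs : d.net.Param}
    (hΘs : Θs ∈ d.searchSpace) : ∃ a₀ a₁ a₂ : ℝ, 0 ≤ a₀ ∧ 0 ≤ a₁ ∧ 0 ≤ a₂ ∧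
      d.IsRemainderBound Θs (fun s => a₂ * s ^ 2 + a₁ * s + a₀) := by
  obtain ⟨A, hA, hle⟩ := d.net.exists_remainder_le_of_boundedDerivs hN d.P_bounded hΘs
  -- The polynomial is A(1 + s)² + s; the extra s gives strict growth even when A = 0.
  refine ⟨A, 2 * A + 1, A, hA, by positivity, hA, fun s hs => by positivity, by fun_prop, ?_, ?_,
    fun x Θ hΘ => ?_⟩
  · intro s hs s' hs' hss
    have hs0 : 0 ≤ s := hs
    have h1 : s ^ 2 ≤ s' ^ 2 := by gcongr
    have h2 := mul_le_mul_of_nonneg_left h1 hA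
    have h3 := mul_le_mul_of_nonneg_left hss.le hA
    show A * s ^ 2 + (2 * A + 1) * s + A < A * s' ^ 2 + (2 * A + 1) * s' + A
    linarith
  · refine tendsto_atTop_mono' _ ?_ tendsto_id
    filter_upwards [eventually_ge_atTop 0] with s hs
    have : 0 ≤ A * s ^ 2 + 2 * A * s + A := by positivity
    simp only [id]
    linarith
  · refine (hle x Θ hΘ).trans ?_
    gcongr
    have := norm_nonneg x
    linarith

end Design

/-! ### Matrices as operators and their extreme eigenvalues -/

section MatrixVector

variable {ι κ μ : Type*} [Fintype ι] [Fintype κ] [Fintype μ]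

/-- The matrix-vector product as a continuous linear map. -/
def mvL (A : Matrix ι κ ℝ) : EuclideanSpace ℝ κ →L[ℝ] EuclideanSpace ℝ ι :=
  LinearMap.toContinuousLinearMap
    { toFun := mv A
      map_add' := fun x y => by ext i; simp [mv, Matrix.mulVec_add]
      map_smul' := fun c x => by ext i; simp [mv, Matrix.mulVec_smul] }

@[simp] theorem mvL_apply (A : Matrix ι κ ℝ) (x : EuclideanSpace ℝ κ) : mvL A x = mv A x := rfl

theorem mv_mul (A : Matrix ι κ ℝ) (B : Matrix κ μ ℝ) (x : EuclideanSpace ℝ μ) :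
    mv (A * B) x = mv A (mv B x) := by
  ext i
  simp [mv, Matrix.mulVec_mulVec]

theorem mv_one [DecidableEq ι] (x : EuclideanSpace ℝ ι) : mv 1 x = x := by
  ext i
  simp [mv]

theorem inner_mv (A : Matrix ι κ ℝ) (x : EuclideanSpace ℝ ι) (y : EuclideanSpace ℝ κ) :
    inner ℝ x (mv A y) = x.ofLp ⬝ᵥ (A *ᵥ y.ofLp) := by
  simp [mv, EuclideanSpace.inner_eq_star_dotProduct, dotProduct_comm]

theorem inner_mv_comm {A : Matrix ι ι ℝ} (hA : A.IsHermitian) (x y : EuclideanSpace ℝ ι) :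
    inner ℝ (mv A x) y = inner ℝ x (mv A y) := by
  have hT : Aᵀ = A := by simpa [Matrix.IsHermitian, Matrix.conjTranspose_eq_transpose_of_trivial] using hA
  rw [real_inner_comm, inner_mv, inner_mv, Matrix.dotProduct_mulVec, ← Matrix.mulVec_transpose, hT,
    dotProduct_comm]

theorem inner_mv_nonneg {A : Matrix ι ι ℝ} (hA : A.PosSemidef) (x : EuclideanSpace ℝ ι) :
    0 ≤ inner ℝ x (mv A x) := by
  rw [inner_mv]
  simpa using hA.dotProduct_mulVec_nonneg x.ofLp

theorem inner_mv_pos {A : Matrix ι ι ℝ} (hA : A.PosDef) {x : EuclideanSpace ℝ ι} (hx : x ≠ 0) :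
    0 < inner ℝ x (mv A x) := by
  rw [inner_mv]
  simpa using hA.dotProduct_mulVec_pos (x := x.ofLp) (by simpa using hx)

variable [DecidableEq ι]

theorem inner_mv_sub_smul_one (A : Matrix ι ι ℝ) (c : ℝ) (x : EuclideanSpace ℝ ι) :
    inner ℝ x (mv (A - algebraMap ℝ (Matrix ι ι ℝ) c) x) = inner ℝ x (mv A x) - c * ‖x‖ ^ 2 := by
  rw [inner_mv, inner_mv, Matrix.sub_mulVec, dotProduct_sub, Algebra.algebraMap_eq_smul_one,
    Matrix.smul_mulVec, Matrix.one_mulVec, dotProduct_smul, ← real_inner_self_eq_norm_sq,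
    EuclideanSpace.inner_eq_star_dotProduct, star_trivial, smul_eq_mul]

theorem finite_spectrum_matrix (A : Matrix ι ι ℝ) : (spectrum ℝ A).Finite :=
  Matrix.finite_spectrum A

/-- Subtracting the smallest eigenvalue shifts the spectrum into [0, ∞), so the difference is
positive semidefinite. -/
theorem sInf_spectrum_mul_le {A : Matrix ι ι ℝ} (hA : A.IsHermitian) (x : EuclideanSpace ℝ ι) :
    sInf (spectrum ℝ A) * ‖x‖ ^ 2 ≤ inner ℝ x (mv A x) := by
  have hps : (A - algebraMap ℝ (Matrix ι ι ℝ) (sInf (spectrum ℝ A))).PosSemidef := by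
    rw [Matrix.posSemidef_iff_isHermitian_and_spectrum_nonneg]
    refine ⟨hA.sub (by simp [Algebra.algebraMap_eq_smul_one, Matrix.IsHermitian]), ?_⟩
    rw [← spectrum.sub_singleton_eq]
    rintro _ ⟨a, ha, _, rfl, rfl⟩
    exact sub_nonneg.2 (csInf_le (finite_spectrum_matrix A).bddBelow ha)
  have := inner_mv_nonneg hps x
  rw [inner_mv_sub_smul_one] at this
  linarith

theorem inner_mv_le_sSup_spectrum {A : Matrix ι ι ℝ} (hA : A.IsHermitian)
    (x : EuclideanSpace ℝ ι) :
    inner ℝ x (mv A x) ≤ sSup (spectrum ℝ A) * ‖x‖ ^ 2 := by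
  have hps : (algebraMap ℝ (Matrix ι ι ℝ) (sSup (spectrum ℝ A)) - A).PosSemidef := by
    rw [Matrix.posSemidef_iff_isHermitian_and_spectrum_nonneg]
    refine ⟨Matrix.IsHermitian.sub (by simp [Algebra.algebraMap_eq_smul_one, Matrix.IsHermitian]) hA, ?_⟩
    rw [← spectrum.singleton_sub_eq]
    rintro _ ⟨_, rfl, a, ha, rfl⟩
    exact sub_nonneg.2 (le_csSup (finite_spectrum_matrix A).bddAbove ha)
  have := inner_mv_nonneg hps x
  rw [← neg_sub, ← mvL_apply] at this
  have h2 : mvL (-(A - algebraMap ℝ (Matrix ι ι ℝ) (sSup (spectrum ℝ A)))) x =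
      - mv (A - algebraMap ℝ (Matrix ι ι ℝ) (sSup (spectrum ℝ A))) x := by
    ext i
    simp only [mvL_apply, mv, Matrix.neg_mulVec]
    rfl
  rw [h2, inner_neg_right, inner_mv_sub_smul_one] at this
  linarith

/-- The spectrum is finite and nonempty, so the infimum is an eigenvalue. The index type must be
nonempty because the real infimum of the empty set is 0. -/
theorem sInf_spectrum_pos [Nonempty ι] {A : Matrix ι ι ℝ} (hA : A.PosDef) :
    0 < sInf (spectrum ℝ A) := by
  have hne : (spectrum ℝ A).Nonempty := by
    rw [hA.isHermitian.spectrum_real_eq_range_eigenvalues]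
    exact range_nonempty _
  have := hne.csInf_mem (finite_spectrum_matrix A)
  rw [hA.isHermitian.spectrum_real_eq_range_eigenvalues] at this ⊢
  obtain ⟨i, hi⟩ := this
  rw [← hi]
  exact hA.eigenvalues_pos i

end MatrixVector

/-- Over ℝ the Gram matrix AAᵀ has the rank of A, so here its n rows are independent. -/
theorem Matrix.isUnit_mul_transpose_of_rank {n m : ℕ} {A : Matrix (Fin n) (Fin m) ℝ}
    (hA : A.rank = n) : IsUnit (A * Aᵀ) := by
  rw [← Matrix.linearIndependent_rows_iff_isUnit, linearIndependent_iff_card_eq_finrank_span,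
    Fintype.card_fin, Set.finrank, ← Matrix.rank_eq_finrank_span_row,
    Matrix.rank_self_mul_transpose, hA]

theorem Plant.mv_g_gPlus {n m : ℕ} (S : Plant n m) {q v : Vec n} {t : ℝ} (ht : 0 ≤ t) (x : Vec n) :
    mv (S.g (q, v, t)) (mv (S.gPlus q v t) x) = x := by
  have h := Matrix.isUnit_mul_transpose_of_rank (S.g_rank q v t ht)
  rw [← mv_mul, Plant.gPlus, ← Matrix.mul_assoc,
    Matrix.mul_nonsing_inv _ ((Matrix.isUnit_iff_isUnit_det _).1 h), mv_one]

theorem ResNet.nonempty_paramIdx {Lin Lout : ℕ} (N : ResNet Lin Lout) : Nonempty N.ParamIdx :=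
  ⟨⟨0, 0, (Fin.last _, ⟨0, N.L_pos _ _⟩)⟩⟩

/-! ### Stacked states -/

namespace Design

variable {n m : ℕ} (d : Design n)

/-- The stacked vector `[aᵀ bᵀ cᵀ]ᵀ`. -/
def stack (a b : Vec n) (c : d.net.Param) : d.State :=
  WithLp.toLp 2 (Sum.elim (Sum.elim a.ofLp b.ofLp) c.ofLp)

/-- Stacking as a continuous linear map. -/
def stackL : (Vec n × Vec n × d.net.Param) →L[ℝ] d.State :=
  LinearMap.toContinuousLinearMap
    { toFun := fun x => d.stack x.1 x.2.1 x.2.2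
      map_add' := fun x y => by ext ((i | i) | i) <;> rfl
      map_smul' := fun c x => by ext ((i | i) | i) <;> rfl }

/-- First block of a stacked vector. -/
def fstL : d.State →L[ℝ] Vec n :=
  LinearMap.toContinuousLinearMap
    { toFun := fun x => WithLp.toLp 2 fun i => x (Sum.inl (Sum.inl i))
      map_add' := fun _ _ => rfl
      map_smul' := fun _ _ => rfl }

/-- Second block of a stacked vector. -/
def sndL : d.State →L[ℝ] Vec n :=
  LinearMap.toContinuousLinearMap
    { toFun := fun x => WithLp.toLp 2 fun i => x (Sum.inl (Sum.inr i))
      map_add' := fun _ _ => rfl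
      map_smul' := fun _ _ => rfl }

/-- Parameter block of a stacked vector. -/
def parL : d.State →L[ℝ] d.net.Param :=
  LinearMap.toContinuousLinearMap
    { toFun := fun x => WithLp.toLp 2 fun i => x (Sum.inr i)
      map_add' := fun _ _ => rfl
      map_smul' := fun _ _ => rfl }

@[simp] theorem stackL_apply (x : Vec n × Vec n × d.net.Param) :
    d.stackL x = d.stack x.1 x.2.1 x.2.2 := rfl

@[simp] theorem fstL_stack (a b : Vec n) (c : d.net.Param) : d.fstL (d.stack a b c) = a := rfl

@[simp] theorem sndL_stack (a b : Vec n) (c : d.net.Param) : d.sndL (d.stack a b c) = b := rfl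

@[simp] theorem parL_stack (a b : Vec n) (c : d.net.Param) : d.parL (d.stack a b c) = c := rfl

theorem stack_eta (x : d.State) : d.stack (d.fstL x) (d.sndL x) (d.parL x) = x := by
  ext ((i | i) | i) <;> rfl

theorem stack_sub (a b a' b' : Vec n) (c c' : d.net.Param) :
    d.stack a b c - d.stack a' b' c' = d.stack (a - a') (b - b') (c - c') := by
  ext ((i | i) | i) <;> rfl

theorem stack_smul (r : ℝ) (a b : Vec n) (c : d.net.Param) :
    r • d.stack a b c = d.stack (r • a) (r • b) (r • c) := by
  ext ((i | i) | i) <;> rfl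

theorem inner_stack (a b a' b' : Vec n) (c c' : d.net.Param) :
    inner ℝ (d.stack a b c) (d.stack a' b' c') = inner ℝ a a' + inner ℝ b b' + inner ℝ c c' := by
  simp [stack, PiLp.inner_apply, Fintype.sum_sum_type]

theorem norm_sq_stack (a b : Vec n) (c : d.net.Param) :
    ‖d.stack a b c‖ ^ 2 = ‖a‖ ^ 2 + ‖b‖ ^ 2 + ‖c‖ ^ 2 := by
  simp only [← real_inner_self_eq_norm_sq, inner_stack]

theorem norm_le_norm_stack (a b : Vec n) (c : d.net.Param) :
    ‖a‖ ≤ ‖d.stack a b c‖ ∧ ‖b‖ ≤ ‖d.stack a b c‖ ∧ ‖c‖ ≤ ‖d.stack a b c‖ := by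
  have h := d.norm_sq_stack a b c
  refine ⟨?_, ?_, ?_⟩ <;> apply le_of_sq_le_sq _ (norm_nonneg _) <;>
    linarith [sq_nonneg ‖a‖, sq_nonneg ‖b‖, sq_nonneg ‖c‖]

theorem norm_stack_le (a b : Vec n) (c : d.net.Param) :
    ‖d.stack a b c‖ ≤ ‖a‖ + ‖b‖ + ‖c‖ := by
  have h := d.norm_sq_stack a b c
  have := norm_nonneg a
  have := norm_nonneg b
  have := norm_nonneg c
  apply le_of_sq_le_sq _ (by positivity)
  have : 0 ≤ ‖a‖ * ‖b‖ := by positivity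
  have : 0 ≤ ‖a‖ * ‖c‖ := by positivity
  have : 0 ≤ ‖b‖ * ‖c‖ := by positivity
  linarith

theorem zvec_eq_stack (Θs : d.net.Param) (q v qd vd : Vec n) (Θ : d.net.Param) :
    d.zvec Θs q v qd vd Θ = d.stack (qd - q) (d.filt q v qd vd) (Θs - Θ) := rfl

/-- `blkdiag {I_{2n}, M}`. -/
def blockMatrix (M : Matrix d.net.ParamIdx d.net.ParamIdx ℝ) : Matrix d.StateIdx d.StateIdx ℝ :=
  Matrix.fromBlocks 1 0 0 M

theorem lyapMatrix_eq : d.lyapMatrix = d.blockMatrix d.Γ⁻¹ := rfl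

theorem mv_blockMatrix (M : Matrix d.net.ParamIdx d.net.ParamIdx ℝ) (a b : Vec n)
    (c : d.net.Param) : mv (d.blockMatrix M) (d.stack a b c) = d.stack a b (mv M c) := by
  ext ((i | i) | i) <;>
  simp [mv, blockMatrix, stack, Matrix.fromBlocks_mulVec, Function.comp_def]

theorem blockMatrix_posDef {M : Matrix d.net.ParamIdx d.net.ParamIdx ℝ} (hM : M.PosDef) :
    (d.blockMatrix M).PosDef := by
  refine Matrix.PosDef.of_dotProduct_mulVec_pos ?_ fun x hx => ?_
  · exact Matrix.IsHermitian.fromBlocks Matrix.isHermitian_one (by simp) hM.isHermitian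
  · have h1 := inner_mv (d.blockMatrix M) (WithLp.toLp 2 x) (WithLp.toLp 2 x)
    rw [star_trivial, ← h1]
    have hx' : (WithLp.toLp 2 x : d.State) ≠ 0 := by simpa using hx
    generalize (WithLp.toLp 2 x : d.State) = y at hx'
    rw [← d.stack_eta y, mv_blockMatrix, inner_stack]
    have e1 := real_inner_self_nonneg (x := d.fstL y)
    have e2 := real_inner_self_nonneg (x := d.sndL y)
    have e3 := inner_mv_nonneg hM.posSemidef (d.parL y)
    by_contra hcon
    have z1 : d.fstL y = 0 := inner_self_eq_zero.1 (le_antisymm (by linarith) e1)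
    have z2 : d.sndL y = 0 := inner_self_eq_zero.1 (le_antisymm (by linarith) e2)
    have z3 : d.parL y = 0 := by
      by_contra h3
      linarith [inner_mv_pos hM h3]
    apply hx'
    rw [← d.stack_eta y, z1, z2, z3]
    ext ((i | i) | i) <;> rfl

instance : Nonempty d.StateIdx := d.net.nonempty_paramIdx.map Sum.inr

theorem lyapMatrix_posDef : d.lyapMatrix.PosDef := d.blockMatrix_posDef d.Γ_posDef.inv

theorem lam₁_pos : 0 < d.lam₁ := sInf_spectrum_pos d.lyapMatrix_posDef

theorem lam₁_le_lamPhi : d.lam₁ ≤ d.lamPhi := by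
  have hne : (spectrum ℝ d.lyapMatrix).Nonempty := by
    rw [d.lyapMatrix_posDef.isHermitian.spectrum_real_eq_range_eigenvalues]
    exact range_nonempty _
  exact csInf_le_csSup hne (finite_spectrum_matrix _).bddBelow (finite_spectrum_matrix _).bddAbove

theorem lamPhi_pos : 0 < d.lamPhi := d.lam₁_pos.trans_le d.lam₁_le_lamPhi

/-- The projected dynamics of the stacked state. -/
def projData : ProjData d.State where
  P := fun x => d.P (d.parL x)
  P_smooth := (d.P_smooth.of_le (by norm_cast)).comp d.parL.contDiff
  P_convex := by
    have := d.P_convex.comp_linearMap d.parL.toLinearMap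
    exact this
  P_zero := by
    rw [map_zero]
    linarith [d.P_zero, d.layer_nonneg]
  A := mvL (d.blockMatrix d.Γ)
  B := mvL d.lyapMatrix
  B_A := fun x => by
    rw [← d.stack_eta x]
    simp only [mvL_apply, lyapMatrix_eq, mv_blockMatrix]
    have h := d.Γ_posDef.isUnit
    rw [← mv_mul, Matrix.nonsing_inv_mul _ ((Matrix.isUnit_iff_isUnit_det _).1 h), mv_one]
  B_symm := fun x y => inner_mv_comm d.lyapMatrix_posDef.isHermitian x y
  α := sInf (spectrum ℝ (d.blockMatrix d.Γ))
  α_pos := sInf_spectrum_pos (d.blockMatrix_posDef d.Γ_posDef)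
  A_coercive := fun x => sInf_spectrum_mul_le (d.blockMatrix_posDef d.Γ_posDef).isHermitian x
  β := d.lam₁
  β_pos := d.lam₁_pos
  B_coercive := fun x => sInf_spectrum_mul_le d.lyapMatrix_posDef.isHermitian x

theorem projData_P (x : d.State) : d.projData.P x = d.P (d.parL x) := rfl

theorem projData_grad (x : d.State) :
    d.projData.grad x = d.stack 0 0 (gradient d.P (d.parL x)) := by
  refine ext_inner_right ℝ fun y => ?_
  have hP : DifferentiableAt ℝ d.P (d.parL x) := d.P_smooth.differentiable (by simp) _
  have h1 : fderiv ℝ d.projData.P x = (fderiv ℝ d.P (d.parL x)).comp d.parL :=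
    (hP.hasFDerivAt.comp x d.parL.hasFDerivAt).fderiv
  conv_rhs => rw [← d.stack_eta y]
  rw [d.projData.inner_grad, h1, inner_stack, inner_zero_left, inner_zero_left, zero_add, zero_add,
    inner_gradient_left]
  rfl

/-- The constraint depends on the parameter block only, so its gradient has zero position and
velocity blocks. The block diagonal `A` preserves this, and the lifted projection leaves the
mechanical velocities alone. -/
theorem projData_pr (x : d.State) (a b : Vec n) (τ : d.net.Param) :
    d.projData.pr d.layer x (d.stack a b τ) = d.stack a b (d.proj (d.parL x) τ) := by
  have hA : d.projData.A (d.stack 0 0 (gradient d.P (d.parL x))) =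
      d.stack 0 0 (mv d.Γ (gradient d.P (d.parL x))) := d.mv_blockMatrix _ _ _ _
  have hw : d.projData.weight d.layer x = d.layerWeight (d.parL x) := rfl
  rw [ProjData.pr, ProjData.mult, projData_grad, hA, hw, inner_stack, inner_stack, stack_smul,
    stack_sub, proj]
  simp only [inner_zero_left, zero_add, smul_zero, sub_zero]
  split_ifs with h
  · rw [max_eq_right h.le]
  · rw [max_eq_left (not_lt.1 h), mul_zero, zero_div, zero_smul, sub_zero]

theorem layer_lt_neg_P_zero : d.layer < -d.projData.P 0 := by
  rw [projData_P, map_zero]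
  linarith [d.P_zero]

end Design

/-! ### The stacked input of the network -/

theorem norm_sq_kap {n : ℕ} (q v p w : Vec n) :
    ‖kap q v p w‖ ^ 2 = ‖q‖ ^ 2 + ‖v‖ ^ 2 + ‖p‖ ^ 2 + ‖w‖ ^ 2 := by
  simp only [EuclideanSpace.norm_sq_eq, kap, Fin.sum_univ_add, Fin.append_left, Fin.append_right]

theorem norm_kap_le {n : ℕ} (q v p w : Vec n) :
    ‖kap q v p w‖ ≤ ‖q‖ + ‖v‖ + ‖p‖ + ‖w‖ := by
  have h := norm_sq_kap q v p w
  have h1 := norm_nonneg q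
  have h2 := norm_nonneg v
  have h3 := norm_nonneg p
  have h4 := norm_nonneg w
  apply le_of_sq_le_sq _ (by positivity)
  have := mul_nonneg h1 h2
  have := mul_nonneg h1 h3
  have := mul_nonneg h1 h4
  have := mul_nonneg h2 h3
  have := mul_nonneg h2 h4
  have := mul_nonneg h3 h4
  linarith

theorem ContDiff.kap {X : Type*} [NormedAddCommGroup X] [NormedSpace ℝ X] {n : ℕ} {k : ℕ∞ω}
    {q v p w : X → Vec n} (hq : ContDiff ℝ k q) (hv : ContDiff ℝ k v) (hp : ContDiff ℝ k p)
    (hw : ContDiff ℝ k w) : ContDiff ℝ k (fun x => kap (q x) (v x) (p x) (w x)) := by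
  rw [contDiff_euclidean] at hq hv hp hw ⊢
  intro i
  simp only [_root_.kap]
  refine Fin.addCases (fun i => ?_) (fun i => ?_) i
  · refine Fin.addCases (fun i => ?_) (fun i => ?_) i
    · refine Fin.addCases (fun i => ?_) (fun i => ?_) i
      · simpa only [Fin.append_left, Fin.append_right] using hq i
      · simpa only [Fin.append_left, Fin.append_right] using hv i
    · simpa only [Fin.append_left, Fin.append_right] using hp i
  · simpa only [Fin.append_right] using hw i

namespace Design

variable {n m : ℕ} (d : Design n)

/-! ### Constants -/

theorem norm_le_thetaBar {Θ : d.net.Param} (hΘ : Θ ∈ d.searchSpace) : ‖Θ‖ ≤ d.thetaBar :=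
  le_csSup (d.isCompact_searchSpace.image continuous_norm).bddAbove (mem_image_of_mem _ hΘ)

/-- P(0) is strictly negative, so a small nonzero multiple of a basis vector is still in the search
space. Positivity is needed for `rho` to inherit strict growth from the remainder bound. -/
theorem thetaBar_pos : 0 < d.thetaBar := by
  obtain ⟨i⟩ := d.net.nonempty_paramIdx
  have hc : Continuous (fun r : ℝ => d.P (EuclideanSpace.single i r)) := by
    have hcs : Continuous (fun r : ℝ => r • (EuclideanSpace.single i (1 : ℝ) : d.net.Param)) := by
      fun_prop
    refine d.P_smooth.continuous.comp (hcs.congr fun r => ?_)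
    ext j
    by_cases h : j = i <;> simp [h]
  have h0 : d.P (EuclideanSpace.single i (0 : ℝ)) < 0 := by
    have : (EuclideanSpace.single i (0 : ℝ) : d.net.Param) = 0 := by simp
    rw [this]
    linarith [d.P_zero, d.layer_nonneg]
  have hev := (hc.tendsto 0).eventually (gt_mem_nhds h0)
  obtain ⟨r, hr, hr0⟩ := ((hev.filter_mono nhdsWithin_le_nhds).and
    (self_mem_nhdsWithin (a := (0 : ℝ)) (s := Ioi 0))).exists
  refine lt_of_lt_of_le ?_ (d.norm_le_thetaBar (Θ := EuclideanSpace.single i r) hr.le)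
  rw [PiLp.norm_single, Real.norm_eq_abs]
  exact abs_pos.2 (ne_of_gt hr0)

theorem delta_pos (ωb εb : ℝ) : 0 < d.delta ωb εb := by
  have h2 := d.k₂_pos
  have h3 := d.k₃_pos
  have := d.thetaBar_pos
  unfold delta
  positivity

theorem ultRadius_pos (ωb εb : ℝ) : 0 < d.ultRadius ωb εb := by
  have := d.delta_pos ωb εb
  have := d.lam₁_pos
  have := d.lamPhi_pos
  have := d.lamV_pos
  unfold ultRadius
  positivity

section Radius

variable {d} {Θs : d.net.Param} {ρ₀ : ℝ → ℝ} {qb vb : ℝ}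

theorem IsRemainderBound.strictMonoOn_rho (hρ : d.IsRemainderBound Θs ρ₀) (hq : 0 ≤ qb)
    (hv : 0 ≤ vb) : StrictMonoOn (d.rho ρ₀ qb vb) (Ici 0) := by
  intro s hs s' hs' hss
  have hk := d.k₁_pos
  have hs0 : 0 ≤ s := hs
  have h0 : 0 ≤ (d.k₁ + 2) * s + 2 * (qb + vb) := by positivity
  have h1 : (d.k₁ + 2) * s + 2 * (qb + vb) < (d.k₁ + 2) * s' + 2 * (qb + vb) := by gcongr
  have h2 := hρ.mono h0 (h0.trans h1.le) h1
  have h3 := hρ.nonneg _ h0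
  have := d.thetaBar_pos
  unfold rho
  gcongr

/-- The radius is defined by a chosen inverse, meaningful only if the value is attained. The gain
condition puts the value above ρ(r), so the intermediate value theorem yields a preimage, and strict
monotonicity places it beyond r. -/
theorem IsRemainderBound.radius_spec (hρ : d.IsRemainderBound Θs ρ₀) (hq : 0 ≤ qb) (hv : 0 ≤ vb)
    {r : ℝ} (hr : 0 ≤ r) (hgain : d.kmin > d.lamV + 1 / d.k₂ * d.rho ρ₀ qb vb r) :
    r < d.radius ρ₀ qb vb ∧ d.rho ρ₀ qb vb (d.radius ρ₀ qb vb) = d.k₂ * (d.kmin - d.lamV) := by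
  have hk1 := d.k₁_pos
  have hk2 := d.k₂_pos
  have hmono := hρ.strictMonoOn_rho hq hv
  have hlt : d.rho ρ₀ qb vb r < d.k₂ * (d.kmin - d.lamV) := by
    have h1 : 1 / d.k₂ * d.rho ρ₀ qb vb r < d.kmin - d.lamV := by linarith
    have h2 := mul_lt_mul_of_pos_left h1 hk2
    have h3 : d.k₂ * (1 / d.k₂ * d.rho ρ₀ qb vb r) = d.rho ρ₀ qb vb r := by field_simp
    linarith
  have hcont : ContinuousOn (fun s => d.rho ρ₀ qb vb s - d.rho ρ₀ qb vb 0) (Ici 0) := by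
    have h1 : ContinuousOn (fun s => ρ₀ ((d.k₁ + 2) * s + 2 * (qb + vb))) (Ici 0) := by
      refine hρ.cont.comp (by fun_prop) fun s hs => ?_
      have : 0 ≤ s := hs
      exact mem_Ici.2 (by positivity)
    unfold rho
    exact (continuousOn_const.mul (h1.pow 2)).sub continuousOn_const
  have htop : Tendsto (fun s => d.rho ρ₀ qb vb s - d.rho ρ₀ qb vb 0) atTop atTop := by
    have h1 : Tendsto (fun s => (d.k₁ + 2) * s + 2 * (qb + vb)) atTop atTop :=
      tendsto_atTop_add_const_right _ _ (tendsto_id.const_mul_atTop (by positivity))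
    have h2 := (tendsto_pow_atTop two_ne_zero).comp (hρ.unbounded.comp h1)
    have := d.thetaBar_pos
    exact tendsto_atTop_add_const_right _ _
      (h2.const_mul_atTop (show 0 < 3 * d.thetaBar ^ 2 by positivity))
  have hc : 0 ≤ d.k₂ * (d.kmin - d.lamV) - d.rho ρ₀ qb vb 0 := by
    have := hmono.monotoneOn (mem_Ici.2 le_rfl) (mem_Ici.2 hr) hr
    linarith
  have hex : ∃ s ∈ Ici (0 : ℝ), d.rho ρ₀ qb vb s - d.rho ρ₀ qb vb 0 =
      d.k₂ * (d.kmin - d.lamV) - d.rho ρ₀ qb vb 0 := by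
    obtain ⟨M, hM, hM0⟩ := ((htop.eventually_ge_atTop _).and (eventually_ge_atTop 0)).exists
    obtain ⟨s, hs, hse⟩ := intermediate_value_Icc hM0 (hcont.mono Icc_subset_Ici_self)
      (show d.k₂ * (d.kmin - d.lamV) - d.rho ρ₀ qb vb 0 ∈ _ from ⟨by simpa using hc, hM⟩)
    exact ⟨s, hs.1, hse⟩
  have hmem : d.radius ρ₀ qb vb ∈ Ici (0 : ℝ) := Function.invFunOn_mem hex
  have heq : d.rho ρ₀ qb vb (d.radius ρ₀ qb vb) - d.rho ρ₀ qb vb 0 =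
      d.k₂ * (d.kmin - d.lamV) - d.rho ρ₀ qb vb 0 := Function.invFunOn_eq hex
  have heq' := sub_left_injective heq
  refine ⟨?_, heq'⟩
  rw [← heq'] at hlt
  exact (hmono.lt_iff_lt (mem_Ici.2 hr) hmem).1 hlt

end Radius

/-- With q = q_d - e and q̇ = q̇_d - r + k₁e, the triangle inequality gives (1 + k₁)‖e‖ + ‖r‖ plus
twice the reference norms. This is where the factor k₁ + 2 in ρ and Ω comes from. -/
theorem norm_kap_le_zvec {Θs Θ : d.net.Param} {q v p w : Vec n} {qb vb : ℝ} (hp : ‖p‖ ≤ qb)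
    (hw : ‖w‖ ≤ vb) :
    ‖kap q v p w‖ ≤ (d.k₁ + 2) * ‖d.zvec Θs q v p w Θ‖ + 2 * (qb + vb) := by
  have hk := d.k₁_pos
  obtain ⟨h1, h2, -⟩ := d.norm_le_norm_stack (p - q) (d.filt q v p w) (Θs - Θ)
  rw [← zvec_eq_stack] at h1 h2
  have hq : ‖q‖ ≤ ‖p‖ + ‖p - q‖ := by
    have := norm_sub_le p (p - q)
    simpa using this
  have hv : ‖v‖ ≤ ‖w‖ + ‖d.filt q v p w‖ + d.k₁ * ‖p - q‖ := by
    have e : v = w - d.filt q v p w + d.k₁ • (p - q) := by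
      rw [filt]; abel
    calc ‖v‖ = ‖w - d.filt q v p w + d.k₁ • (p - q)‖ := by rw [← e]
      _ ≤ ‖w - d.filt q v p w‖ + ‖d.k₁ • (p - q)‖ := norm_add_le _ _
      _ ≤ ‖w‖ + ‖d.filt q v p w‖ + d.k₁ * ‖p - q‖ := by
        rw [norm_smul, Real.norm_of_nonneg hk.le]
        gcongr
        exact norm_sub_le _ _
  have h3 := mul_le_mul_of_nonneg_left h1 hk.le
  linarith [norm_kap_le q v p w]

/-! ### The closed loop -/

/-- The acceleration in the closed loop, as a function of the signals `(ω, q_d, q̇_d)` and the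
stacked state. -/
def fieldVel (S : Plant n m) (z : (Vec n × Vec n × Vec n) × d.State) : Vec n :=
  S.f (d.fstL z.2, d.sndL z.2)
    + ((1 - d.k₁ ^ 2) • (z.1.2.1 - d.fstL z.2)
      + (d.k₁ + d.k₂) • d.filt (d.fstL z.2) (d.sndL z.2) z.1.2.1 z.1.2.2
      + d.net.Psi (kap (d.fstL z.2) (d.sndL z.2) z.1.2.1 z.1.2.2) (d.parL z.2))
    + z.1.1

/-- The adaptation law before projection. -/
def fieldPar (z : (Vec n × Vec n × Vec n) × d.State) : d.net.Param :=
  mv d.Γ (ContinuousLinearMap.adjoint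
    (d.net.jac (kap (d.fstL z.2) (d.sndL z.2) z.1.2.1 z.1.2.2) (d.parL z.2))
    (d.filt (d.fstL z.2) (d.sndL z.2) z.1.2.1 z.1.2.2) - d.k₃ • d.parL z.2)

/-- The velocity of the stacked state `[qᵀ vᵀ Θᵀ]ᵀ` in the closed loop before projection. -/
def field (S : Plant n m) (z : (Vec n × Vec n × Vec n) × d.State) : d.State :=
  d.stackL (d.sndL z.2, d.fieldVel S z, d.fieldPar z)

theorem contDiff_filt : ContDiff ℝ ∞ (fun z : (Vec n × Vec n × Vec n) × d.State =>
    d.filt (d.fstL z.2) (d.sndL z.2) z.1.2.1 z.1.2.2) := by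
  unfold filt
  fun_prop

theorem contDiff_kap_state : ContDiff ℝ ∞ (fun z : (Vec n × Vec n × Vec n) × d.State =>
    kap (d.fstL z.2) (d.sndL z.2) z.1.2.1 z.1.2.2) :=
  ContDiff.kap (by fun_prop) (by fun_prop) (by fun_prop) (by fun_prop)

theorem locallyLipschitz_fieldVel (S : Plant n m) : LocallyLipschitz (d.fieldVel S) := by
  have hΘ : ContDiff ℝ ∞ (fun z : (Vec n × Vec n × Vec n) × d.State => d.parL z.2) := by fun_prop
  have hPsi := (d.net.contDiff_Psi.comp (d.contDiff_kap_state.prodMk hΘ)).of_le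
    (show (1 : ℕ∞ω) ≤ ∞ by norm_cast)
  have h1 : ContDiff ℝ 1 (fun z : (Vec n × Vec n × Vec n) × d.State =>
      S.f (d.fstL z.2, d.sndL z.2)) :=
    S.f_smooth.comp (by fun_prop)
  have h2 : ContDiff ℝ 1 (fun z : (Vec n × Vec n × Vec n) × d.State =>
      (1 - d.k₁ ^ 2) • (z.1.2.1 - d.fstL z.2)) := by fun_prop
  have h3 : ContDiff ℝ 1 (fun z : (Vec n × Vec n × Vec n) × d.State =>
      (d.k₁ + d.k₂) • d.filt (d.fstL z.2) (d.sndL z.2) z.1.2.1 z.1.2.2) :=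
    (d.contDiff_filt.of_le (by norm_cast)).const_smul _
  have h4 : ContDiff ℝ 1 (fun z : (Vec n × Vec n × Vec n) × d.State => z.1.1) := by fun_prop
  exact ((h1.add ((h2.add h3).add hPsi)).add h4).locallyLipschitz

theorem locallyLipschitz_fieldPar : LocallyLipschitz d.fieldPar := by
  have hΘ : ContDiff ℝ ∞ (fun z : (Vec n × Vec n × Vec n) × d.State => d.parL z.2) := by fun_prop
  have hjac := (d.net.contDiff_jac.comp (d.contDiff_kap_state.prodMk hΘ)).of_le
    (show (1 : ℕ∞ω) ≤ ∞ by norm_cast)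
  have h3 : LocallyLipschitz (fun z : (Vec n × Vec n × Vec n) × d.State =>
      ContinuousLinearMap.adjoint
      (d.net.jac (kap (d.fstL z.2) (d.sndL z.2) z.1.2.1 z.1.2.2) (d.parL z.2))) :=
    (LinearIsometryEquiv.lipschitz ContinuousLinearMap.adjoint).locallyLipschitz.comp
      hjac.locallyLipschitz
  have h4 := (d.contDiff_filt.of_le (show (1 : ℕ∞ω) ≤ ∞ by norm_cast)).locallyLipschitz
  have h5 := ((hΘ.of_le (show (1 : ℕ∞ω) ≤ ∞ by norm_cast)).const_smul d.k₃).locallyLipschitz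
  exact LocallyLipschitz.clm (mvL d.Γ) ((h3.clm_apply h4).sub h5)

theorem locallyLipschitz_field (S : Plant n m) : LocallyLipschitz (d.field S) := by
  have h : ContDiff ℝ 1 (fun z : (Vec n × Vec n × Vec n) × d.State => d.sndL z.2) := by fun_prop
  exact LocallyLipschitz.clm d.stackL (h.locallyLipschitz.prodMk
    ((d.locallyLipschitz_fieldVel S).prodMk d.locallyLipschitz_fieldPar))

end Design

/-! ### Error dynamics and the Lyapunov estimate -/

namespace Design

variable {n m : ℕ} (d : Design n)

/-- The velocity of `z` in the closed loop, where `a` is the reference acceleration. -/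
def zvel (S : Plant n m) (w p r a : Vec n) (x : d.State) : d.State :=
  d.stack (r - d.sndL x)
    ((a - d.fieldVel S ((w, p, r), x)) + d.k₁ • (r - d.sndL x))
    (-d.proj (d.parL x) (d.fieldPar ((w, p, r), x)))

/-- Decay of the Lyapunov function in the region where the gains dominate the remainder. -/
theorem inner_lyap_zvel_le (S : Plant n m) {Θs : d.net.Param} (hΘs : Θs ∈ d.searchSpace)
    (hlayer : 0 < d.layer → d.P Θs ≤ -d.layer) {w p r a : Vec n} {x : d.State} {ωb εb c : ℝ}
    (hΘ : d.parL x ∈ d.searchSpace) (hω : ‖w‖ ≤ ωb)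
    (hε : ‖(a - S.f (d.fstL x, d.sndL x)) - d.net.Psi (kap (d.fstL x) (d.sndL x) p r) Θs‖ ≤ εb)
    (hR : ‖d.net.remainder (kap (d.fstL x) (d.sndL x) p r) Θs (d.parL x)‖
      ≤ c * ‖Θs - d.parL x‖ ^ 2)
    (hgain : 3 * d.thetaBar ^ 2 * c ^ 2 ≤ d.k₂ * (d.kmin - d.lamV)) :
    inner ℝ (mv d.lyapMatrix (d.zvec Θs (d.fstL x) (d.sndL x) p r (d.parL x)))
        (d.zvel S w p r a x)
      ≤ -d.lamV * ‖d.zvec Θs (d.fstL x) (d.sndL x) p r (d.parL x)‖ ^ 2 + d.delta ωb εb := by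
  have hk1 := d.k₁_pos
  have hk2 := d.k₂_pos
  have hk3 := d.k₃_pos
  -- the parameter part, with the projection
  have hpar : inner ℝ (mv d.Γ⁻¹ (Θs - d.parL x))
      (-d.proj (d.parL x) (d.fieldPar ((w, p, r), x))) ≤
      -inner ℝ (mv d.Γ⁻¹ (Θs - d.parL x)) (d.fieldPar ((w, p, r), x)) := by
    -- Comparison with the current state whose estimate is replaced by Θ*: only the parameter block
    -- of the difference survives.
    have h := d.projData.inner_B_pr_sub_nonpos d.layer_nonneg (x := x)
      (y := d.stack (d.fstL x) (d.sndL x) Θs) (d.stack 0 0 (d.fieldPar ((w, p, r), x))) hΘs hlayer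
    have hx : x - d.stack (d.fstL x) (d.sndL x) Θs = d.stack 0 0 (d.parL x - Θs) := by
      conv_lhs => rw [← d.stack_eta x, stack_sub]
      simp
    have hB : d.projData.B (d.stack 0 0 (d.parL x - Θs)) =
        d.stack 0 0 (mv d.Γ⁻¹ (d.parL x - Θs)) := d.mv_blockMatrix _ _ _ _
    rw [projData_pr, stack_sub, hx, hB, inner_stack, ← neg_sub Θs, ← mvL_apply, map_neg,
      inner_neg_left, mvL_apply] at h
    simp only [inner_zero_left, inner_sub_right] at h
    rw [inner_neg_right]
    linarith
  have hΓ : inner ℝ (mv d.Γ⁻¹ (Θs - d.parL x)) (d.fieldPar ((w, p, r), x)) =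
      inner ℝ (d.net.jac (kap (d.fstL x) (d.sndL x) p r) (d.parL x) (Θs - d.parL x))
        (d.filt (d.fstL x) (d.sndL x) p r) - d.k₃ * inner ℝ (Θs - d.parL x) (d.parL x) := by
    have hu := (Matrix.isUnit_iff_isUnit_det _).1 d.Γ_posDef.isUnit
    rw [fieldPar, inner_mv_comm d.Γ_posDef.inv.isHermitian, ← mv_mul,
      Matrix.nonsing_inv_mul _ hu, mv_one, inner_sub_right, inner_smul_right,
      ContinuousLinearMap.adjoint_inner_right]
  -- names for the error components
  set Θ := d.parL x with hΘdef
  set q := d.fstL x with hq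
  set v := d.sndL x with hv
  set T := Θs - Θ with hT
  set κ := kap q v p r with hκ
  set e := p - q with he
  set f := d.filt q v p r with hf
  have hrv : r - v = f - d.k₁ • e := by rw [hf, filt]; abel
  set E := (a - S.f (q, v)) - d.net.Psi κ Θs with hE
  set Rm := d.net.remainder κ Θs Θ with hRm
  -- The mismatch h - Ψ(κ, Θ̂) splits into approximation error, Taylor remainder and Jacobian term.
  -- The Jacobian term is cancelled by the adaptation law and -e by the e-equation.
  have hvel : (a - d.fieldVel S ((w, p, r), x)) + d.k₁ • (r - v) =
      E + Rm + d.net.jac κ Θ T - w - e - d.k₂ • f := by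
    rw [hrv]
    simp only [fieldVel, ← hq, ← hv, ← hΘdef, ← hf, ← hκ, ← he, hE, hRm, ResNet.remainder, ← hT]
    module
  have hz : d.zvec Θs q v p r Θ = d.stack e f T := rfl
  rw [hz, zvel, lyapMatrix_eq, mv_blockMatrix, inner_stack, hvel, hrv, norm_sq_stack]
  simp only [inner_sub_right, inner_add_right, inner_smul_right, real_inner_self_eq_norm_sq]
  have hef := real_inner_comm e f
  have hJf := real_inner_comm (d.net.jac κ Θ T) f
  -- scalar estimates
  have b1 : inner ℝ f E ≤ ‖f‖ * εb :=
    (real_inner_le_norm _ _).trans (mul_le_mul_of_nonneg_left hε (norm_nonneg _))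
  have b2 : inner ℝ f Rm ≤ ‖f‖ * (c * ‖T‖ ^ 2) :=
    (real_inner_le_norm _ _).trans (mul_le_mul_of_nonneg_left hR (norm_nonneg _))
  have b3 : -inner ℝ f w ≤ ‖f‖ * ωb := by
    rw [← inner_neg_right]
    refine (real_inner_le_norm _ _).trans ?_
    rw [norm_neg]
    gcongr
  have hTb : ‖T‖ ≤ 2 * d.thetaBar := by
    have := norm_sub_le Θs Θ
    linarith [d.norm_le_thetaBar hΘs, d.norm_le_thetaBar hΘ]
  -- Substituting Θ̂ = Θ* - Θ̃ makes the leakage k₃Θ̂ produce the damping -k₃‖Θ̃‖²/2 and the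
  -- constant k₃Θ̄²/2 in δ.
  have b4 : inner ℝ T Θ ≤ 1 / 2 * d.thetaBar ^ 2 - 1 / 2 * ‖T‖ ^ 2 := by
    have e1 : Θ = Θs - T := by rw [hT]; abel
    have e2 : inner ℝ T Θ = inner ℝ T Θs - ‖T‖ ^ 2 := by
      conv_lhs => rw [e1]
      rw [inner_sub_right, real_inner_self_eq_norm_sq]
    have e3 : inner ℝ T Θs ≤ ‖T‖ * d.thetaBar :=
      (real_inner_le_norm _ _).trans
        (mul_le_mul_of_nonneg_left (d.norm_le_thetaBar hΘs) (norm_nonneg _))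
    have := sq_nonneg (‖T‖ - d.thetaBar)
    linarith
  have b5 : ‖f‖ * (ωb + εb) ≤ d.k₂ / 3 * ‖f‖ ^ 2 + 3 * (ωb + εb) ^ 2 / (4 * d.k₂) := by
    have h1 : d.k₂ / 3 * ‖f‖ ^ 2 + 3 * (ωb + εb) ^ 2 / (4 * d.k₂) - ‖f‖ * (ωb + εb) =
        (2 * d.k₂ * ‖f‖ - 3 * (ωb + εb)) ^ 2 / (12 * d.k₂) := by
      field_simp
      ring
    have h2 : 0 ≤ (2 * d.k₂ * ‖f‖ - 3 * (ωb + εb)) ^ 2 / (12 * d.k₂) := by positivity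
    linarith
  -- Young's inequality leaves a quartic in Θ̃; ‖Θ̃‖ ≤ 2Θ̄ turns it into a quadratic with
  -- coefficient 3Θ̄²c²/k₂, exactly the form of ρ/k₂. Of the damping k₂‖r‖², one third is spent
  -- here, one third in `b5`, and one third remains.
  have b6 : ‖f‖ * (c * ‖T‖ ^ 2) ≤ d.k₂ / 3 * ‖f‖ ^ 2 + (d.kmin - d.lamV) * ‖T‖ ^ 2 := by
    have h1 : d.k₂ / 3 * ‖f‖ ^ 2 + 3 * (c * ‖T‖ ^ 2) ^ 2 / (4 * d.k₂) - ‖f‖ * (c * ‖T‖ ^ 2) =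
        (2 * d.k₂ * ‖f‖ - 3 * (c * ‖T‖ ^ 2)) ^ 2 / (12 * d.k₂) := by
      field_simp
      ring
    have h2 : 0 ≤ (2 * d.k₂ * ‖f‖ - 3 * (c * ‖T‖ ^ 2)) ^ 2 / (12 * d.k₂) := by positivity
    have h3 : 3 * (c * ‖T‖ ^ 2) ^ 2 / (4 * d.k₂) ≤ (d.kmin - d.lamV) * ‖T‖ ^ 2 := by
      rw [div_le_iff₀ (by positivity)]
      have h4 : ‖T‖ ^ 2 ≤ (2 * d.thetaBar) ^ 2 := by gcongr
      calc 3 * (c * ‖T‖ ^ 2) ^ 2 = 3 * c ^ 2 * ‖T‖ ^ 2 * ‖T‖ ^ 2 := by ring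
        _ ≤ 3 * c ^ 2 * (2 * d.thetaBar) ^ 2 * ‖T‖ ^ 2 := by gcongr
        _ = 4 * (3 * d.thetaBar ^ 2 * c ^ 2) * ‖T‖ ^ 2 := by ring
        _ ≤ 4 * (d.k₂ * (d.kmin - d.lamV)) * ‖T‖ ^ 2 := by gcongr
        _ = _ := by ring
    linarith
  have m1 : d.kmin ≤ d.k₁ := min_le_left _ _
  have m2 : d.kmin ≤ d.k₂ / 3 := (min_le_right _ _).trans (min_le_left _ _)
  have m3 : d.kmin ≤ d.k₃ / 2 := (min_le_right _ _).trans (min_le_right _ _)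
  have hlk : d.lamV ≤ d.kmin := by
    have : 0 ≤ 3 * d.thetaBar ^ 2 * c ^ 2 := by positivity
    exact sub_nonneg.1 (nonneg_of_mul_nonneg_right (this.trans hgain) hk2)
  have g1 := mul_le_mul_of_nonneg_right m1 (sq_nonneg ‖e‖)
  have g2 := mul_le_mul_of_nonneg_right m2 (sq_nonneg ‖f‖)
  have g3 := mul_le_mul_of_nonneg_right m3 (sq_nonneg ‖T‖)
  have g4 := mul_le_mul_of_nonneg_right hlk (sq_nonneg ‖e‖)
  have g5 := mul_le_mul_of_nonneg_right hlk (sq_nonneg ‖f‖)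
  have g6 := mul_le_mul_of_nonneg_left b4 hk3.le
  unfold delta
  linarith

/-- Dynamics of `z`. -/
theorem hasDerivAt_zvec (S : Plant n m) (Θs : d.net.Param) {x : ℝ → d.State}
    {w qd vd : ℝ → Vec n} {a : Vec n} {t : ℝ} (hq : HasDerivAt qd (vd t) t)
    (hv : HasDerivAt vd a t)
    (hx : HasDerivAt x (d.projData.pr d.layer (x t) (d.field S ((w t, qd t, vd t), x t))) t) :
    HasDerivAt (fun t => d.zvec Θs (d.fstL (x t)) (d.sndL (x t)) (qd t) (vd t) (d.parL (x t)))
      (d.zvel S (w t) (qd t) (vd t) a (x t)) t := by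
  rw [field, stackL_apply, projData_pr] at hx
  have h1 : HasDerivAt (fun t => d.fstL (x t)) (d.sndL (x t)) t :=
    d.fstL.hasFDerivAt.comp_hasDerivAt t hx
  have h2 : HasDerivAt (fun t => d.sndL (x t)) (d.fieldVel S ((w t, qd t, vd t), x t)) t :=
    d.sndL.hasFDerivAt.comp_hasDerivAt t hx
  have h3 : HasDerivAt (fun t => d.parL (x t))
      (d.proj (d.parL (x t)) (d.fieldPar ((w t, qd t, vd t), x t))) t :=
    d.parL.hasFDerivAt.comp_hasDerivAt t hx
  have he := hq.sub h1
  have hr := (hv.sub h2).add (he.const_smul d.k₁)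
  have hT := h3.const_sub Θs
  exact d.stackL.hasFDerivAt.comp_hasDerivAt t (he.prodMk (hr.prodMk hT))

theorem lipschitzOnWith_zvec {Θs : d.net.Param} {x : ℝ → d.State} {qd vd : ℝ → Vec n} {a b : ℝ}
    {K₁ K₂ K₃ : NNReal} (hx : LipschitzOnWith K₁ x (Icc a b))
    (hq : LipschitzOnWith K₂ qd (Icc a b)) (hv : LipschitzOnWith K₃ vd (Icc a b)) :
    ∃ K, LipschitzOnWith K (fun t => d.zvec Θs (d.fstL (x t)) (d.sndL (x t)) (qd t) (vd t)
      (d.parL (x t))) (Icc a b) := by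
  have h : ContDiff ℝ 1 (fun y : d.State × Vec n × Vec n =>
      d.zvec Θs (d.fstL y.1) (d.sndL y.1) y.2.1 y.2.2 (d.parL y.1)) := by
    have : (fun y : d.State × Vec n × Vec n =>
      d.zvec Θs (d.fstL y.1) (d.sndL y.1) y.2.1 y.2.2 (d.parL y.1)) = fun y => d.stackL
        (y.2.1 - d.fstL y.1, (y.2.2 - d.sndL y.1) + d.k₁ • (y.2.1 - d.fstL y.1),
          Θs - d.parL y.1) := rfl
    rw [this]
    fun_prop
  exact h.locallyLipschitz.comp_lipschitzOnWith_Icc (x := fun t => (x t, qd t, vd t))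
    (hx.prodMk (hq.prodMk hv))

/-! ### The exponential bound -/

section Bound

variable {ωb εb χ y : ℝ}

theorem exp_rate_mem {s : ℝ} (hs : 0 ≤ s) : 0 < Real.exp (-(2 * d.lamV / d.lamPhi) * s) ∧
    Real.exp (-(2 * d.lamV / d.lamPhi) * s) ≤ 1 := by
  have := d.lamV_pos
  have := d.lamPhi_pos
  refine ⟨Real.exp_pos _, Real.exp_le_one_iff.2 ?_⟩
  have : 0 ≤ 2 * d.lamV / d.lamPhi * s := by positivity
  linarith

/-- Multiplied by √(λ_φ/λ₁), membership in 𝒮 becomes √(λ_φ/λ₁) y ≤ χ - u, with u the ultimate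
radius. The squared bound is then a convex combination of numbers at most (χ - u)² and equal to u²,
both below χ² since 0 < u < χ. -/
theorem expBound_lt (hy0 : 0 ≤ y) (hy : y ≤ -√(d.delta ωb εb / d.lamV) + √(d.lam₁ / d.lamPhi) * χ)
    (hχ : d.ultRadius ωb εb < χ) {s : ℝ} (hs : 0 ≤ s) : d.expBound ωb εb y s < χ := by
  have hl1 := d.lam₁_pos
  have hlp := d.lamPhi_pos
  have hlv := d.lamV_pos
  have hδ := d.delta_pos ωb εb
  have hult := d.ultRadius_pos ωb εb
  obtain ⟨hE0, hE1⟩ := d.exp_rate_mem hs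
  set E := Real.exp (-(2 * d.lamV / d.lamPhi) * s) with hE
  have hultsq : d.ultRadius ωb εb ^ 2 = d.lamPhi * d.delta ωb εb / (d.lam₁ * d.lamV) :=
    Real.sq_sqrt (by positivity)
  have hu : d.ultRadius ωb εb = √(d.lamPhi / d.lam₁) * √(d.delta ωb εb / d.lamV) := by
    rw [← Real.sqrt_mul (by positivity), ultRadius]
    congr 1
    field_simp
  have hmul : √(d.lamPhi / d.lam₁) * √(d.lam₁ / d.lamPhi) = 1 := by
    rw [← Real.sqrt_mul (by positivity), div_mul_div_cancel₀ hl1.ne', div_self hlp.ne',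
      Real.sqrt_one]
  have h1 : √(d.lamPhi / d.lam₁) * y ≤ χ - d.ultRadius ωb εb := by
    have := mul_le_mul_of_nonneg_left hy (Real.sqrt_nonneg (d.lamPhi / d.lam₁))
    rw [mul_add, mul_neg, ← hu, ← mul_assoc, hmul, one_mul] at this
    linarith
  have h2 : d.lamPhi / d.lam₁ * y ^ 2 ≤ (χ - d.ultRadius ωb εb) ^ 2 := by
    have h3 : d.lamPhi / d.lam₁ * y ^ 2 = (√(d.lamPhi / d.lam₁) * y) ^ 2 := by
      rw [mul_pow, Real.sq_sqrt (by positivity)]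
    rw [h3]
    gcongr
  have hχ0 : 0 < χ := hult.trans hχ
  rw [expBound, Real.sqrt_lt' hχ0, ← hE, ← hultsq]
  have h4 : (χ - d.ultRadius ωb εb) ^ 2 < χ ^ 2 := by nlinarith
  have h5 : d.ultRadius ωb εb ^ 2 < χ ^ 2 := by nlinarith
  have h6 : d.lamPhi / d.lam₁ * y ^ 2 * E < χ ^ 2 * E := by
    apply mul_lt_mul_of_pos_right _ hE0
    linarith
  have h7 : d.ultRadius ωb εb ^ 2 * (1 - E) ≤ χ ^ 2 * (1 - E) := by
    apply mul_le_mul_of_nonneg_right h5.le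
    linarith
  linarith

theorem tendsto_expBound (y : ℝ) (t₀ : ℝ) :
    Tendsto (fun t => d.expBound ωb εb y (t - t₀)) atTop (𝓝 (d.ultRadius ωb εb)) := by
  have hlp := d.lamPhi_pos
  have hlv := d.lamV_pos
  have h1 : Tendsto (fun t : ℝ => Real.exp (-(2 * d.lamV / d.lamPhi) * (t - t₀))) atTop (𝓝 0) := by
    refine Real.tendsto_exp_atBot.comp ?_
    refine (tendsto_atTop_add_const_right _ (-t₀) tendsto_id).const_mul_atTop_of_neg ?_
    rw [neg_lt_zero]
    positivity
  have h2 := (((h1.const_mul (d.lamPhi / d.lam₁ * y ^ 2)).add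
    ((h1.const_sub 1).const_mul (d.lamPhi * d.delta ωb εb / (d.lam₁ * d.lamV)))).sqrt)
  simp only [mul_zero, zero_add, sub_zero, mul_one] at h2
  exact h2

end Bound

/-- The trajectories that start in `𝒮` satisfy the exponential bound and stay in `𝒟`, as long as
they solve the closed loop in `𝒟`. -/
theorem norm_zvec_le_expBound (S : Plant n m) {Θs : d.net.Param} (hΘs : Θs ∈ d.searchSpace)
    (hlayer : 0 < d.layer → d.P Θs ≤ -d.layer) {w qd vd : ℝ → Vec n}
    {fd : Vec n × Vec n → Vec n} {ρ₀ : ℝ → ℝ} (hρ : d.IsRemainderBound Θs ρ₀) {qb vb ωb εb : ℝ}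
    (hε : ∀ q v p w : Vec n, kap q v p w ∈ d.domOmega ρ₀ qb vb →
        ‖(fd (p, w) - S.f (q, v)) - d.net.Psi (kap q v p w) Θs‖ ≤ εb)
    (hgain : d.kmin > d.lamV + 1 / d.k₂ * d.rho ρ₀ qb vb (d.ultRadius ωb εb))
    {a b : ℝ} (hω : ∀ t ∈ Icc a b, ‖w t‖ ≤ ωb) (hqb : ∀ t ∈ Icc a b, ‖qd t‖ ≤ qb)
    (hvb : ∀ t ∈ Icc a b, ‖vd t‖ ≤ vb) {K₁ K₂ K₃ : NNReal} {x : ℝ → d.State}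
    (hxL : LipschitzOnWith K₁ x (Icc a b))
    (hqL : LipschitzOnWith K₂ qd (Icc a b)) (hvL : LipschitzOnWith K₃ vd (Icc a b))
    (hqd : ∀ t ∈ Ioo a b, HasDerivAt qd (vd t) t)
    (hvd : ∀ t ∈ Ioo a b, HasDerivAt vd (fd (qd t, vd t)) t)
    (hxP : ∀ t ∈ Icc a b, d.parL (x t) ∈ d.searchSpace)
    (hxd : ∀ᵐ t, t ∈ Ioo a b →
      d.zvec Θs (d.fstL (x t)) (d.sndL (x t)) (qd t) (vd t) (d.parL (x t)) ∈ d.domD ρ₀ qb vb →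
      HasDerivAt x (d.projData.pr d.layer (x t) (d.field S ((w t, qd t, vd t), x t))) t)
    (h0 : d.zvec Θs (d.fstL (x a)) (d.sndL (x a)) (qd a) (vd a) (d.parL (x a))
      ∈ d.domS ρ₀ qb vb ωb εb) :
    ∀ t ∈ Icc a b, ‖d.zvec Θs (d.fstL (x t)) (d.sndL (x t)) (qd t) (vd t) (d.parL (x t))‖ ≤
        d.expBound ωb εb
          ‖d.zvec Θs (d.fstL (x a)) (d.sndL (x a)) (qd a) (vd a) (d.parL (x a))‖ (t - a) ∧
      d.zvec Θs (d.fstL (x t)) (d.sndL (x t)) (qd t) (vd t) (d.parL (x t))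
        ∈ d.domD ρ₀ qb vb := by
  rcases lt_or_ge b a with hba | hab
  · intro t ht
    exact absurd (ht.1.trans ht.2) (not_le.2 hba)
  have hqb0 : 0 ≤ qb := (norm_nonneg _).trans (hqb a ⟨le_rfl, hab⟩)
  have hvb0 : 0 ≤ vb := (norm_nonneg _).trans (hvb a ⟨le_rfl, hab⟩)
  have hl1 := d.lam₁_pos
  have hlp := d.lamPhi_pos
  have hlv := d.lamV_pos
  have hk1 := d.k₁_pos
  obtain ⟨hχ, hχeq⟩ := hρ.radius_spec hqb0 hvb0 (d.ultRadius_pos ωb εb).le hgain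
  set χ := d.radius ρ₀ qb vb with hχdef
  have hχ0 : 0 < χ := (d.ultRadius_pos ωb εb).trans hχ
  obtain ⟨K, hK⟩ := d.lipschitzOnWith_zvec (Θs := Θs) hxL hqL hvL
  set z : ℝ → d.State := fun t =>
    d.zvec Θs (d.fstL (x t)) (d.sndL (x t)) (qd t) (vd t) (d.parL (x t)) with hz
  -- the bound holds as long as the trajectory is in the domain
  have hbound : ∀ c ∈ Icc a b, (∀ t ∈ Ioo a c, ‖z t‖ ≤ χ) →
      ‖z c‖ ≤ d.expBound ωb εb ‖z a‖ (c - a) := by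
    intro c hc hD
    obtain ⟨K', hK'⟩ := d.projData.locallyLipschitz_quadratic.comp_lipschitzOnWith_Icc
      (hK.mono (Icc_subset_Icc_right hc.2))
    have hac : AbsolutelyContinuousOnInterval
        (fun t => inner ℝ (z t) (d.projData.B (z t))) a c :=
      (uIcc_of_le hc.1 ▸ hK').absolutelyContinuousOnInterval
    have hα : 0 < 2 * d.lamV / d.lamPhi := by positivity
    -- Grönwall is applied to zᵀBz, twice the Lyapunov function; zᵀBz ≤ λ_φ‖z‖² turns the decay in
    -- ‖z‖² into the rate 2λ_V/λ_φ.
    have key := hac.le_gronwall (α := 2 * d.lamV / d.lamPhi) (β := 2 * d.delta ωb εb) hc.1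
      hα.ne' (by
        filter_upwards [hxd] with t htd ht
        have ht' : t ∈ Ioo a b := ⟨ht.1, ht.2.trans_le hc.2⟩
        have ht'' := Ioo_subset_Icc_self ht'
        have hzt := hD t ht
        have hzd := d.hasDerivAt_zvec S Θs (w := w) (hqd t ht') (hvd t ht') (htd ht' hzt)
        refine ⟨_, d.projData.hasDerivAt_quadratic hzd, ?_⟩
        have hkap := d.norm_kap_le_zvec (Θs := Θs) (Θ := d.parL (x t)) (q := d.fstL (x t))
          (v := d.sndL (x t)) (hqb t ht'') (hvb t ht'')
        have hkap' : ‖kap (d.fstL (x t)) (d.sndL (x t)) (qd t) (vd t)‖ ≤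
            (d.k₁ + 2) * χ + 2 * (qb + vb) :=
          hkap.trans (by gcongr)
        have hκ0 := norm_nonneg (kap (d.fstL (x t)) (d.sndL (x t)) (qd t) (vd t))
        have hρκ := hρ.nonneg _ hκ0
        have hle := d.inner_lyap_zvel_le S hΘs hlayer (x := x t) (p := qd t) (r := vd t)
          (a := fd (qd t, vd t)) (hxP t ht'') (hω t ht'')
          (hε _ _ _ _ (by
            show ‖_‖ ≤ _
            linarith)) (hρ.bound _ _ (hxP t ht'')) (by
            rw [← hχeq, rho]
            have := hρ.mono.monotoneOn (mem_Ici.2 hκ0) (mem_Ici.2 (hκ0.trans hkap')) hkap'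
            gcongr)
        have hq : inner ℝ (z t) (d.projData.B (z t)) ≤ d.lamPhi * ‖z t‖ ^ 2 :=
          inner_mv_le_sSup_spectrum d.lyapMatrix_posDef.isHermitian (z t)
        have h1 : 2 * d.lamV / d.lamPhi * inner ℝ (z t) (d.projData.B (z t)) ≤
            2 * d.lamV * ‖z t‖ ^ 2 := by
          rw [div_mul_eq_mul_div, div_le_iff₀ hlp]
          have := mul_le_mul_of_nonneg_left hq (show 0 ≤ 2 * d.lamV by positivity)
          linarith
        have h2 : inner ℝ (d.projData.B (z t)) (d.zvel S (w t) (qd t) (vd t)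
            (fd (qd t, vd t)) (x t)) ≤ -d.lamV * ‖z t‖ ^ 2 + d.delta ωb εb := hle
        linarith)
    have hlow : d.lam₁ * ‖z c‖ ^ 2 ≤ inner ℝ (z c) (d.projData.B (z c)) :=
      d.projData.B_coercive (z c)
    have hup : inner ℝ (z a) (d.projData.B (z a)) ≤ d.lamPhi * ‖z a‖ ^ 2 :=
      inner_mv_le_sSup_spectrum d.lyapMatrix_posDef.isHermitian (z a)
    apply Real.le_sqrt_of_sq_le
    obtain ⟨hE0, -⟩ := d.exp_rate_mem (sub_nonneg.2 hc.1)
    set E := Real.exp (-(2 * d.lamV / d.lamPhi) * (c - a)) with hE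
    have h3 := hlow.trans (key.trans (add_le_add
      (mul_le_mul_of_nonneg_right hup hE0.le) le_rfl))
    have h4 : d.lam₁ * (d.lamPhi / d.lam₁ * ‖z a‖ ^ 2 * E
        + d.lamPhi * d.delta ωb εb / (d.lam₁ * d.lamV) * (1 - E)) =
        d.lamPhi * ‖z a‖ ^ 2 * E + 2 * d.delta ωb εb / (2 * d.lamV / d.lamPhi) * (1 - E) := by
      field_simp
    rw [← h4] at h3
    exact le_of_mul_le_mul_left h3 hl1
  have hsmall : ∀ c ∈ Icc a b, d.expBound ωb εb ‖z a‖ (c - a) < χ := fun c hc =>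
    d.expBound_lt (norm_nonneg _) h0 hχ (sub_nonneg.2 hc.1)
  have hzc : ContinuousOn (fun t => ‖z t‖) (Icc a b) := hK.continuousOn.norm
  have hdom : ∀ t ∈ Icc a b, ‖z t‖ < χ := by
    by_contra hcon
    push Not at hcon
    obtain ⟨t₁, ht₁, hle⟩ := hcon
    have hAc : IsCompact (Icc a b ∩ (fun t => ‖z t‖) ⁻¹' Ici χ) :=
      isCompact_Icc.of_isClosed_subset (hzc.preimage_isClosed_of_isClosed isClosed_Icc isClosed_Ici)
        inter_subset_left
    have hAne : (Icc a b ∩ (fun t => ‖z t‖) ⁻¹' Ici χ).Nonempty := ⟨t₁, ht₁, hle⟩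
    -- The first time with ‖z‖ ≥ χ. Before it the trajectory is inside 𝒟, so the bound holds at `c`
    -- as well and gives ‖z(c)‖ < χ.
    obtain ⟨c, hc, hmin⟩ := hAc.exists_isLeast hAne
    have := hbound c hc.1 (fun t ht => by
      by_contra hgt
      push Not at hgt
      have := hmin ⟨⟨ht.1.le, ht.2.le.trans hc.1.2⟩, hgt.le⟩
      exact absurd ht.2 (not_lt.2 this))
    have h2 : χ ≤ ‖z c‖ := hc.2
    linarith [hsmall c hc.1]
  intro t ht
  exact ⟨hbound t ht fun r hr => (hdom r ⟨hr.1.le, hr.2.le.trans ht.2⟩).le, (hdom t ht).le⟩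

end Design

/-! ### Carathéodory solutions and integral equations -/

namespace CaratheodorySol

variable {H : Type*} [NormedAddCommGroup H] [NormedSpace ℝ H] {Φ : ℝ → H → H} {a b : ℝ}
  {x y : ℝ → H}

theorem congr (h : CaratheodorySol Φ a b x) (hxy : EqOn y x (Icc a b)) :
    CaratheodorySol Φ a b y := by
  obtain ⟨⟨K, hK⟩, hd⟩ := h
  refine ⟨⟨K, fun t ht r hr => by rw [hxy ht, hxy hr]; exact hK ht hr⟩, ?_⟩
  filter_upwards [hd] with t htd ht
  have heq : y =ᶠ[𝓝 t] x := by
    filter_upwards [Icc_mem_nhds ht.1 ht.2] with s hs using hxy hs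
  rw [hxy (Ioo_subset_Icc_self ht)]
  exact (htd ht).congr_of_eventuallyEq heq

theorem ae_norm_le {K : NNReal} (hK : LipschitzOnWith K x (Icc a b))
    (hd : ∀ᵐ t, t ∈ Ioo a b → HasDerivAt x (Φ t (x t)) t) :
    ∀ᵐ t, t ∈ Ioo a b → ‖Φ t (x t)‖ ≤ K := by
  filter_upwards [hd] with t htd ht
  exact (htd ht).le_of_lipschitzOn (Icc_mem_nhds ht.1 ht.2) hK

theorem ae_mem_Ioo_of_mem_Icc (a b : ℝ) : ∀ᵐ t : ℝ, t ∈ Icc a b → t ∈ Ioo a b := by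
  have ha : ∀ᵐ t : ℝ, t ≠ a := by simp [ae_iff, measure_singleton]
  have hb : ∀ᵐ t : ℝ, t ≠ b := by simp [ae_iff, measure_singleton]
  filter_upwards [ha, hb] with t hta htb ht
  exact ⟨lt_of_le_of_ne ht.1 (Ne.symm hta), lt_of_le_of_ne ht.2 htb⟩

variable [FiniteDimensional ℝ H]

/-- No measurability of Φ is assumed: along the solution it agrees almost everywhere with `deriv x`,
which is measurable, and the Lipschitz constant bounds it. -/
theorem intervalIntegrable (h : CaratheodorySol Φ a b x) (hab : a ≤ b) :
    IntervalIntegrable (fun t => Φ t (x t)) volume a b := by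
  obtain ⟨⟨K, hK⟩, hd⟩ := h
  have : CompleteSpace H := FiniteDimensional.complete ℝ H
  borelize H
  have : SecondCountableTopology H := by
    have := FiniteDimensional.proper ℝ H
    infer_instance
  rw [intervalIntegrable_iff_integrableOn_Ioc_of_le hab]
  refine Integrable.mono' (g := fun _ => (K : ℝ)) (by simp) ?_ ?_
  · refine (measurable_deriv x).aestronglyMeasurable.congr ?_
    rw [EventuallyEq, ae_restrict_iff' measurableSet_Ioc]
    filter_upwards [hd, ae_mem_Ioo_of_mem_Icc a b] with t htd hmem ht
    exact (htd (hmem (Ioc_subset_Icc_self ht))).deriv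
  · rw [ae_restrict_iff' measurableSet_Ioc]
    filter_upwards [ae_norm_le hK hd, ae_mem_Ioo_of_mem_Icc a b] with t htd hmem ht
    exact htd (hmem (Ioc_subset_Icc_self ht))

/-- The difference between the solution and the integral of its velocity is Lipschitz with
derivative zero almost everywhere, hence constant. -/
theorem eq_add_integral (h : CaratheodorySol Φ a b x) (hab : a ≤ b) :
    x b = x a + ∫ t in a..b, Φ t (x t) := by
  have hint := h.intervalIntegrable hab
  have : CompleteSpace H := FiniteDimensional.complete ℝ H
  obtain ⟨⟨K, hK⟩, hd⟩ := h
  have hsub : ∀ s ∈ Icc a b, ∀ t ∈ Icc a b, uIcc s t ⊆ uIcc a b := fun s hs t ht => by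
    rw [uIcc_of_le hab]
    exact (convex_Icc a b).ordConnected.uIcc_subset hs ht
  have hI : LipschitzOnWith K (fun t => ∫ s in a..t, Φ s (x s)) (Icc a b) := by
    refine LipschitzOnWith.of_dist_le_mul fun t ht s hs => ?_
    have haa : a ∈ Icc a b := ⟨le_rfl, hab⟩
    rw [dist_eq_norm, intervalIntegral.integral_interval_sub_left
      (hint.mono_set (hsub a haa t ht)) (hint.mono_set (hsub a haa s hs)), Real.dist_eq]
    refine intervalIntegral.norm_integral_le_of_norm_le_const_ae ?_
    filter_upwards [ae_norm_le hK hd, ae_mem_Ioo_of_mem_Icc a b] with r hr hmem hr'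
    have := hsub s hs t ht (uIoc_subset_uIcc hr')
    rw [uIcc_of_le hab] at this
    exact hr (hmem this)
  have hG := hK.sub hI
  have hac : AbsolutelyContinuousOnInterval (fun t => x t - ∫ s in a..t, Φ s (x s)) a b :=
    (uIcc_of_le hab ▸ hG).absolutelyContinuousOnInterval
  obtain ⟨C, hC⟩ := hac.const_of_ae_hasDerivAt_zero (by
    filter_upwards [hd, ae_mem_Ioo_of_mem_Icc a b, hint.ae_hasDerivAt_integral]
      with t htd hmem hti ht
    have h1 := htd (hmem (uIcc_of_le hab ▸ ht))
    have h2 := h1.sub (hti ht a left_mem_uIcc)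
    rw [sub_self] at h2
    exact h2)
  have h1 := hC a left_mem_uIcc
  have h2 := hC b right_mem_uIcc
  simp only [intervalIntegral.integral_same, sub_zero] at h1
  rw [← h1] at h2
  exact sub_eq_iff_eq_add.1 h2

end CaratheodorySol

theorem hasDerivWithinAt_of_eq_add_integral {E : Type*} [NormedAddCommGroup E] [NormedSpace ℝ E]
    [CompleteSpace E] {y g : ℝ → E} {a : ℝ} (hg : ContinuousOn g (Ici a))
    (hy : ∀ t, a ≤ t → y t = y a + ∫ s in a..t, g s) {t : ℝ} (ht : a ≤ t) :
    HasDerivWithinAt y (g t) (Ici a) t := by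
  -- Constant extension to the left of `a` makes the integrand continuous on ℝ, so the fundamental
  -- theorem also covers the endpoint.
  have hg' : Continuous (fun s => g (max s a)) :=
    hg.comp_continuous (by fun_prop) fun s => mem_Ici.2 (le_max_right _ _)
  have h1 : HasDerivAt (fun t => y a + ∫ s in a..t, g (max s a)) (g (max t a)) t :=
    (hg'.integral_hasStrictDerivAt a t).hasDerivAt.const_add _
  rw [max_eq_left ht] at h1
  have heq : ∀ r ∈ Ici a, y r = y a + ∫ s in a..r, g (max s a) := by
    intro r hr
    rw [hy r hr]
    congr 1
    refine intervalIntegral.integral_congr fun s hs => ?_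
    rw [uIcc_of_le hr] at hs
    simp only [max_eq_left hs.1]
  exact h1.hasDerivWithinAt.congr heq (heq t ht)

namespace ProjData

/-- Solutions on all bounded intervals fit together. -/
theorem exists_forall_caratheodorySol {H : Type*} [NormedAddCommGroup H] [InnerProductSpace ℝ H]
    [CompleteSpace H] (p : ProjData H) {S : Type*} [NormedAddCommGroup S] {F : S × H → H}
    (hF : LocallyLipschitz F) {s : ℝ → S} {a : ℝ} (hs : ContinuousOn s (Ici a)) {ε : ℝ}
    (hε : 0 ≤ ε) (hε' : ε < -p.P 0) {x₀ : H} (hx₀ : p.P x₀ ≤ 0)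
    (h : ∀ b, a ≤ b → ∃ x, x a = x₀ ∧ CaratheodorySol (fun t z => p.pr ε z (F (s t, z))) a b x) :
    ∃ x, x a = x₀ ∧ ∀ b, CaratheodorySol (fun t z => p.pr ε z (F (s t, z))) a b x := by
  -- The value at t is read from the solution on [a, a + ⌈t - a⌉]; by uniqueness every longer
  -- solution gives the same value.
  choose X hX0 hX using fun N : ℕ => h (a + N) (by simp)
  have heq : ∀ N : ℕ, EqOn (fun t => X ⌈t - a⌉₊ t) (X N) (Icc a (a + N)) := by
    intro N t ht
    have hle : ⌈t - a⌉₊ ≤ N := Nat.ceil_le.2 (by linarith [ht.2])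
    have hle' : ((⌈t - a⌉₊ : ℕ) : ℝ) ≤ N := by exact_mod_cast hle
    refine p.eqOn_of_caratheodorySol (b := a + (⌈t - a⌉₊ : ℕ)) hF
      (hs.mono Icc_subset_Ici_self) hε hε' (hX _) ((hX N).mono (by linarith))
      ((hX0 _).trans (hX0 N).symm) ((hX0 _).symm ▸ hx₀) t ⟨ht.1, ?_⟩
    linarith [Nat.le_ceil (t - a)]
  refine ⟨fun t => X ⌈t - a⌉₊ t, hX0 _, fun b => ?_⟩
  obtain ⟨N, hN⟩ := exists_nat_ge (b - a)
  exact ((hX N).congr (heq N)).mono (by linarith)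

end ProjData

/-! ### The closed loop as a Carathéodory equation -/

namespace Design

variable {n m : ℕ} (d : Design n)

/-- The right-hand side of the closed loop in the stacked state. -/
def rhs (S : Plant n m) (qd vd : ℝ → Vec n) (t : ℝ) (x : d.State) : d.State :=
  d.projData.pr d.layer x (d.field S ((S.dist t, qd t, vd t), x))

theorem rhs_eq (S : Plant n m) (qd vd : ℝ → Vec n) {t : ℝ} (ht : 0 ≤ t) (x : d.State) :
    d.rhs S qd vd t x = d.stack (d.sndL x)
      (S.f (d.fstL x, d.sndL x) + mv (S.g (d.fstL x, d.sndL x, t))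
        (d.control S t (d.fstL x) (d.sndL x) (qd t) (vd t) (d.parL x)) + S.dist t)
      (d.update (d.fstL x) (d.sndL x) (qd t) (vd t) (d.parL x)) := by
  rw [rhs, field, stackL_apply, projData_pr, control, S.mv_g_gPlus ht]
  rfl

/-- Integrated equations for the blocks give a Carathéodory solution. -/
theorem caratheodorySol_stack {Φ : ℝ → d.State → d.State} {t₀ t₁ L : ℝ} (h01 : t₀ ≤ t₁)
    {q v a : ℝ → Vec n} {Θ τ : ℝ → d.net.Param}
    (hq : ∀ t ∈ Icc t₀ t₁, HasDerivWithinAt q (v t) (Icc t₀ t₁) t)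
    (hv : ∀ t ∈ Icc t₀ t₁, HasDerivWithinAt v (a t) (Icc t₀ t₁) t)
    (hτ : ∀ t ∈ Icc t₀ t₁, IntervalIntegrable τ volume t₀ t)
    (hΘ : ∀ t ∈ Icc t₀ t₁, Θ t = Θ t₀ + ∫ s in t₀..t, τ s)
    (hΦ : ∀ t ∈ Icc t₀ t₁, Φ t (d.stack (q t) (v t) (Θ t)) = d.stack (v t) (a t) (τ t))
    (hL : ∀ t ∈ Icc t₀ t₁, ‖Φ t (d.stack (q t) (v t) (Θ t))‖ ≤ L) :
    CaratheodorySol Φ t₀ t₁ (fun t => d.stack (q t) (v t) (Θ t)) := by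
  have hL0 : 0 ≤ L := (norm_nonneg _).trans (hL t₀ ⟨le_rfl, h01⟩)
  have hbd : ∀ t ∈ Icc t₀ t₁, ‖v t‖ ≤ L ∧ ‖a t‖ ≤ L ∧ ‖τ t‖ ≤ L := by
    intro t ht
    have h1 := hL t ht
    rw [hΦ t ht] at h1
    obtain ⟨e1, e2, e3⟩ := d.norm_le_norm_stack (v t) (a t) (τ t)
    exact ⟨e1.trans h1, e2.trans h1, e3.trans h1⟩
  have hqL : LipschitzOnWith L.toNNReal q (Icc t₀ t₁) :=
    (convex_Icc _ _).lipschitzOnWith_of_nnnorm_hasDerivWithin_le hq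
      fun t ht => by
        rw [← NNReal.coe_le_coe, coe_nnnorm, Real.coe_toNNReal _ hL0]
        exact (hbd t ht).1
  have hvL : LipschitzOnWith L.toNNReal v (Icc t₀ t₁) :=
    (convex_Icc _ _).lipschitzOnWith_of_nnnorm_hasDerivWithin_le hv
      fun t ht => by
        rw [← NNReal.coe_le_coe, coe_nnnorm, Real.coe_toNNReal _ hL0]
        exact (hbd t ht).2.1
  have hΘL : LipschitzOnWith L.toNNReal Θ (Icc t₀ t₁) := by
    refine LipschitzOnWith.of_dist_le_mul fun t ht r hr => ?_
    rw [dist_eq_norm, hΘ t ht, hΘ r hr, add_sub_add_left_eq_sub,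
      intervalIntegral.integral_interval_sub_left (hτ t ht) (hτ r hr), Real.dist_eq,
      Real.coe_toNNReal _ hL0]
    refine intervalIntegral.norm_integral_le_of_norm_le_const fun u hu => ?_
    exact (hbd u ((convex_Icc t₀ t₁).ordConnected.uIcc_subset hr ht (uIoc_subset_uIcc hu))).2.2
  have hxL : ∃ K, LipschitzOnWith K (fun t => d.stackL (q t, v t, Θ t)) (Icc t₀ t₁) :=
    ⟨_, d.stackL.lipschitz.comp_lipschitzOnWith (hqL.prodMk (hvL.prodMk hΘL))⟩
  refine ⟨hxL, ?_⟩
  filter_upwards [(hτ t₁ ⟨h01, le_rfl⟩).ae_hasDerivAt_integral] with t hti ht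
  have ht' := Ioo_subset_Icc_self ht
  have hnh := Icc_mem_nhds ht.1 ht.2
  have e3 : HasDerivAt Θ (τ t) t := by
    refine ((hti (uIcc_of_le h01 ▸ ht') t₀ left_mem_uIcc).const_add (Θ t₀)).congr_of_eventuallyEq ?_
    filter_upwards [hnh] with r hr using hΘ r hr
  rw [hΦ t ht']
  have e1 := (hq t ht').hasDerivAt hnh
  have e2 := (hv t ht').hasDerivAt hnh
  exact d.stackL.hasFDerivAt.comp_hasDerivAt t (e1.prodMk (e2.prodMk e3))

variable {d}

/-- The unprojected field is continuous along the solution, hence bounded on a compact interval, and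
the projection enlarges norms by at most a fixed factor. The bounded velocity supplies the Lipschitz
property that uniqueness requires. -/
theorem IsSolution.caratheodorySol {S : Plant n m} {qd vd : ℝ → Vec n} {t₀ t₁ : ℝ} {J : Set ℝ}
    {q v : ℝ → Vec n} {Θ : ℝ → d.net.Param} (h : d.IsSolution S qd vd t₀ J q v Θ)
    (h01 : t₀ ≤ t₁) (hJ : Icc t₀ t₁ ⊆ J) (ht₀ : 0 ≤ t₀)
    (hs : ContinuousOn (fun t => (S.dist t, qd t, vd t)) (Icc t₀ t₁)) :
    CaratheodorySol (d.rhs S qd vd) t₀ t₁ (fun t => d.stack (q t) (v t) (Θ t)) := by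
  have hqc : ContinuousOn q (Icc t₀ t₁) := fun t ht => (h.pos t (hJ ht)).continuousWithinAt.mono hJ
  have hvc : ContinuousOn v (Icc t₀ t₁) := fun t ht => (h.vel t (hJ ht)).continuousWithinAt.mono hJ
  have hΘc : ContinuousOn Θ (Icc t₀ t₁) := h.cont.mono hJ
  have hxc : ContinuousOn (fun t => d.stack (q t) (v t) (Θ t)) (Icc t₀ t₁) :=
    d.stackL.continuous.comp_continuousOn (hqc.prodMk (hvc.prodMk hΘc))
  have hτc : ContinuousOn (fun t => d.field S ((S.dist t, qd t, vd t),
      d.stack (q t) (v t) (Θ t))) (Icc t₀ t₁) :=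
    (d.locallyLipschitz_field S).continuous.comp_continuousOn (hs.prodMk hxc)
  obtain ⟨M, hM⟩ := isCompact_Icc.exists_bound_of_continuousOn hτc
  have hα := d.projData.α_pos
  refine d.caratheodorySol_stack (L := (1 + ‖d.projData.A‖ / d.projData.α) * M) h01
    (fun t ht => (h.pos t (hJ ht)).mono hJ) (fun t ht => (h.vel t (hJ ht)).mono hJ)
    (fun t ht => h.integrable t (hJ ht)) (fun t ht => h.adapt t (hJ ht)) (fun t ht => ?_)
    (fun t ht => ?_)
  · rw [d.rhs_eq S qd vd (ht₀.trans ht.1)]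
    simp only [fstL_stack, sndL_stack, parL_stack]
  · exact (d.projData.norm_pr_le d.layer_nonneg _ _).trans
      (mul_le_mul_of_nonneg_left (hM t ht) (by positivity))

/-- Position and velocity have continuous right-hand sides, so their integral equations can be
differentiated at every time. The parameter equation stays in integrated form. -/
theorem isSolution_of_caratheodorySol {S : Plant n m} {qd vd : ℝ → Vec n} {t₀ : ℝ} (ht₀ : 0 ≤ t₀)
    (hs : ContinuousOn (fun t => (S.dist t, qd t, vd t)) (Ici t₀)) {x : ℝ → d.State}
    (hx : ∀ b, CaratheodorySol (d.rhs S qd vd) t₀ b x) :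
    d.IsSolution S qd vd t₀ (Ici t₀) (fun t => d.fstL (x t)) (fun t => d.sndL (x t))
      (fun t => d.parL (x t)) := by
  have hxc : ContinuousOn x (Ici t₀) := by
    intro t ht
    obtain ⟨K, hK⟩ := (hx (t + 1)).lip
    refine (hK.continuousOn t ⟨ht, by linarith⟩).mono_of_mem_nhdsWithin ?_
    rw [← Ici_inter_Iic]
    exact inter_mem self_mem_nhdsWithin (mem_nhdsWithin_of_mem_nhds (Iic_mem_nhds (by linarith)))
  have hint : ∀ t, t₀ ≤ t → x t = x t₀ + ∫ s in t₀..t, d.rhs S qd vd s (x s) := fun t ht =>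
    (hx t).eq_add_integral ht
  have hii : ∀ t, t₀ ≤ t → IntervalIntegrable (fun s => d.rhs S qd vd s (x s)) volume t₀ t :=
    fun t ht => (hx t).intervalIntegrable ht
  have hcomp : ∀ {E : Type} [NormedAddCommGroup E] [NormedSpace ℝ E] [CompleteSpace E]
      (Lc : d.State →L[ℝ] E) (t : ℝ), t₀ ≤ t → Lc (x t) = Lc (x t₀) +
        ∫ s in t₀..t, Lc (d.rhs S qd vd s (x s)) := by
    intro E _ _ _ Lc t ht
    rw [Lc.intervalIntegral_comp_comm (hii t ht), ← map_add, ← hint t ht]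
  have hvelc : ContinuousOn (fun t => d.fieldVel S ((S.dist t, qd t, vd t), x t)) (Ici t₀) :=
    (d.locallyLipschitz_fieldVel S).continuous.comp_continuousOn (hs.prodMk hxc)
  have hrhs : ∀ s, d.rhs S qd vd s (x s) = d.stack (d.sndL (x s))
      (d.fieldVel S ((S.dist s, qd s, vd s), x s))
      (d.update (d.fstL (x s)) (d.sndL (x s)) (qd s) (vd s) (d.parL (x s))) := fun s => by
    rw [rhs, field, stackL_apply, projData_pr]
    rfl
  refine ⟨fun t ht => ?_, fun t ht => ?_, d.parL.continuous.comp_continuousOn hxc,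
    fun t ht => ?_, fun t ht => ?_⟩
  · refine hasDerivWithinAt_of_eq_add_integral (y := fun t => d.fstL (x t))
      (g := fun t => d.sndL (x t)) (d.sndL.continuous.comp_continuousOn hxc) (fun r hr => ?_) ht
    have := hcomp d.fstL r hr
    simpa only [hrhs, fstL_stack] using this
  · have h1 := hasDerivWithinAt_of_eq_add_integral (y := fun t => d.sndL (x t)) hvelc
      (fun r hr => by
        have := hcomp d.sndL r hr
        simpa only [hrhs, sndL_stack] using this) ht
    rw [control, S.mv_g_gPlus (ht₀.trans ht)]
    exact h1
  · have h1 : (fun s => d.parL (d.rhs S qd vd s (x s))) = fun s =>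
        d.update (d.fstL (x s)) (d.sndL (x s)) (qd s) (vd s) (d.parL (x s)) := by
      ext1 s
      rw [hrhs, parL_stack]
    rw [← h1]
    have h2 := hii t ht
    rw [intervalIntegrable_iff_integrableOn_Ioc_of_le ht] at h2 ⊢
    exact d.parL.integrable_comp h2
  · have := hcomp d.parL t ht
    simpa only [hrhs, parL_stack] using this

end Design

/-! ### The reference trajectory -/

namespace IsReference

variable {n : ℕ} {fd : Vec n × Vec n → Vec n} {qd vd : ℝ → Vec n}

theorem hasDerivAt (h : IsReference fd qd vd) {t : ℝ} (ht : 0 < t) :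
    HasDerivAt qd (vd t) t ∧ HasDerivAt vd (fd (qd t, vd t)) t :=
  ⟨(h t ht.le).1.hasDerivAt (Ici_mem_nhds ht), (h t ht.le).2.hasDerivAt (Ici_mem_nhds ht)⟩

theorem continuousOn (h : IsReference fd qd vd) :
    ContinuousOn qd (Ici 0) ∧ ContinuousOn vd (Ici 0) :=
  ⟨fun t ht => (h t ht).1.continuousWithinAt, fun t ht => (h t ht).2.continuousWithinAt⟩

theorem lipschitzOnWith (h : IsReference fd qd vd) {C₁ C₂ : ℝ}
    (h₁ : ∀ t, 0 ≤ t → ‖vd t‖ ≤ C₁) (h₂ : ∀ t, 0 ≤ t → ‖fd (qd t, vd t)‖ ≤ C₂) :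
    LipschitzOnWith C₁.toNNReal qd (Ici 0) ∧ LipschitzOnWith C₂.toNNReal vd (Ici 0) := by
  refine ⟨(convex_Ici 0).lipschitzOnWith_of_nnnorm_hasDerivWithin_le (fun t ht => (h t ht).1)
    fun t ht => ?_, (convex_Ici 0).lipschitzOnWith_of_nnnorm_hasDerivWithin_le
      (fun t ht => (h t ht).2) fun t ht => ?_⟩ <;>
    rw [← NNReal.coe_le_coe, coe_nnnorm]
  · exact (h₁ t ht).trans (Real.le_coe_toNNReal _)
  · exact (h₂ t ht).trans (Real.le_coe_toNNReal _)

end IsReference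

theorem norm_mv_le {ι κ : Type*} [Fintype ι] [Fintype κ] {A : Matrix ι κ ℝ} {M : ℝ}
    (hA : ∀ i j, |A i j| ≤ M) (x : EuclideanSpace ℝ κ) :
    ‖mv A x‖ ≤ Fintype.card ι * (Fintype.card κ * (M * ‖x‖)) := by
  refine (EuclideanSpace.norm_le_sum _).trans ?_
  have h : ∀ i : ι, |mv A x i| ≤ Fintype.card κ * (M * ‖x‖) := by
    intro i
    refine (Finset.abs_sum_le_sum_abs _ _).trans ?_
    refine (Finset.sum_le_card_nsmul _ _ (M * ‖x‖) fun j _ => ?_).trans ?_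
    · rw [abs_mul]
      exact mul_le_mul (hA i j) (EuclideanSpace.abs_apply_le_norm x j) (abs_nonneg _)
        ((abs_nonneg _).trans (hA i j))
    · rw [nsmul_eq_mul, Finset.card_univ]
  refine (Finset.sum_le_card_nsmul _ _ _ fun i _ => h i).trans ?_
  rw [nsmul_eq_mul, Finset.card_univ]

/-- Outside the ball, the radial rescaling of `z` to norm `r` is the comparison point. -/
theorem infDist_closedBall_zero_le {E : Type*} [NormedAddCommGroup E] [NormedSpace ℝ E] {r : ℝ}
    (hr : 0 ≤ r) (z : E) : Metric.infDist z {y | ‖y‖ ≤ r} ≤ max 0 (‖z‖ - r) := by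
  rcases le_or_gt ‖z‖ r with h | h
  · rw [Metric.infDist_zero_of_mem (show z ∈ {y : E | ‖y‖ ≤ r} from h)]
    exact le_max_left _ _
  · have hz : 0 < ‖z‖ := hr.trans_lt h
    have hy : (r / ‖z‖) • z ∈ {y : E | ‖y‖ ≤ r} := by
      show ‖_‖ ≤ r
      rw [norm_smul, Real.norm_of_nonneg (by positivity), div_mul_cancel₀ _ hz.ne']
    refine (Metric.infDist_le_dist_of_mem hy).trans (le_max_of_le_right ?_)
    have h1 : z - (r / ‖z‖) • z = (1 - r / ‖z‖) • z := by rw [sub_smul, one_smul]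
    have h2 : r / ‖z‖ ≤ 1 := (div_le_one hz).2 h.le
    rw [dist_eq_norm, h1, norm_smul, Real.norm_of_nonneg (sub_nonneg.2 h2), sub_mul,
      div_mul_cancel₀ _ hz.ne', one_mul]

/-! ### A priori bounds, cut-off and global solutions -/

namespace Design

variable {n m : ℕ} (d : Design n)

theorem norm_le_of_zvec (Θs Θ : d.net.Param) (q v p w : Vec n) :
    ‖q‖ ≤ ‖p‖ + ‖d.zvec Θs q v p w Θ‖ ∧ ‖v‖ ≤ ‖w‖ + (1 + d.k₁) * ‖d.zvec Θs q v p w Θ‖ ∧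
      ‖Θ‖ ≤ ‖Θs‖ + ‖d.zvec Θs q v p w Θ‖ ∧
      ‖p - q‖ ≤ ‖d.zvec Θs q v p w Θ‖ ∧ ‖d.filt q v p w‖ ≤ ‖d.zvec Θs q v p w Θ‖ := by
  have hk := d.k₁_pos
  obtain ⟨h1, h2, h3⟩ := d.norm_le_norm_stack (p - q) (d.filt q v p w) (Θs - Θ)
  rw [← zvec_eq_stack] at h1 h2 h3
  refine ⟨?_, ?_, ?_, h1, h2⟩
  · have := norm_sub_le p (p - q)
    rw [sub_sub_cancel] at this
    linarith
  · have e : v = w - d.filt q v p w + d.k₁ • (p - q) := by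
      rw [filt]; abel
    have h4 : ‖v‖ ≤ ‖w - d.filt q v p w‖ + ‖d.k₁ • (p - q)‖ := by
      conv_lhs => rw [e]
      exact norm_add_le _ _
    rw [norm_smul, Real.norm_of_nonneg hk.le] at h4
    have h5 := norm_sub_le w (d.filt q v p w)
    have h6 := mul_le_mul_of_nonneg_left h1 hk.le
    linarith
  · have := norm_sub_le Θs (Θs - Θ)
    rw [sub_sub_cancel] at this
    linarith

/-- The approximation property on `Ω` bounds the reference acceleration. -/
theorem exists_norm_fd_le (S : Plant n m) {Θs : d.net.Param} {fd : Vec n × Vec n → Vec n}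
    {ρ₀ : ℝ → ℝ} {qb vb εb : ℝ} (hq : 0 ≤ qb) (hv : 0 ≤ vb) (hχ : 0 ≤ d.radius ρ₀ qb vb)
    (hε : ∀ q v p w : Vec n, kap q v p w ∈ d.domOmega ρ₀ qb vb →
        ‖(fd (p, w) - S.f (q, v)) - d.net.Psi (kap q v p w) Θs‖ ≤ εb) :
    ∃ C, ∀ p w : Vec n, ‖p‖ ≤ qb → ‖w‖ ≤ vb → ‖fd (p, w)‖ ≤ C := by
  have hk := d.k₁_pos
  have hc : Continuous (fun x => d.net.Psi x Θs) :=
    d.net.contDiff_Psi.continuous.comp (by fun_prop : Continuous fun x => (x, Θs))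
  obtain ⟨C, hC⟩ := (isCompact_closedBall (0 : Vec (n + n + n + n)) (qb + vb)
    ).exists_bound_of_continuousOn hc.continuousOn
  refine ⟨εb + C + ‖S.f (0, 0)‖, fun p w hp hw => ?_⟩
  have hκ : ‖kap 0 0 p w‖ ≤ qb + vb := by
    have := norm_kap_le 0 0 p w
    simp only [norm_zero, zero_add] at this
    linarith
  -- No regularity of f_d is assumed; setting q = q̇ = 0 gives an input in Ω, and the approximation
  -- hypothesis then bounds f_d. This makes q̇_d Lipschitz.
  have h1 := hε 0 0 p w (by
    show ‖_‖ ≤ _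
    have : 0 ≤ (d.k₁ + 2) * d.radius ρ₀ qb vb := by positivity
    linarith)
  have h2 := hC (kap 0 0 p w) (mem_closedBall_zero_iff.2 hκ)
  have e : fd (p, w) = ((fd (p, w) - S.f (0, 0)) - d.net.Psi (kap 0 0 p w) Θs)
      + d.net.Psi (kap 0 0 p w) Θs + S.f (0, 0) := by abel
  rw [e]
  exact (norm_add_le _ _).trans (add_le_add ((norm_add_le _ _).trans (add_le_add h1 h2)) le_rfl)

/-- A field that agrees with the closed loop on a ball and vanishes outside a larger one. -/
def cutField (S : Plant n m) (R : ℝ) (z : (Vec n × Vec n × Vec n) × d.State) : d.State :=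
  max 0 (min 1 (R + 1 - ‖z.2‖)) • d.field S z

theorem cutField_eq (S : Plant n m) {R : ℝ} {z : (Vec n × Vec n × Vec n) × d.State}
    (hz : ‖z.2‖ ≤ R) : d.cutField S R z = d.field S z := by
  rw [cutField, min_eq_left (by linarith), max_eq_right zero_le_one, one_smul]

theorem locallyLipschitz_cutField (S : Plant n m) (R : ℝ) : LocallyLipschitz (d.cutField S R) := by
  have h1 : LocallyLipschitz (fun z : (Vec n × Vec n × Vec n) × d.State => R + 1 - ‖z.2‖) := by
    have h2 : LocallyLipschitz (fun z : (Vec n × Vec n × Vec n) × d.State => ‖z.2‖) :=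
      (lipschitzWith_one_norm.comp LipschitzWith.prod_snd).locallyLipschitz
    have h3 : ContDiff ℝ 1 (fun y : ℝ => R + 1 - y) := by fun_prop
    exact h3.comp_locallyLipschitz h2
  exact ((h1.const_min 1).const_max 0).smul' (d.locallyLipschitz_field S)

theorem exists_norm_cutField_le (S : Plant n m) (R : ℝ) {s : ℝ → Vec n × Vec n × Vec n} {a b : ℝ}
    (hs : ContinuousOn s (Icc a b)) :
    ∃ M, ∀ t ∈ Icc a b, ∀ x, ‖d.cutField S R (s t, x)‖ ≤ M := by
  obtain ⟨M, hM⟩ := ((isCompact_Icc.image_of_continuousOn hs).prod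
    (isCompact_closedBall (0 : d.State) (R + 1))).exists_bound_of_continuousOn
      (d.locallyLipschitz_field S).continuous.continuousOn
  refine ⟨max M 0, fun t ht x => ?_⟩
  rcases le_or_gt ‖x‖ (R + 1) with h | h
  · have h1 := hM (s t, x) ⟨mem_image_of_mem _ ht, mem_closedBall_zero_iff.2 h⟩
    rw [cutField, norm_smul, Real.norm_of_nonneg (le_max_left _ _)]
    have h2 : max 0 (min 1 (R + 1 - ‖x‖)) ≤ 1 := max_le zero_le_one (min_le_left _ _)
    refine (mul_le_of_le_one_left (norm_nonneg _) h2).trans (h1.trans (le_max_left _ _))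
  · rw [cutField, max_eq_left (min_le_of_right_le (by simp only; linarith)), zero_smul, norm_zero]
    exact le_max_right _ _

section ClosedLoop

variable {d} {S : Plant n m} {Θs : d.net.Param} {fd : Vec n × Vec n → Vec n} {qd vd : ℝ → Vec n}
  {ρ₀ : ℝ → ℝ} {qb vb ωb εb : ℝ}

/-- The closed loop has a solution on each bounded interval, which satisfies the exponential
bound and stays in `𝒟`. -/
theorem exists_caratheodorySol_rhs (hΘs : Θs ∈ d.searchSpace)
    (hlayer : 0 < d.layer → d.P Θs ≤ -d.layer) (hω : ∀ t, 0 ≤ t → ‖S.dist t‖ ≤ ωb)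
    (href : IsReference fd qd vd) (hqb : ∀ t, 0 ≤ t → ‖qd t‖ ≤ qb)
    (hvb : ∀ t, 0 ≤ t → ‖vd t‖ ≤ vb) (hρ : d.IsRemainderBound Θs ρ₀)
    (hε : ∀ q v p w : Vec n, kap q v p w ∈ d.domOmega ρ₀ qb vb →
        ‖(fd (p, w) - S.f (q, v)) - d.net.Psi (kap q v p w) Θs‖ ≤ εb)
    (hgain : d.kmin > d.lamV + 1 / d.k₂ * d.rho ρ₀ qb vb (d.ultRadius ωb εb)) {t₀ t₁ : ℝ}
    (ht₀ : 0 ≤ t₀) (h01 : t₀ ≤ t₁) {x₀ : d.State} (hx₀ : d.parL x₀ ∈ d.searchSpace)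
    (hz₀ : d.zvec Θs (d.fstL x₀) (d.sndL x₀) (qd t₀) (vd t₀) (d.parL x₀)
      ∈ d.domS ρ₀ qb vb ωb εb) :
    ∃ x, x t₀ = x₀ ∧ CaratheodorySol (d.rhs S qd vd) t₀ t₁ x ∧ ∀ t ∈ Icc t₀ t₁,
      d.parL (x t) ∈ d.searchSpace ∧
      ‖d.zvec Θs (d.fstL (x t)) (d.sndL (x t)) (qd t) (vd t) (d.parL (x t))‖ ≤
        d.expBound ωb εb
          ‖d.zvec Θs (d.fstL x₀) (d.sndL x₀) (qd t₀) (vd t₀) (d.parL x₀)‖ (t - t₀) ∧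
      d.zvec Θs (d.fstL (x t)) (d.sndL (x t)) (qd t) (vd t) (d.parL (x t))
        ∈ d.domD ρ₀ qb vb := by
  have hqb0 : 0 ≤ qb := (norm_nonneg _).trans (hqb 0 le_rfl)
  have hvb0 : 0 ≤ vb := (norm_nonneg _).trans (hvb 0 le_rfl)
  have hk := d.k₁_pos
  have hχ := (d.ultRadius_pos ωb εb).trans
    (hρ.radius_spec hqb0 hvb0 (d.ultRadius_pos ωb εb).le hgain).1
  obtain ⟨C, hC⟩ := d.exists_norm_fd_le S hqb0 hvb0 hχ.le hε
  obtain ⟨hqL, hvL⟩ := href.lipschitzOnWith hvb fun t ht => hC _ _ (hqb t ht) (hvb t ht)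
  have hsub : Icc t₀ t₁ ⊆ Ici 0 := fun t ht => ht₀.trans ht.1
  have hs : ContinuousOn (fun t => (S.dist t, qd t, vd t)) (Icc t₀ t₁) :=
    (S.dist_smooth.continuousOn.prodMk
      (href.continuousOn.1.prodMk href.continuousOn.2)).mono hsub
  set χ := d.radius ρ₀ qb vb with hχdef
  -- This bounds the norm of the stacked state whenever z lies in 𝒟, so the cut-off is inactive
  -- there.
  set R : ℝ := (qb + χ) + (vb + (1 + d.k₁) * χ) + (‖Θs‖ + χ) with hR
  obtain ⟨M, hM⟩ := d.exists_norm_cutField_le S R hs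
  obtain ⟨x, hx0, ⟨⟨K, hK⟩, hxd⟩⟩ := d.projData.exists_caratheodorySol
    (d.locallyLipschitz_cutField S R) h01 hs hM d.layer_nonneg d.layer_lt_neg_P_zero (x₀ := x₀) hx₀
  have hxP : ∀ t ∈ Icc t₀ t₁, d.parL (x t) ∈ d.searchSpace :=
    d.projData.P_nonpos_of_ae hK (by rw [hx0]; exact hx₀) hxd
  have hcut : ∀ t ∈ Icc t₀ t₁, d.zvec Θs (d.fstL (x t)) (d.sndL (x t)) (qd t) (vd t)
      (d.parL (x t)) ∈ d.domD ρ₀ qb vb →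
      d.cutField S R ((S.dist t, qd t, vd t), x t) = d.field S ((S.dist t, qd t, vd t), x t) := by
    intro t ht hD
    have hD' : ‖d.zvec Θs (d.fstL (x t)) (d.sndL (x t)) (qd t) (vd t) (d.parL (x t))‖ ≤ χ := hD
    obtain ⟨b1, b2, b3, -⟩ := d.norm_le_of_zvec Θs (d.parL (x t)) (d.fstL (x t)) (d.sndL (x t))
      (qd t) (vd t)
    refine d.cutField_eq S ?_
    have h1 := d.norm_stack_le (d.fstL (x t)) (d.sndL (x t)) (d.parL (x t))
    rw [stack_eta] at h1
    have h2 := mul_le_mul_of_nonneg_left hD' (show 0 ≤ 1 + d.k₁ by positivity)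
    have h3 := hqb t (hsub ht)
    have h4 := hvb t (hsub ht)
    show ‖x t‖ ≤ R
    linarith
  -- The estimate requires the true dynamics only inside 𝒟, so it applies to the cut-off solution.
  -- Its conclusion confines z to 𝒟, and the cut-off solution turns out to solve the closed loop.
  have hbound := d.norm_zvec_le_expBound S hΘs hlayer (w := S.dist) hρ hε hgain
    (fun t ht => hω t (hsub ht)) (fun t ht => hqb t (hsub ht)) (fun t ht => hvb t (hsub ht)) hK
    (hqL.mono hsub) (hvL.mono hsub)
    (fun t ht => (href.hasDerivAt (ht₀.trans_lt ht.1)).1)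
    (fun t ht => (href.hasDerivAt (ht₀.trans_lt ht.1)).2) hxP
    (by
      filter_upwards [hxd] with t htd ht hD
      have h1 := htd ht
      rw [hcut t (Ioo_subset_Icc_self ht) hD] at h1
      exact h1)
    (by rw [hx0]; exact hz₀)
  rw [hx0] at hbound
  refine ⟨x, hx0, ⟨⟨K, hK⟩, ?_⟩, fun t ht => ⟨hxP t ht, hbound t ht⟩⟩
  filter_upwards [hxd] with t htd ht
  have h1 := htd ht
  have ht' := Ioo_subset_Icc_self ht
  rw [hcut t ht' (hbound t ht').2] at h1
  exact h1

/-- Two solutions of the closed loop in the stacked state agree. -/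
theorem eqOn_of_caratheodorySol_rhs {t₀ t₁ : ℝ}
    (hs : ContinuousOn (fun t => (S.dist t, qd t, vd t)) (Icc t₀ t₁)) {x y : ℝ → d.State}
    (hx : CaratheodorySol (d.rhs S qd vd) t₀ t₁ x) (hy : CaratheodorySol (d.rhs S qd vd) t₀ t₁ y)
    (h0 : x t₀ = y t₀) (hx₀ : d.parL (x t₀) ∈ d.searchSpace) : ∀ t ∈ Icc t₀ t₁, x t = y t :=
  d.projData.eqOn_of_caratheodorySol (d.locallyLipschitz_field S) hs d.layer_nonneg
    d.layer_lt_neg_P_zero hx hy h0 hx₀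

/-- The solutions on bounded intervals are glued first. At each time t the bounds are then imported
from the solution on [t₀, t], which coincides with the glued one by uniqueness. -/
theorem exists_forall_caratheodorySol_rhs (hΘs : Θs ∈ d.searchSpace)
    (hlayer : 0 < d.layer → d.P Θs ≤ -d.layer) (hω : ∀ t, 0 ≤ t → ‖S.dist t‖ ≤ ωb)
    (href : IsReference fd qd vd) (hqb : ∀ t, 0 ≤ t → ‖qd t‖ ≤ qb)
    (hvb : ∀ t, 0 ≤ t → ‖vd t‖ ≤ vb) (hρ : d.IsRemainderBound Θs ρ₀)
    (hε : ∀ q v p w : Vec n, kap q v p w ∈ d.domOmega ρ₀ qb vb →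
        ‖(fd (p, w) - S.f (q, v)) - d.net.Psi (kap q v p w) Θs‖ ≤ εb)
    (hgain : d.kmin > d.lamV + 1 / d.k₂ * d.rho ρ₀ qb vb (d.ultRadius ωb εb)) {t₀ : ℝ}
    (ht₀ : 0 ≤ t₀) {x₀ : d.State} (hx₀ : d.parL x₀ ∈ d.searchSpace)
    (hz₀ : d.zvec Θs (d.fstL x₀) (d.sndL x₀) (qd t₀) (vd t₀) (d.parL x₀)
      ∈ d.domS ρ₀ qb vb ωb εb) :
    ∃ x, x t₀ = x₀ ∧ (∀ b, CaratheodorySol (d.rhs S qd vd) t₀ b x) ∧ ∀ t, t₀ ≤ t →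
      d.parL (x t) ∈ d.searchSpace ∧
      ‖d.zvec Θs (d.fstL (x t)) (d.sndL (x t)) (qd t) (vd t) (d.parL (x t))‖ ≤
        d.expBound ωb εb
          ‖d.zvec Θs (d.fstL x₀) (d.sndL x₀) (qd t₀) (vd t₀) (d.parL x₀)‖ (t - t₀) ∧
      d.zvec Θs (d.fstL (x t)) (d.sndL (x t)) (qd t) (vd t) (d.parL (x t))
        ∈ d.domD ρ₀ qb vb := by
  have hs : ContinuousOn (fun t => (S.dist t, qd t, vd t)) (Ici t₀) :=
    (S.dist_smooth.continuousOn.prodMk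
      (href.continuousOn.1.prodMk href.continuousOn.2)).mono (Ici_subset_Ici.2 ht₀)
  have hex := fun (b : ℝ) (hb : t₀ ≤ b) => exists_caratheodorySol_rhs hΘs hlayer hω href hqb hvb
    hρ hε hgain ht₀ hb hx₀ hz₀
  obtain ⟨x, hx0, hx⟩ := d.projData.exists_forall_caratheodorySol (d.locallyLipschitz_field S) hs
    d.layer_nonneg d.layer_lt_neg_P_zero (x₀ := x₀) hx₀ fun b hb => by
      obtain ⟨x, h1, h2, -⟩ := hex b hb
      exact ⟨x, h1, h2⟩
  refine ⟨x, hx0, hx, fun t ht => ?_⟩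
  obtain ⟨y, hy0, hy, hyb⟩ := hex t ht
  have h1 := eqOn_of_caratheodorySol_rhs (hs.mono Icc_subset_Ici_self) (hx t) hy
    (hx0.trans hy0.symm) (hx0 ▸ hx₀) t ⟨ht, le_rfl⟩
  rw [h1]
  exact hyb t ⟨ht, le_rfl⟩

/-- The control input is bounded along bounded errors. -/
theorem exists_norm_control_le (hg : S.GPlusBounded) (hqb : ∀ t, 0 ≤ t → ‖qd t‖ ≤ qb)
    (hvb : ∀ t, 0 ≤ t → ‖vd t‖ ≤ vb) (Θs : d.net.Param) (χ : ℝ) :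
    ∃ B, ∀ t, 0 ≤ t → ∀ (q v : Vec n), ∀ Θ ∈ d.searchSpace,
      ‖d.zvec Θs q v (qd t) (vd t) Θ‖ ≤ χ → ‖d.control S t q v (qd t) (vd t) Θ‖ ≤ B := by
  have hqb0 : 0 ≤ qb := (norm_nonneg _).trans (hqb 0 le_rfl)
  have hvb0 : 0 ≤ vb := (norm_nonneg _).trans (hvb 0 le_rfl)
  have hk1 := d.k₁_pos
  have hk2 := d.k₂_pos
  obtain ⟨M, hM⟩ := hg (max (qb + χ) (vb + (1 + d.k₁) * χ))
  obtain ⟨C, hC⟩ := ((isCompact_closedBall (0 : Vec (n + n + n + n))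
    ((d.k₁ + 2) * χ + 2 * (qb + vb))).prod d.isCompact_searchSpace).exists_bound_of_continuousOn
      d.net.contDiff_Psi.continuous.continuousOn
  -- The entry bound `M` may be negative when the matrix has no entries, hence `max M 0`.
  refine ⟨Fintype.card (Fin m) * (Fintype.card (Fin n) *
    (max M 0 * (|1 - d.k₁ ^ 2| * χ + (d.k₁ + d.k₂) * χ + C))), fun t ht q v Θ hΘ hz => ?_⟩
  obtain ⟨b1, b2, -, b4, b5⟩ := d.norm_le_of_zvec Θs Θ q v (qd t) (vd t)
  have h2 := mul_le_mul_of_nonneg_left hz (show 0 ≤ 1 + d.k₁ by positivity)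
  have hgM := hM q v t (le_max_of_le_left (by linarith [hqb t ht]))
    (le_max_of_le_right (by linarith [hvb t ht])) ht
  have hκ : ‖kap q v (qd t) (vd t)‖ ≤ (d.k₁ + 2) * χ + 2 * (qb + vb) :=
    (d.norm_kap_le_zvec (hqb t ht) (hvb t ht)).trans (by gcongr)
  have hΨ := hC (kap q v (qd t) (vd t), Θ) ⟨mem_closedBall_zero_iff.2 hκ, hΘ⟩
  refine (norm_mv_le (fun a c => (hgM a c).trans (le_max_left M 0)) _).trans ?_
  have h3 : ‖(1 - d.k₁ ^ 2) • (qd t - q)‖ ≤ |1 - d.k₁ ^ 2| * χ := by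
    rw [norm_smul, Real.norm_eq_abs]
    exact mul_le_mul_of_nonneg_left (b4.trans hz) (abs_nonneg _)
  have h4 : ‖(d.k₁ + d.k₂) • d.filt q v (qd t) (vd t)‖ ≤ (d.k₁ + d.k₂) * χ := by
    rw [norm_smul, Real.norm_of_nonneg (by positivity)]
    exact mul_le_mul_of_nonneg_left (b5.trans hz) (by positivity)
  have h5 := (norm_add_le _ _).trans (add_le_add ((norm_add_le _ _).trans (add_le_add h3 h4)) hΨ)
  have := le_max_right M 0
  gcongr

theorem tendsto_infDist_domU {z : ℝ → d.State} {t₀ y : ℝ}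
    (hz : ∀ t, t₀ ≤ t → ‖z t‖ ≤ d.expBound ωb εb y (t - t₀)) :
    Tendsto (fun t => Metric.infDist (z t) (d.domU ωb εb)) atTop (𝓝 0) := by
  have h1 : Tendsto (fun t => max 0 (d.expBound ωb εb y (t - t₀) - d.ultRadius ωb εb)) atTop
      (𝓝 0) := by
    have h2 := (tendsto_const_nhds (x := (0 : ℝ))).max
      ((d.tendsto_expBound (ωb := ωb) (εb := εb) y t₀).sub_const (d.ultRadius ωb εb))
    rwa [sub_self, max_self] at h2
  refine tendsto_of_tendsto_of_tendsto_of_le_of_le' tendsto_const_nhds h1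
    (Eventually.of_forall fun t => Metric.infDist_nonneg) ?_
  filter_upwards [eventually_ge_atTop t₀] with t ht
  refine (infDist_closedBall_zero_le (d.ultRadius_pos ωb εb).le (z t)).trans ?_
  gcongr
  exact hz t ht

end ClosedLoop

end Design

end

/-! ### The main theorem -/

theorem theorem1 {n m : ℕ} (S : Plant n m) (hg : S.GPlusBounded)
    (ωb : ℝ) (hω : ∀ t, 0 ≤ t → ‖S.dist t‖ ≤ ωb)
    (fd : Vec n × Vec n → Vec n) (qd vd : ℝ → Vec n) (href : IsReference fd qd vd)
    (qb vb : ℝ) (hqb : ∀ t, 0 ≤ t → ‖qd t‖ ≤ qb) (hvb : ∀ t, 0 ≤ t → ‖vd t‖ ≤ vb)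
    (d : Design n)
    (J : d.net.Param → ℝ) (hJ_nonneg : ∀ Θ ∈ d.searchSpace, 0 ≤ J Θ)
    (hJ_cont : ContinuousOn J d.searchSpace) (hJ_conv : StrictConvexOn ℝ d.searchSpace J)
    (Θs : d.net.Param) (hΘs : Θs ∈ d.searchSpace) (hΘs_min : IsMinOn J d.searchSpace Θs)
    (hlayer : 0 < d.layer → d.P Θs ≤ -d.layer) :
    -- remainder bounds exist, and are quadratic for activations with bounded derivatives
    (∃ ρ₀ : ℝ → ℝ, d.IsRemainderBound Θs ρ₀) ∧
    (d.net.BoundedDerivs → ∃ a₀ a₁ a₂ : ℝ, 0 ≤ a₀ ∧ 0 ≤ a₁ ∧ 0 ≤ a₂ ∧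
      d.IsRemainderBound Θs (fun s => a₂ * s ^ 2 + a₁ * s + a₀)) ∧
    ∀ ρ₀ : ℝ → ℝ, d.IsRemainderBound Θs ρ₀ →
    ∀ εb : ℝ, (∀ q v p w : Vec n, kap q v p w ∈ d.domOmega ρ₀ qb vb →
        ‖(fd (p, w) - S.f (q, v)) - d.net.Psi (kap q v p w) Θs‖ ≤ εb) →
    d.kmin > d.lamV + 1 / d.k₂ * d.rho ρ₀ qb vb (d.ultRadius ωb εb) →
    ∀ t₀ : ℝ, 0 ≤ t₀ → ∀ (q₀ v₀ : Vec n), ∀ Θ₀ ∈ d.searchSpace,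
    d.zvec Θs q₀ v₀ (qd t₀) (vd t₀) Θ₀ ∈ d.domS ρ₀ qb vb ωb εb →
    ∃ (q v : ℝ → Vec n) (Θ : ℝ → d.net.Param),
      -- the solution exists for all time
      d.IsSolution S qd vd t₀ (Ici t₀) q v Θ ∧ q t₀ = q₀ ∧ v t₀ = v₀ ∧ Θ t₀ = Θ₀ ∧
      -- it is the only one
      (∀ (T : ℝ) (q' v' : ℝ → Vec n) (Θ' : ℝ → d.net.Param),
        d.IsSolution S qd vd t₀ (Ico t₀ T) q' v' Θ' → q' t₀ = q₀ → v' t₀ = v₀ → Θ' t₀ = Θ₀ →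
        ∀ t ∈ Ico t₀ T, q' t = q t ∧ v' t = v t ∧ Θ' t = Θ t) ∧
      -- it satisfies the bound and stays in the domains
      (∀ t, t₀ ≤ t →
        ‖d.zvec Θs (q t) (v t) (qd t) (vd t) (Θ t)‖
          ≤ d.expBound ωb εb ‖d.zvec Θs q₀ v₀ (qd t₀) (vd t₀) Θ₀‖ (t - t₀) ∧
        d.zvec Θs (q t) (v t) (qd t) (vd t) (Θ t) ∈ d.domD ρ₀ qb vb ∧
        kap (q t) (v t) (qd t) (vd t) ∈ d.domOmega ρ₀ qb vb ∧
        Θ t ∈ d.searchSpace) ∧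
      -- it converges to the ultimate bound
      Tendsto (fun t => Metric.infDist (d.zvec Θs (q t) (v t) (qd t) (vd t) (Θ t))
        (d.domU ωb εb)) atTop (𝓝 0) ∧
      -- all signals are bounded
      ∃ B : ℝ, ∀ t, t₀ ≤ t → ‖q t‖ ≤ B ∧ ‖v t‖ ≤ B ∧ ‖Θ t‖ ≤ B ∧
        ‖d.zvec Θs (q t) (v t) (qd t) (vd t) (Θ t)‖ ≤ B ∧
        ‖kap (q t) (v t) (qd t) (vd t)‖ ≤ B ∧
        ‖d.control S t (q t) (v t) (qd t) (vd t) (Θ t)‖ ≤ B := by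
  refine ⟨d.exists_isRemainderBound hΘs, fun hN => d.exists_quadratic_isRemainderBound hN hΘs, ?_⟩
  intro ρ₀ hρ εb hε hgain t₀ ht₀ q₀ v₀ Θ₀ hΘ₀ hz₀
  have hs : ContinuousOn (fun t => (S.dist t, qd t, vd t)) (Ici t₀) :=
    (S.dist_smooth.continuousOn.prodMk
      (href.continuousOn.1.prodMk href.continuousOn.2)).mono (Ici_subset_Ici.2 ht₀)
  obtain ⟨x, hx0, hx, hxb⟩ := Design.exists_forall_caratheodorySol_rhs (x₀ := d.stack q₀ v₀ Θ₀)
    hΘs hlayer hω href hqb hvb hρ hε hgain ht₀ hΘ₀ hz₀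
  simp only [Design.fstL_stack, Design.sndL_stack, Design.parL_stack] at hxb
  have hΩ : ∀ t, t₀ ≤ t → kap (d.fstL (x t)) (d.sndL (x t)) (qd t) (vd t)
      ∈ d.domOmega ρ₀ qb vb := by
    intro t ht
    have hk := d.k₁_pos
    have h1 := d.norm_kap_le_zvec (Θs := Θs) (Θ := d.parL (x t)) (q := d.fstL (x t))
      (v := d.sndL (x t)) (hqb t (ht₀.trans ht)) (hvb t (ht₀.trans ht))
    have h2 := mul_le_mul_of_nonneg_left
      (show ‖_‖ ≤ d.radius ρ₀ qb vb from (hxb t ht).2.2) (show 0 ≤ d.k₁ + 2 by positivity)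
    show ‖_‖ ≤ _
    linarith
  refine ⟨fun t => d.fstL (x t), fun t => d.sndL (x t), fun t => d.parL (x t),
    Design.isSolution_of_caratheodorySol ht₀ hs hx, by simp [hx0], by simp [hx0], by simp [hx0],
    fun T q' v' Θ' h hq hv hΘ t ht => ?_,
    fun t ht => ⟨(hxb t ht).2.1, (hxb t ht).2.2, hΩ t ht, (hxb t ht).1⟩,
    Design.tendsto_infDist_domU fun t ht => (hxb t ht).2.1, ?_⟩
  -- Uniqueness is local in time: each t < T is handled on the compact interval [t₀, t], where the
  -- competing solution is Lipschitz.
  · have hy := h.caratheodorySol ht.1 (Icc_subset_Ico_right ht.2) ht₀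
      (hs.mono Icc_subset_Ici_self)
    have heq := Design.eqOn_of_caratheodorySol_rhs (hs.mono Icc_subset_Ici_self) (hx t) hy
      (by rw [hx0, hq, hv, hΘ]) (by rw [hx0]; exact hΘ₀) t ⟨ht.1, le_rfl⟩
    beta_reduce
    rw [heq]
    exact ⟨rfl, rfl, rfl⟩
  · obtain ⟨Bu, hBu⟩ := Design.exists_norm_control_le hg hqb hvb Θs (d.radius ρ₀ qb vb)
    set χ := d.radius ρ₀ qb vb with hχ
    have hk := d.k₁_pos
    let B := max (max (max (qb + χ) (vb + (1 + d.k₁) * χ)) (max d.thetaBar χ))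
      (max (2 * (qb + vb) + (d.k₁ + 2) * χ) Bu)
    refine ⟨B, fun t ht => ?_⟩
    have h0 := ht₀.trans ht
    obtain ⟨hP, -, hD⟩ := hxb t ht
    have hz : ‖d.zvec Θs (d.fstL (x t)) (d.sndL (x t)) (qd t) (vd t) (d.parL (x t))‖ ≤ χ := hD
    obtain ⟨b1, b2, -⟩ := d.norm_le_of_zvec Θs (d.parL (x t)) (d.fstL (x t)) (d.sndL (x t))
      (qd t) (vd t)
    have h2 := mul_le_mul_of_nonneg_left hz (show 0 ≤ 1 + d.k₁ by positivity)
    have c1 : ‖d.fstL (x t)‖ ≤ qb + χ := by linarith [hqb t h0]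
    have c2 : ‖d.sndL (x t)‖ ≤ vb + (1 + d.k₁) * χ := by linarith [hvb t h0]
    exact ⟨le_max_of_le_left (le_max_of_le_left (le_max_of_le_left c1)),
      le_max_of_le_left (le_max_of_le_left (le_max_of_le_right c2)),
      le_max_of_le_left (le_max_of_le_right (le_max_of_le_left (d.norm_le_thetaBar hP))),
      le_max_of_le_left (le_max_of_le_right (le_max_of_le_right hz)),
      le_max_of_le_right (le_max_of_le_left (hΩ t ht)),
      le_max_of_le_right (le_max_of_le_right (hBu t h0 _ _ _ hP hz))⟩
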